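/- Let $(\mathcal{M},g_{ab})$ be a smooth four-dimensional real Lorentzian manifold of signature $(+,-,-,-)$ that is Einstein ($R_{ab}=k\,g_{ab}$ with a constant $k$) and is equipped with a spinor structure: a smooth complex rank-two bundle $\mathbb{S}$ with symplectic form $\epsilon_{AB}$, with complex conjugate bundle $\mathbb{S}'$, and with an identification $T\mathcal{M}\otimes\mathbb{C}\cong\mathbb{S}\otimes\mathbb{S}'$, compatible with complex conjugation, such that $g_{ab}=\epsilon_{AB}\bar\epsilon_{A'B'}$. Let $\nabla_{AA'}$ be the Levi-Civita connection and its lift to spinors. Let $\Psi_{ABCD}=\Psi_{(ABCD)}$ be the Weyl spinor. Spinor indices are raised and lowered by $\psi^A=\epsilon^{AB}\psi_B$, $\psi_B=\psi^A\epsilon_{AB}$. On an open set $U\subseteq\mathcal{M}$ let $(o^A,\iota^A)$ be a smooth spin dyad, $o_A\iota^A=1$. Suppose that on $U$ the Weyl spinor is of Petrov type II with repeated principal spinor $o_A$; all that is used of this is that $o_A$ is a principal spinor of multiplicity exactly two, $\Psi_{ABCD}o^Ao^Bo^C=0\ne\Psi_{ABCD}o^Ao^B$, so that type D is allowed too. Put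 $\Psi_2=\Psi_{ABCD}o^Ao^B\iota^C\iota^D$ and $\Psi_3=\Psi_{ABCD}o^A\iota^B\iota^C\iota^D$, and let $\Psi_2^{1/3}$ be any smooth branch of the cube root of $\Psi_2$ on $U$, with $\Psi_2^{-1/3}=(\Psi_2^{1/3})^{-1}$ and $\Psi_2^{-4/3}=(\Psi_2^{1/3})^{-4}$. Define $$K_{AB}=\Psi_2^{-1/3}\,o_{(A}\iota_{B)}-\tfrac13\,\Psi_2^{-4/3}\,\Psi_3\,o_Ao_B,\qquad \xi_{AA'}=\nabla^B{}_{A'}K_{AB}.$$ Then, on $U$: 1. $K_{AB}$ solves the projected Killing spinor equation $o^A\nabla_{A'(A}K_{BC)}=0$; 2. $\xi_{AA'}$ solves the projected Killing equation $o^A\left(\nabla_{AA'}\xi_{BB'}+\nabla_{BB'}\xi_{AA'}\right)=0$. -/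

import Mathlib

open Bundle
open scoped Manifold ContDiff ComplexConjugate

noncomputable section

/-- The model space of a four-dimensional manifold. -/
abbrev R4 := EuclideanSpace ℝ (Fin 4)

/-- The model fibre of the bundle of unprimed spinors. -/
abbrev C2 := Fin 2 → ℂ

/-- A smooth metric of signature `(+,-,-,-)` on a four-dimensional manifold. -/
structure LorentzMetric (M : Type*) [TopologicalSpace M] [ChartedSpace R4 M]
    [IsManifold (𝓡 4) ∞ M] where
  /-- the scalar product on each tangent space -/
  inner : ∀ x : M, TangentSpace (𝓡 4) x →L[ℝ] TangentSpace (𝓡 4) x →L[ℝ] ℝ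
  symm : ∀ (x : M) (v w : TangentSpace (𝓡 4) x), inner x v w = inner x w v
  signature : ∀ x : M, ∃ b : Module.Basis (Fin 4) ℝ (TangentSpace (𝓡 4) x), ∀ i j,
    inner x (b i) (b j) = if i = j then (if i = 0 then 1 else -1) else 0
  contMDiff : ContMDiff (𝓡 4) ((𝓡 4).prod 𝓘(ℝ, R4 →L[ℝ] R4 →L[ℝ] ℝ)) ∞
    (fun x : M ↦ TotalSpace.mk' (R4 →L[ℝ] R4 →L[ℝ] ℝ) x (inner x))

section Tensors

variable {M : Type*} [TopologicalSpace M] [ChartedSpace R4 M] [IsManifold (𝓡 4) ∞ M]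

/-- `nabla` is the Levi-Civita connection of `g`: smooth, torsion-free and metric. -/
structure IsLeviCivita (g : LorentzMetric M)
    (nabla : CovariantDerivative (𝓡 4) R4 (TangentSpace (𝓡 4) : M → Type _)) : Prop where
  smooth : ∀ U : Set M, IsOpen U → ContMDiffCovariantDerivativeOn R4 ∞ nabla.toFun U
  torsion_free : ∀ (X Y : ∀ x : M, TangentSpace (𝓡 4) x) (x : M),
    MDifferentiableAt (𝓡 4) ((𝓡 4).prod 𝓘(ℝ, R4)) (fun y ↦ TotalSpace.mk' R4 y (X y)) x →
    MDifferentiableAt (𝓡 4) ((𝓡 4).prod 𝓘(ℝ, R4)) (fun y ↦ TotalSpace.mk' R4 y (Y y)) x →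
    nabla Y x (X x) - nabla X x (Y x) = VectorField.mlieBracket (𝓡 4) X Y x
  metric : ∀ (X Y : ∀ x : M, TangentSpace (𝓡 4) x) (x : M),
    MDifferentiableAt (𝓡 4) ((𝓡 4).prod 𝓘(ℝ, R4)) (fun y ↦ TotalSpace.mk' R4 y (X y)) x →
    MDifferentiableAt (𝓡 4) ((𝓡 4).prod 𝓘(ℝ, R4)) (fun y ↦ TotalSpace.mk' R4 y (Y y)) x →
    ∀ v : TangentSpace (𝓡 4) x,
      mvfderiv (𝓡 4) (fun y ↦ g.inner y (X y) (Y y)) x v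
        = g.inner x (nabla X x v) (Y x) + g.inner x (X x) (nabla Y x v)

/-- The Riemann tensor `R(u,v)w = ∇_u ∇_v w - ∇_v ∇_u w - ∇_[u,v] w` at `x`; the tangent vectors are
extended to local vector fields, and the result does not depend on the extension. -/
def riemann (nabla : CovariantDerivative (𝓡 4) R4 (TangentSpace (𝓡 4) : M → Type _)) (x : M)
    (u v w : TangentSpace (𝓡 4) x) : TangentSpace (𝓡 4) x :=
  letI X : ∀ y : M, TangentSpace (𝓡 4) y := FiberBundle.extend R4 u
  letI Y : ∀ y : M, TangentSpace (𝓡 4) y := FiberBundle.extend R4 v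
  letI Z : ∀ y : M, TangentSpace (𝓡 4) y := FiberBundle.extend R4 w
  nabla (fun y ↦ nabla Z y (Y y)) x u - nabla (fun y ↦ nabla Z y (X y)) x v
    - nabla Z x (VectorField.mlieBracket (𝓡 4) X Y x)

/-- The Ricci tensor `R_ab = R_acb^c`, that is, the trace of `u ↦ R(v,u)w`. (A tangent space of `M`
is a copy of `R4`; the trace is computed in the standard basis.) -/
def ricci (nabla : CovariantDerivative (𝓡 4) R4 (TangentSpace (𝓡 4) : M → Type _)) (x : M)
    (v w : TangentSpace (𝓡 4) x) : ℝ :=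
  ∑ i : Fin 4, (EuclideanSpace.basisFun (Fin 4) ℝ).toBasis.coord i
    (riemann nabla x v ((EuclideanSpace.basisFun (Fin 4) ℝ).toBasis i) w)

/-- `g`, with Levi-Civita connection `nabla`, is an Einstein metric:
the Ricci tensor is a constant multiple of the metric. -/
def IsEinstein (g : LorentzMetric M)
    (nabla : CovariantDerivative (𝓡 4) R4 (TangentSpace (𝓡 4) : M → Type _)) : Prop :=
  ∃ k : ℝ, ∀ (x : M) (v w : TangentSpace (𝓡 4) x), ricci nabla x v w = k * g.inner x v w

end Tensors

section Spinors

variable {M : Type*} [TopologicalSpace M] [ChartedSpace R4 M] [IsManifold (𝓡 4) ∞ M]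
  {S : M → Type*} [TopologicalSpace (TotalSpace C2 S)]
  [∀ x, AddCommGroup (S x)] [∀ x, Module ℝ (S x)] [∀ x, Module ℂ (S x)]
  [∀ x, IsScalarTower ℝ ℂ (S x)] [∀ x, TopologicalSpace (S x)]
  [∀ x, IsTopologicalAddGroup (S x)] [∀ x, ContinuousSMul ℝ (S x)]
  [FiberBundle C2 S] [VectorBundle ℝ C2 S]

/-- The section `s` of the bundle `S` is smooth on `U`. -/
def SmoothSpinorOn (s : ∀ x, S x) (U : Set M) : Prop :=
  ContMDiffOn (𝓡 4) ((𝓡 4).prod 𝓘(ℝ, C2)) ∞ (fun x ↦ TotalSpace.mk' C2 x (s x)) U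

/-- The section `s` of the bundle `S` is differentiable at `x`. -/
def DiffSpinorAt (s : ∀ x, S x) (x : M) : Prop :=
  MDifferentiableAt (𝓡 4) ((𝓡 4).prod 𝓘(ℝ, C2)) (fun x ↦ TotalSpace.mk' C2 x (s x)) x

variable (S) in
/-- A spinor structure for `(M, g)` on a complex rank two bundle `S`: a symplectic form
`ε_AB` on `S` and an identification of `TM ⊗ ℂ` with the tensor product of `S` with its complex
conjugate `S'`, such that `g_ab = ε_AB ε_A'B'`.

The identification is given by `vec`: `vec a b` is the real part of the complex vector
`a^A (conj b)^A'`, so that this vector itself is `vec a b - i vec (i a) b`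
(see `SpinStructure.cext`); in particular `vec a a` is the real null vector `a^A (conj a)^A'`.
By polarization, `inner_vec` is `g_ab = ε_AB ε_A'B'`. It makes `vec` span the tangent space. -/
structure SpinStructure (g : LorentzMetric M) where
  /-- the symplectic form `ε_AB a^A b^B` -/
  eps : ∀ x, S x →ₗ[ℂ] S x →ₗ[ℂ] ℂ
  /-- the real part of `a^A (conj b)^A'` -/
  vec : ∀ x, S x →ₗ[ℝ] S x →ₗ[ℝ] TangentSpace (𝓡 4) x
  eps_self : ∀ x (a : S x), eps x a a = 0
  eps_nondegenerate : ∀ x (a : S x), a ≠ 0 → ∃ b, eps x a b ≠ 0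
  vec_symm : ∀ x (a b : S x), vec x a b = vec x b a
  vec_I_smul : ∀ x (a b : S x), vec x (Complex.I • a) (Complex.I • b) = vec x a b
  inner_vec : ∀ x (a b : S x), g.inner x (vec x a a) (vec x b b) = ‖eps x a b‖ ^ 2
  eps_smooth : ∀ (U : Set M), IsOpen U → ∀ s t : ∀ x, S x,
    SmoothSpinorOn s U → SmoothSpinorOn t U →
      ContMDiffOn (𝓡 4) 𝓘(ℝ, ℂ) ∞ (fun x ↦ eps x (s x) (t x)) U
  vec_smooth : ∀ (U : Set M), IsOpen U → ∀ s t : ∀ x, S x,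
    SmoothSpinorOn s U → SmoothSpinorOn t U →
      ContMDiffOn (𝓡 4) ((𝓡 4).prod 𝓘(ℝ, R4)) ∞
        (fun x ↦ TotalSpace.mk' R4 x (vec x (s x) (t x))) U

variable {g : LorentzMetric M}

/-- `D` is the spinor covariant derivative `∇_AA'`, the lift to `S` of the Levi-Civita
connection `nabla`: it is smooth and complex linear, and `ε_AB` and the identification of `TM ⊗ ℂ`
with `S ⊗ S'` are parallel. -/
structure SpinStructure.IsSpinConnection (σ : SpinStructure S g)
    (nabla : CovariantDerivative (𝓡 4) R4 (TangentSpace (𝓡 4) : M → Type _))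
    (D : CovariantDerivative (𝓡 4) C2 S) : Prop where
  smooth : ∀ U : Set M, IsOpen U → ContMDiffCovariantDerivativeOn C2 ∞ D.toFun U
  complex_linear : ∀ (s : ∀ x, S x) (x : M), DiffSpinorAt s x →
    ∀ v : TangentSpace (𝓡 4) x, D (fun y ↦ Complex.I • s y) x v = Complex.I • D s x v
  eps_parallel : ∀ (s t : ∀ x, S x) (x : M), DiffSpinorAt s x → DiffSpinorAt t x →
    ∀ v : TangentSpace (𝓡 4) x,
      mvfderiv (𝓡 4) (fun y ↦ σ.eps y (s y) (t y)) x v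
        = σ.eps x (D s x v) (t x) + σ.eps x (s x) (D t x v)
  vec_parallel : ∀ (s t : ∀ x, S x) (x : M), DiffSpinorAt s x → DiffSpinorAt t x →
    ∀ v : TangentSpace (𝓡 4) x,
      nabla (fun y ↦ σ.vec y (s y) (t y)) x v
        = σ.vec x (D s x v) (t x) + σ.vec x (s x) (D t x v)

/-- The value at the complex tangent vector `a^A (conj b)^A'` of the complex linear extension
of a real linear `L : T_x M → ℂ`, that is, the spinor component `L_AA' a^A (conj b)^A'`. -/
def SpinStructure.cext (σ : SpinStructure S g) {x : M} (L : TangentSpace (𝓡 4) x → ℂ)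
    (a b : S x) : ℂ :=
  L (σ.vec x a b) - Complex.I * L (σ.vec x (Complex.I • a) b)

/-- `p, q` is a spin dyad at `x`: `p_A q^A = ε_AB p^A q^B = 1`. -/
def SpinStructure.IsDyad (σ : SpinStructure S g) {x : M} (p q : S x) : Prop :=
  σ.eps x p q = 1

/-- The contraction `ε^AB f_AB`, where `ε^AB = p^A q^B - q^A p^B` for any spin dyad `p, q`.
The same expression is `ε^A'B' f_A'B'` when the arguments of `f` stand for the conjugates. -/
def epsContract {x : M} (p q : S x) (f : S x → S x → ℂ) : ℂ := f p q - f q p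

/-- The Riemann tensor `R_abcd = g(R(u,v)w,z)` on the complex vectors
`a (conj a')`, `b (conj b')`, `c (conj c')`, `d (conj d')`. -/
def SpinStructure.riemannSpinor (σ : SpinStructure S g)
    (nabla : CovariantDerivative (𝓡 4) R4 (TangentSpace (𝓡 4) : M → Type _)) {x : M}
    (a a' b b' c c' d d' : S x) : ℂ :=
  σ.cext (fun u ↦ σ.cext (fun v ↦ σ.cext (fun w ↦ σ.cext (fun z ↦
    ((g.inner x (riemann nabla x u v w) z : ℝ) : ℂ)) d d') c c') b b') a a'

/-- The curvature spinor `X_ABCD = (1/4) R_AA'BB'CC'DD' ε^A'B' ε^C'D'`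
(`p, q` is any spin dyad at `x`). -/
def SpinStructure.curvatureSpinor (σ : SpinStructure S g)
    (nabla : CovariantDerivative (𝓡 4) R4 (TangentSpace (𝓡 4) : M → Type _)) {x : M}
    (p q a b c d : S x) : ℂ :=
  (1 / 4) * epsContract p q (fun a' b' ↦ epsContract p q (fun c' d' ↦
    σ.riemannSpinor nabla a a' b b' c c' d d'))

/-- The Weyl spinor `Ψ_ABCD = X_(ABCD)`. Since `X_ABCD` is symmetric in `AB`, in `CD` and under
exchange of the two pairs, three terms give the total symmetrization. -/
def SpinStructure.weylSpinor (σ : SpinStructure S g)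
    (nabla : CovariantDerivative (𝓡 4) R4 (TangentSpace (𝓡 4) : M → Type _)) {x : M}
    (p q a b c d : S x) : ℂ :=
  (σ.curvatureSpinor nabla p q a b c d + σ.curvatureSpinor nabla p q a c b d
    + σ.curvatureSpinor nabla p q a d b c) / 3

/-- The first member `o` of the spin dyad `o, ι` is a principal spinor of `Ψ_ABCD` of multiplicity
exactly two: `Ψ_ABCD o^A o^B o^C = 0` and `Ψ_ABCD o^A o^B ≠ 0`. So the Weyl spinor is of
Petrov type II (or D, if the two other principal spinors coincide as well) with repeated
principal spinor `o`. -/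
def SpinStructure.IsDoublePrincipal (σ : SpinStructure S g)
    (nabla : CovariantDerivative (𝓡 4) R4 (TangentSpace (𝓡 4) : M → Type _)) {x : M}
    (o ι : S x) : Prop :=
  (∀ d, σ.weylSpinor nabla o ι o o o d = 0) ∧ ∃ c d, σ.weylSpinor nabla o ι o o c d ≠ 0

/-- The Weyl scalar `Ψ_2 = Ψ_ABCD o^A o^B ι^C ι^D`. -/
def SpinStructure.weyl2 (σ : SpinStructure S g)
    (nabla : CovariantDerivative (𝓡 4) R4 (TangentSpace (𝓡 4) : M → Type _)) {x : M}
    (o ι : S x) : ℂ := σ.weylSpinor nabla o ι o o ι ι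

/-- The Weyl scalar `Ψ_3 = Ψ_ABCD o^A ι^B ι^C ι^D`. -/
def SpinStructure.weyl3 (σ : SpinStructure S g)
    (nabla : CovariantDerivative (𝓡 4) R4 (TangentSpace (𝓡 4) : M → Type _)) {x : M}
    (o ι : S x) : ℂ := σ.weylSpinor nabla o ι o ι ι ι

/-- The covariant derivative `∇_v T` of a field `T` of forms on pairs of spinors, by the
Leibniz rule: `(∇_v T)(a,b) = v (T(a,b)) - T(∇_v a, b) - T(a, ∇_v b)`, the spinors being extended
to local spinor fields (the result does not depend on the extension). It serves for `T_AB`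
(complex bilinear) and for `T_AA'` (conjugate linear in the second argument). -/
def covDeriv (D : CovariantDerivative (𝓡 4) C2 S) (T : ∀ x, S x → S x → ℂ) (x : M)
    (v : TangentSpace (𝓡 4) x) (a b : S x) : ℂ :=
  mvfderiv (𝓡 4) (fun y ↦ T y (FiberBundle.extend C2 a y) (FiberBundle.extend C2 b y)) x v
    - T x (D (FiberBundle.extend C2 a) x v) b - T x a (D (FiberBundle.extend C2 b) x v)

/-- The spinor components `(∇_CC' T)(a, b) c^C (conj c')^C'` of the covariant derivative. -/
def SpinStructure.spinorDeriv (σ : SpinStructure S g) (D : CovariantDerivative (𝓡 4) C2 S)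
    (T : ∀ x, S x → S x → ℂ) (x : M) (c c' a b : S x) : ℂ :=
  σ.cext (fun v ↦ covDeriv D T x v a b) c c'

/-- `K_AB = Ψ_2^(-1/3) o_(A ι_B) - (1/3) Ψ_2^(-4/3) Ψ_3 o_A o_B`, where `φ` is the chosen branch
of `Ψ_2^(1/3)` and `o_A a^A = ε(o,a)`. -/
def SpinStructure.killingSpinor (σ : SpinStructure S g)
    (nabla : CovariantDerivative (𝓡 4) R4 (TangentSpace (𝓡 4) : M → Type _))
    (o ι : ∀ x, S x) (φ : M → ℂ) (x : M) (a b : S x) : ℂ :=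
  (φ x)⁻¹ * ((1 / 2) * (σ.eps x (o x) a * σ.eps x (ι x) b + σ.eps x (ι x) a * σ.eps x (o x) b))
    - (1 / 3) * ((φ x)⁻¹ ^ 4 * σ.weyl3 nabla (o x) (ι x) * (σ.eps x (o x) a * σ.eps x (o x) b))

/-- `ξ_AA' = ∇^B_A' K_AB = ε^BC ∇_CA' K_AB` (for a spin dyad field `o, ι`). -/
def SpinStructure.divergence (σ : SpinStructure S g) (D : CovariantDerivative (𝓡 4) C2 S)
    (o ι : ∀ x, S x) (K : ∀ x, S x → S x → ℂ) (x : M) (a a' : S x) : ℂ :=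
  epsContract (o x) (ι x) (fun b c ↦ σ.spinorDeriv D K x c a' a b)

/-- The projected Killing spinor equation `o^A ∇_A'(A K_BC) = 0` at `x`, for symmetric `K`. -/
def SpinStructure.ProjectedKillingSpinorEq (σ : SpinStructure S g)
    (D : CovariantDerivative (𝓡 4) C2 S) (o : ∀ x, S x) (K : ∀ x, S x → S x → ℂ) (x : M) : Prop :=
  ∀ a' b c : S x,
    (1 / 3) * (σ.spinorDeriv D K x (o x) a' b c + σ.spinorDeriv D K x b a' c (o x)
      + σ.spinorDeriv D K x c a' (o x) b) = 0

/-- The projected Killing equation `o^A (∇_AA' ξ_BB' + ∇_BB' ξ_AA') = 0` at `x`. -/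
def SpinStructure.ProjectedKillingEq (σ : SpinStructure S g)
    (D : CovariantDerivative (𝓡 4) C2 S) (o : ∀ x, S x) (ξ : ∀ x, S x → S x → ℂ) (x : M) : Prop :=
  ∀ a' b b' : S x,
    σ.spinorDeriv D ξ x (o x) a' b b' + σ.spinorDeriv D ξ x b b' (o x) a' = 0

end Spinors

end

set_option linter.unusedSectionVars false
set_option linter.unusedSimpArgs false

/-! Take the dyad `e₀ = o`, `e₁ = ι` and the null tetrad `e_i (conj e_j)`. Write `E i j` for the
derivative along a tetrad vector and `Γ i j k m` for the spin coefficients. The theorem is then a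
statement about finitely many functions. They obey the commutators of the `E i j` (no torsion) and
the Ricci identities, which express the derivatives of `Γ` by the curvature spinor. In an Einstein
space that spinor consists of `Ψ_n` and a constant `Λ`. This calculus is axiomatized over a
commutative ring in `SpinCoefficients`, and the decisive computations are polynomial identities
there.

The second Bianchi identity `∇^A_A' Ψ_ABCD = 0` is an integrability condition of the Ricci
identities. With `Ψ_0 = Ψ_1 = 0` its `ooo` components read `Γ 0 j 0 1 * Ψ_2 = 0`, so `o` is geodesic
and shear-free, as in the Goldberg–Sachs theorem (`shear_free`). The `ooi` components then say that
`Ψ_2` has logarithmic derivative `-3 Γ 1 j 0 1` along `e₀ (conj e_j)`, and the `oii` components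
relate the derivative of `Ψ_3` in these directions to that of `Ψ_2` along `e₁ (conj e_j)`. The
components of `o^A ∇_A'(A K_BC) = 0` are the same equations after substituting `K_01 = -Ψ_2^(-1/3) /
2` and `K_11 = -Ψ_2^(-4/3) Ψ_3 / 3` (`isProjectedKillingSpinor`).

For the second claim, the first one reduces the divergence to `ξ_0j = -3 E_0j K_01` and `ξ_1j = 3
(E_1j K_01 - Γ 1 j 0 1 * K_11)`. The projected Killing equation then follows from the commutator on
`K_01` and from Ricci identities whose only possible source is `Ψ_1 = 0`; `Λ` drops out
(`projectedKilling`).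

The geometric half shows that a smooth dyad does produce such a calculus
(`IsSmoothDyadOn.spinCoefficients`). The algebraic core there is `spinCurvature_component_eq`: the
first Bianchi identity and the Einstein equations leave only `Ψ` and `Λ` in the curvature of the
spin connection. `spinorDeriv_dyad_bilinear` and `spinorDeriv_dyad_sesquilinear` translate the
invariantly defined derivatives of `K` and `ξ` into ring elements, and linearity carries the result
from the dyad to all spinors. -/

noncomputable section

/-! ### Abstract spin coefficient calculus of an aligned Einstein space -/

/-- The Levi-Civita symbol `ε_AB` in a spin dyad. -/
def levi {A : Type*} [CommRing A] (i j : Fin 2) : A :=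
  if i = 0 ∧ j = 1 then 1 else if i = 1 ∧ j = 0 then -1 else 0

section levi

variable {A : Type*} [CommRing A]

theorem levi_zero_zero : (levi 0 0 : A) = 0 := by simp [levi]

theorem levi_zero_one : (levi 0 1 : A) = 1 := by simp [levi]

theorem levi_one_zero : (levi 1 0 : A) = -1 := by simp [levi]

theorem levi_one_one : (levi 1 1 : A) = 0 := by simp [levi]

end levi

/-- The number of indices equal to `1`, which determines a component of a symmetric spinor. -/
def weylIndex (i j k l : Fin 2) : ℕ := i.val + j.val + k.val + l.val

/-- The component `Ψ_ijkl + Λ (ε_ik ε_jl + ε_il ε_jk)` of the curvature spinor `X_ABCD`. -/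
def curvatureComponent {A : Type*} [CommRing A] (Ψ : ℕ → A) (Λ : A) (i j k l : Fin 2) : A :=
  Ψ (weylIndex i j k l) + Λ * (levi i k * levi j l + levi i l * levi j k)

/-- The spin coefficient calculus of a spin dyad `e₀, e₁` in an Einstein space with an aligned
Weyl spinor, over a ring `A` of functions: `E i j` is the derivative along `e_i (conj e_j)`,
`Γ i j k m` is the coefficient of `e_m` in the covariant derivative of `e_k` along this vector,
and `Γb` has the same meaning for the conjugate spinors. -/
structure SpinCoefficients (A : Type*) [CommRing A] [Algebra ℂ A] where
  /-- the derivations along the null tetrad -/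
  E : Fin 2 → Fin 2 → Derivation ℂ A A
  /-- the spin coefficients -/
  Γ : Fin 2 → Fin 2 → Fin 2 → Fin 2 → A
  /-- the conjugate spin coefficients -/
  Γb : Fin 2 → Fin 2 → Fin 2 → Fin 2 → A
  /-- the Weyl scalars -/
  Ψ : ℕ → A
  /-- the conjugate Weyl scalars -/
  Ψb : ℕ → A
  /-- the cosmological constant -/
  Λ : A
  trace : ∀ i j, Γ i j 1 1 = -Γ i j 0 0
  traceb : ∀ i j, Γb i j 1 1 = -Γb i j 0 0
  Ψ_zero : Ψ 0 = 0
  Ψ_one : Ψ 1 = 0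
  Ψb_zero : Ψb 0 = 0
  Ψb_one : Ψb 1 = 0
  derivation_Λ : ∀ i j, E i j Λ = 0
  comm : ∀ i j k l f, E i j (E k l f) - E k l (E i j f) =
    ∑ n, (Γ i j k n * E n l f + Γb i j l n * E k n f - Γ k l i n * E n j f - Γb k l j n * E i n f)
  curv : ∀ i j k l m p, E i j (Γ k l m p) - E k l (Γ i j m p)
    - ∑ n, (Γ i j k n * Γ n l m p + Γb i j l n * Γ k n m p
      - Γ k l i n * Γ n j m p - Γb k l j n * Γ i n m p)
    + ∑ n, (Γ k l m n * Γ i j n p - Γ i j m n * Γ k l n p) =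
    levi j l * ∑ q, levi p q * curvatureComponent Ψ Λ i k m q
  curvb : ∀ i j k l m p, E i j (Γb k l m p) - E k l (Γb i j m p)
    - ∑ n, (Γ i j k n * Γb n l m p + Γb i j l n * Γb k n m p
      - Γ k l i n * Γb n j m p - Γb k l j n * Γb i n m p)
    + ∑ n, (Γb k l m n * Γb i j n p - Γb i j m n * Γb k l n p) =
    levi i k * ∑ q, levi p q * curvatureComponent Ψb Λ j l m q

/-! ### The second Bianchi identity in dyad components -/

namespace SpinCoefficients

variable {A : Type*} [CommRing A] [Algebra ℂ A] (S : SpinCoefficients A)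

/-- This is `∇^A_A' Ψ_ABCD = 0` with `BCD = ooo` and `A' = 0`; the names of the next five lemmas
record `BCD` and `A'` in the same way. Up to sign, `Γ 0 0 0 1` is the Newman–Penrose coefficient
`κ`, and the derivative terms have dropped out with `Ψ_0` and `Ψ_1`. -/
theorem bianchi_ooo_0 : 3 * S.Γ 0 0 0 1 * S.Ψ 2 = 0 := by
  have h000100 := S.curv 0 0 0 1 0 0
  have h000101 := S.curv 0 0 0 1 0 1
  have h000110 := S.curv 0 0 0 1 1 0
  have h001000 := S.curv 0 0 1 0 0 0
  have h001001 := S.curv 0 0 1 0 0 1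
  have h001101 := S.curv 0 0 1 1 0 1
  have h011000 := S.curv 0 1 1 0 0 0
  have h011001 := S.curv 0 1 1 0 0 1
  have h011101 := S.curv 0 1 1 1 0 1
  have h101101 := S.curv 1 0 1 1 0 1
  have hb000100 := S.curvb 0 0 0 1 0 0
  have hb000101 := S.curvb 0 0 0 1 0 1
  have hb001000 := S.curvb 0 0 1 0 0 0
  have hb001010 := S.curvb 0 0 1 0 1 0
  have hb011000 := S.curvb 0 1 1 0 0 0
  have hb011001 := S.curvb 0 1 1 0 0 1
  -- The alternating sum over the three tetrad directions 00, 01, 10 of derivatives of the Ricci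
  -- identities for the complementary planes: its right-hand side is a divergence of the curvature
  -- spinor. The last two indices 0, 1 of the identities select the pair `CD = oo`.
  have d0 := congrArg (S.E 0 0) h011001
  have d1 := congrArg (S.E 0 1) h001001
  have d2 := congrArg (S.E 1 0) h000101
  -- The commutators cancel the second derivatives of the spin coefficients in that sum.
  have m0 := S.comm 0 0 0 1 (S.Γ 1 0 0 1)
  have m1 := S.comm 0 1 1 0 (S.Γ 0 0 0 1)
  have m2 := S.comm 1 0 0 0 (S.Γ 0 1 0 1)
  simp only [Fin.sum_univ_two, levi_zero_zero, levi_zero_one, levi_one_zero, levi_one_one,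
    S.trace, S.traceb, curvatureComponent, S.Ψ_zero, S.Ψ_one, S.derivation_Λ, S.Ψb_zero,
    S.Ψb_one, weylIndex, Fin.val_zero, Fin.val_one, Nat.reduceAdd, map_add, map_sub, map_neg,
    map_zero, Derivation.leibniz, Derivation.map_one_eq_zero, smul_eq_mul, mul_zero, zero_mul,
    mul_one, one_mul, mul_neg, neg_mul, neg_neg, neg_zero, zero_add, add_zero, sub_zero,
    zero_sub] at *
  -- What is left is of first order: derivatives of `Γ` and `Γb` times spin coefficients. Each
  -- multiple of a Ricci identity, or of its conjugate, removes one such derivative; afterwards the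
  -- cubic terms cancel identically.
  linear_combination d0 - d1 + d2 - m0 - m1 - m2 - (- S.Γ 1 0 0 1) * h000100 - (- S.Γ 0 0 1 0 + 4
    * S.Γ 1 0 0 0) * h000101 - (- S.Γ 0 0 0 1) * h000110 - (3 * S.Γ 0 1 0 1) * h001000 - (S.Γb 0
    0 1 0 - 2 * S.Γb 0 1 0 0 - 2 * S.Γ 0 1 0 0 + S.Γ 1 1 0 1) * h001001 - (- S.Γb 0 1 0 1 + S.Γ 1
    0 0 1) * h001101 - (- 3 * S.Γ 0 0 0 1) * h011000 - (- S.Γb 0 1 0 1 + 2 * S.Γ 0 0 0 0 - 2 *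
    S.Γ 1 0 0 1) * h011001 - (S.Γb 0 0 0 1) * h011101 - (- S.Γ 0 0 0 1) * h101101 - (- S.Γ 1 0 0
    1) * hb000100 - (- S.Γ 1 1 0 1) * hb000101 - (- S.Γ 0 1 0 1) * hb001000 - (S.Γ 0 0 0 1) *
    hb001010 - (- S.Γ 0 0 0 1) * hb011000 - (- S.Γ 0 1 0 1) * hb011001

/-- The same elimination with the last indices 0, 0 of `curv`, that is, the pair `CD = oι`. As `Λ`
is constant, only `Ψ_2` is differentiated. The factor 3 in front of `Γ 1 0 0 1 * Ψ_2` is the source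
of the cube root in the Killing spinor. -/
theorem bianchi_ooi_0 :
    S.E 0 0 (S.Ψ 2) - 2 * S.Γ 0 0 0 1 * S.Ψ 3 + 3 * S.Γ 1 0 0 1 * S.Ψ 2 = 0 := by
  have h000100 := S.curv 0 0 0 1 0 0
  have h000101 := S.curv 0 0 0 1 0 1
  have h000110 := S.curv 0 0 0 1 1 0
  have h001000 := S.curv 0 0 1 0 0 0
  have h001001 := S.curv 0 0 1 0 0 1
  have h001010 := S.curv 0 0 1 0 1 0
  have h001100 := S.curv 0 0 1 1 0 0
  have h011000 := S.curv 0 1 1 0 0 0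
  have h011001 := S.curv 0 1 1 0 0 1
  have h011010 := S.curv 0 1 1 0 1 0
  have h011100 := S.curv 0 1 1 1 0 0
  have h101100 := S.curv 1 0 1 1 0 0
  have hb000100 := S.curvb 0 0 0 1 0 0
  have hb000101 := S.curvb 0 0 0 1 0 1
  have hb001000 := S.curvb 0 0 1 0 0 0
  have hb001010 := S.curvb 0 0 1 0 1 0
  have hb011000 := S.curvb 0 1 1 0 0 0
  have hb011001 := S.curvb 0 1 1 0 0 1
  have d0 := congrArg (S.E 0 0) h011000
  have d1 := congrArg (S.E 0 1) h001000
  have d2 := congrArg (S.E 1 0) h000100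
  have m0 := S.comm 0 0 0 1 (S.Γ 1 0 0 0)
  have m1 := S.comm 0 1 1 0 (S.Γ 0 0 0 0)
  have m2 := S.comm 1 0 0 0 (S.Γ 0 1 0 0)
  simp only [Fin.sum_univ_two, levi_zero_zero, levi_zero_one, levi_one_zero, levi_one_one,
    S.trace, S.traceb, curvatureComponent, S.Ψ_zero, S.Ψ_one, S.derivation_Λ, S.Ψb_zero,
    S.Ψb_one, weylIndex, Fin.val_zero, Fin.val_one, Nat.reduceAdd, map_add, map_sub, map_neg,
    map_zero, Derivation.leibniz, Derivation.map_one_eq_zero, smul_eq_mul, mul_zero, zero_mul,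
    mul_one, one_mul, mul_neg, neg_mul, neg_neg, neg_zero, zero_add, add_zero, sub_zero,
    zero_sub] at *
  linear_combination d0 - d1 + d2 - m0 - m1 - m2 - (- S.Γ 0 0 1 0 + 3 * S.Γ 1 0 0 0) * h000100 -
    (- S.Γ 1 0 1 0) * h000101 - (- S.Γ 0 0 0 0 + S.Γ 1 0 0 1) * h000110 - (S.Γb 0 0 1 0 - 2 *
    S.Γb 0 1 0 0 + S.Γ 0 1 0 0) * h001000 - (S.Γ 0 1 1 0 + S.Γ 1 1 0 0) * h001001 - (- S.Γ 0 1 0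
    1) * h001010 - (- S.Γb 0 1 0 1 + S.Γ 1 0 0 1) * h001100 - (- S.Γb 0 1 0 1 - S.Γ 0 0 0 0 - S.Γ
    1 0 0 1) * h011000 - (- S.Γ 0 0 1 0 - S.Γ 1 0 0 0) * h011001 - (S.Γ 0 0 0 1) * h011010 -
    (S.Γb 0 0 0 1) * h011100 - (- S.Γ 0 0 0 1) * h101100 - (- S.Γ 1 0 0 0) * hb000100 - (- S.Γ 1
    1 0 0) * hb000101 - (- S.Γ 0 1 0 0) * hb001000 - (S.Γ 0 0 0 0) * hb001010 - (- S.Γ 0 0 0 0) *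
    hb011000 - (- S.Γ 0 1 0 0) * hb011001

/-- The last indices 1, 0 of `curv` give the pair `CD = ιι`. This is the only component needed in
which a derivative along `e₁` survives. -/
theorem bianchi_oii_0 :
    S.E 0 0 (S.Ψ 3) - S.E 1 0 (S.Ψ 2) + 2 * S.Γ 0 0 0 0 * S.Ψ 3 - S.Γ 0 0 0 1 * S.Ψ 4
      - 3 * S.Γ 0 0 1 0 * S.Ψ 2 + 2 * S.Γ 1 0 0 1 * S.Ψ 3 = 0 := by
  have h000100 := S.curv 0 0 0 1 0 0
  have h000110 := S.curv 0 0 0 1 1 0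
  have h001000 := S.curv 0 0 1 0 0 0
  have h001001 := S.curv 0 0 1 0 0 1
  have h001010 := S.curv 0 0 1 0 1 0
  have h001110 := S.curv 0 0 1 1 1 0
  have h011000 := S.curv 0 1 1 0 0 0
  have h011001 := S.curv 0 1 1 0 0 1
  have h011010 := S.curv 0 1 1 0 1 0
  have h011110 := S.curv 0 1 1 1 1 0
  have h101110 := S.curv 1 0 1 1 1 0
  have hb000100 := S.curvb 0 0 0 1 0 0
  have hb000101 := S.curvb 0 0 0 1 0 1
  have hb001000 := S.curvb 0 0 1 0 0 0
  have hb001010 := S.curvb 0 0 1 0 1 0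
  have hb011000 := S.curvb 0 1 1 0 0 0
  have hb011001 := S.curvb 0 1 1 0 0 1
  have d0 := congrArg (S.E 0 0) h011010
  have d1 := congrArg (S.E 0 1) h001010
  have d2 := congrArg (S.E 1 0) h000110
  have m0 := S.comm 0 0 0 1 (S.Γ 1 0 1 0)
  have m1 := S.comm 0 1 1 0 (S.Γ 0 0 1 0)
  have m2 := S.comm 1 0 0 0 (S.Γ 0 1 1 0)
  simp only [Fin.sum_univ_two, levi_zero_zero, levi_zero_one, levi_one_zero, levi_one_one,
    S.trace, S.traceb, curvatureComponent, S.Ψ_zero, S.Ψ_one, S.derivation_Λ, S.Ψb_zero,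
    S.Ψb_one, weylIndex, Fin.val_zero, Fin.val_one, Nat.reduceAdd, map_add, map_sub, map_neg,
    map_zero, Derivation.leibniz, Derivation.map_one_eq_zero, smul_eq_mul, mul_zero, zero_mul,
    mul_one, one_mul, mul_neg, neg_mul, neg_neg, neg_zero, zero_add, add_zero, sub_zero,
    zero_sub] at *
  linear_combination d0 - d1 + d2 - m0 - m1 - m2 - (3 * S.Γ 1 0 1 0) * h000100 - (- 2 * S.Γ 0 0 1
    0) * h000110 - (- S.Γ 0 1 1 0) * h001000 - (S.Γ 1 1 1 0) * h001001 - (S.Γb 0 0 1 0 - 2 * S.Γb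
    0 1 0 0 + 2 * S.Γ 0 1 0 0) * h001010 - (- S.Γb 0 1 0 1 + S.Γ 1 0 0 1) * h001110 - (S.Γ 0 0 1
    0) * h011000 - (- S.Γ 1 0 1 0) * h011001 - (- S.Γb 0 1 0 1 - 2 * S.Γ 0 0 0 0 - S.Γ 1 0 0 1) *
    h011010 - (S.Γb 0 0 0 1) * h011110 - (- S.Γ 0 0 0 1) * h101110 - (- S.Γ 1 0 1 0) * hb000100 -
    (- S.Γ 1 1 1 0) * hb000101 - (- S.Γ 0 1 1 0) * hb001000 - (S.Γ 0 0 1 0) * hb001010 - (- S.Γ 0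
    0 1 0) * hb011000 - (- S.Γ 0 1 1 0) * hb011001

/-- For `A' = 1` the three directions are 00, 01, 11 instead of 00, 01, 10. Up to sign, `Γ 0 1 0 1`
is the shear `σ`. -/
theorem bianchi_ooo_1 : 3 * S.Γ 0 1 0 1 * S.Ψ 2 = 0 := by
  have h000100 := S.curv 0 0 0 1 0 0
  have h000101 := S.curv 0 0 0 1 0 1
  have h000110 := S.curv 0 0 0 1 1 0
  have h001001 := S.curv 0 0 1 0 0 1
  have h001100 := S.curv 0 0 1 1 0 0
  have h001101 := S.curv 0 0 1 1 0 1
  have h011001 := S.curv 0 1 1 0 0 1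
  have h011100 := S.curv 0 1 1 1 0 0
  have h011101 := S.curv 0 1 1 1 0 1
  have h101101 := S.curv 1 0 1 1 0 1
  have hb000100 := S.curvb 0 0 0 1 0 0
  have hb000110 := S.curvb 0 0 0 1 1 0
  have hb001100 := S.curvb 0 0 1 1 0 0
  have hb001110 := S.curvb 0 0 1 1 1 0
  have hb011100 := S.curvb 0 1 1 1 0 0
  have hb011101 := S.curvb 0 1 1 1 0 1
  have d0 := congrArg (S.E 0 0) h011101
  have d1 := congrArg (S.E 0 1) h001101
  have d2 := congrArg (S.E 1 1) h000101
  have m0 := S.comm 0 0 0 1 (S.Γ 1 1 0 1)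
  have m1 := S.comm 0 1 1 1 (S.Γ 0 0 0 1)
  have m2 := S.comm 1 1 0 0 (S.Γ 0 1 0 1)
  simp only [Fin.sum_univ_two, levi_zero_zero, levi_zero_one, levi_one_zero, levi_one_one,
    S.trace, S.traceb, curvatureComponent, S.Ψ_zero, S.Ψ_one, S.derivation_Λ, S.Ψb_zero,
    S.Ψb_one, weylIndex, Fin.val_zero, Fin.val_one, Nat.reduceAdd, map_add, map_sub, map_neg,
    map_zero, Derivation.leibniz, Derivation.map_one_eq_zero, smul_eq_mul, mul_zero, zero_mul,
    mul_one, one_mul, mul_neg, neg_mul, neg_neg, neg_zero, zero_add, add_zero, sub_zero,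
    zero_sub] at *
  linear_combination d0 - d1 + d2 - m0 - m1 - m2 - (- S.Γ 1 1 0 1) * h000100 - (- S.Γ 0 1 1 0 + 4
    * S.Γ 1 1 0 0) * h000101 - (- S.Γ 0 1 0 1) * h000110 - (- S.Γb 0 1 1 0) * h001001 - (3 * S.Γ
    0 1 0 1) * h001100 - (S.Γb 0 0 1 0 - 2 * S.Γ 0 1 0 0 + 2 * S.Γ 1 1 0 1) * h001101 - (S.Γb 0 0
    1 0 - S.Γ 1 1 0 1) * h011001 - (- 3 * S.Γ 0 0 0 1) * h011100 - (- 2 * S.Γb 0 0 0 0 - S.Γb 0 1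
    0 1 + 2 * S.Γ 0 0 0 0 - S.Γ 1 0 0 1) * h011101 - (- S.Γ 0 1 0 1) * h101101 - (S.Γ 1 1 0 1) *
    hb000100 - (- S.Γ 1 0 0 1) * hb000110 - (- S.Γ 0 1 0 1) * hb001100 - (S.Γ 0 0 0 1) * hb001110
    - (- S.Γ 0 0 0 1) * hb011100 - (- S.Γ 0 1 0 1) * hb011101

theorem bianchi_ooi_1 :
    S.E 0 1 (S.Ψ 2) - 2 * S.Γ 0 1 0 1 * S.Ψ 3 + 3 * S.Γ 1 1 0 1 * S.Ψ 2 = 0 := by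
  have h000100 := S.curv 0 0 0 1 0 0
  have h000101 := S.curv 0 0 0 1 0 1
  have h000110 := S.curv 0 0 0 1 1 0
  have h001000 := S.curv 0 0 1 0 0 0
  have h001100 := S.curv 0 0 1 1 0 0
  have h001101 := S.curv 0 0 1 1 0 1
  have h001110 := S.curv 0 0 1 1 1 0
  have h011000 := S.curv 0 1 1 0 0 0
  have h011100 := S.curv 0 1 1 1 0 0
  have h011101 := S.curv 0 1 1 1 0 1
  have h011110 := S.curv 0 1 1 1 1 0
  have h101100 := S.curv 1 0 1 1 0 0
  have hb000100 := S.curvb 0 0 0 1 0 0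
  have hb000110 := S.curvb 0 0 0 1 1 0
  have hb001100 := S.curvb 0 0 1 1 0 0
  have hb001110 := S.curvb 0 0 1 1 1 0
  have hb011100 := S.curvb 0 1 1 1 0 0
  have hb011101 := S.curvb 0 1 1 1 0 1
  have d0 := congrArg (S.E 0 0) h011100
  have d1 := congrArg (S.E 0 1) h001100
  have d2 := congrArg (S.E 1 1) h000100
  have m0 := S.comm 0 0 0 1 (S.Γ 1 1 0 0)
  have m1 := S.comm 0 1 1 1 (S.Γ 0 0 0 0)
  have m2 := S.comm 1 1 0 0 (S.Γ 0 1 0 0)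
  simp only [Fin.sum_univ_two, levi_zero_zero, levi_zero_one, levi_one_zero, levi_one_one,
    S.trace, S.traceb, curvatureComponent, S.Ψ_zero, S.Ψ_one, S.derivation_Λ, S.Ψb_zero,
    S.Ψb_one, weylIndex, Fin.val_zero, Fin.val_one, Nat.reduceAdd, map_add, map_sub, map_neg,
    map_zero, Derivation.leibniz, Derivation.map_one_eq_zero, smul_eq_mul, mul_zero, zero_mul,
    mul_one, one_mul, mul_neg, neg_mul, neg_neg, neg_zero, zero_add, add_zero, sub_zero,
    zero_sub] at *
  linear_combination d0 - d1 + d2 - m0 - m1 - m2 - (- S.Γ 0 1 1 0 + 3 * S.Γ 1 1 0 0) * h000100 -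
    (- S.Γ 1 1 1 0) * h000101 - (- S.Γ 0 1 0 0 + S.Γ 1 1 0 1) * h000110 - (- S.Γb 0 1 1 0) *
    h001000 - (S.Γb 0 0 1 0 + S.Γ 0 1 0 0 + S.Γ 1 1 0 1) * h001100 - (S.Γ 0 1 1 0 + S.Γ 1 1 0 0)
    * h001101 - (- S.Γ 0 1 0 1) * h001110 - (S.Γb 0 0 1 0 - S.Γ 1 1 0 1) * h011000 - (- 2 * S.Γb
    0 0 0 0 - S.Γb 0 1 0 1 - S.Γ 0 0 0 0) * h011100 - (- S.Γ 0 0 1 0 - S.Γ 1 0 0 0) * h011101 -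
    (S.Γ 0 0 0 1) * h011110 - (- S.Γ 0 1 0 1) * h101100 - (S.Γ 1 1 0 0) * hb000100 - (- S.Γ 1 0 0
    0) * hb000110 - (- S.Γ 0 1 0 0) * hb001100 - (S.Γ 0 0 0 0) * hb001110 - (- S.Γ 0 0 0 0) *
    hb011100 - (- S.Γ 0 1 0 0) * hb011101

theorem bianchi_oii_1 :
    S.E 0 1 (S.Ψ 3) - S.E 1 1 (S.Ψ 2) + 2 * S.Γ 0 1 0 0 * S.Ψ 3 - S.Γ 0 1 0 1 * S.Ψ 4
      - 3 * S.Γ 0 1 1 0 * S.Ψ 2 + 2 * S.Γ 1 1 0 1 * S.Ψ 3 = 0 := by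
  have h000100 := S.curv 0 0 0 1 0 0
  have h000110 := S.curv 0 0 0 1 1 0
  have h001010 := S.curv 0 0 1 0 1 0
  have h001100 := S.curv 0 0 1 1 0 0
  have h001101 := S.curv 0 0 1 1 0 1
  have h001110 := S.curv 0 0 1 1 1 0
  have h011010 := S.curv 0 1 1 0 1 0
  have h011100 := S.curv 0 1 1 1 0 0
  have h011101 := S.curv 0 1 1 1 0 1
  have h011110 := S.curv 0 1 1 1 1 0
  have h101110 := S.curv 1 0 1 1 1 0
  have hb000100 := S.curvb 0 0 0 1 0 0
  have hb000110 := S.curvb 0 0 0 1 1 0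
  have hb001100 := S.curvb 0 0 1 1 0 0
  have hb001110 := S.curvb 0 0 1 1 1 0
  have hb011100 := S.curvb 0 1 1 1 0 0
  have hb011101 := S.curvb 0 1 1 1 0 1
  have d0 := congrArg (S.E 0 0) h011110
  have d1 := congrArg (S.E 0 1) h001110
  have d2 := congrArg (S.E 1 1) h000110
  have m0 := S.comm 0 0 0 1 (S.Γ 1 1 1 0)
  have m1 := S.comm 0 1 1 1 (S.Γ 0 0 1 0)
  have m2 := S.comm 1 1 0 0 (S.Γ 0 1 1 0)
  simp only [Fin.sum_univ_two, levi_zero_zero, levi_zero_one, levi_one_zero, levi_one_one,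
    S.trace, S.traceb, curvatureComponent, S.Ψ_zero, S.Ψ_one, S.derivation_Λ, S.Ψb_zero,
    S.Ψb_one, weylIndex, Fin.val_zero, Fin.val_one, Nat.reduceAdd, map_add, map_sub, map_neg,
    map_zero, Derivation.leibniz, Derivation.map_one_eq_zero, smul_eq_mul, mul_zero, zero_mul,
    mul_one, one_mul, mul_neg, neg_mul, neg_neg, neg_zero, zero_add, add_zero, sub_zero,
    zero_sub] at *
  linear_combination d0 - d1 + d2 - m0 - m1 - m2 - (3 * S.Γ 1 1 1 0) * h000100 - (- 2 * S.Γ 0 1 1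
    0) * h000110 - (- S.Γb 0 1 1 0) * h001010 - (- S.Γ 0 1 1 0) * h001100 - (S.Γ 1 1 1 0) *
    h001101 - (S.Γb 0 0 1 0 + 2 * S.Γ 0 1 0 0 + S.Γ 1 1 0 1) * h001110 - (S.Γb 0 0 1 0 - S.Γ 1 1
    0 1) * h011010 - (S.Γ 0 0 1 0) * h011100 - (- S.Γ 1 0 1 0) * h011101 - (- 2 * S.Γb 0 0 0 0 -
    S.Γb 0 1 0 1 - 2 * S.Γ 0 0 0 0) * h011110 - (- S.Γ 0 1 0 1) * h101110 - (S.Γ 1 1 1 0) *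
    hb000100 - (- S.Γ 1 0 1 0) * hb000110 - (- S.Γ 0 1 1 0) * hb001100 - (S.Γ 0 0 1 0) * hb001110
    - (- S.Γ 0 0 1 0) * hb011100 - (- S.Γ 0 1 1 0) * hb011101

/-! ### The projected Killing equation for the divergence -/

/-- The components `ξ_AA'` of the divergence of a spinor `K_AB` with `K_00 = 0`, `K_01 = K₁`,
`K_11 = K₂` that solves the projected Killing spinor equation. -/
def divergenceComponent (K₁ K₂ : A) (k l : Fin 2) : A :=
  if k = 0 then -3 * (S.Γ 1 l 0 1 * K₁) else 3 * (S.E 1 l K₁ - S.Γ 1 l 0 1 * K₂)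

theorem divergenceComponent_zero (K₁ K₂ : A) (l : Fin 2) :
    S.divergenceComponent K₁ K₂ 0 l = -3 * (S.Γ 1 l 0 1 * K₁) := by simp [divergenceComponent]

theorem divergenceComponent_one (K₁ K₂ : A) (l : Fin 2) :
    S.divergenceComponent K₁ K₂ 1 l = 3 * (S.E 1 l K₁ - S.Γ 1 l 0 1 * K₂) := by
  simp [divergenceComponent]

/-- The components `∇_ij ξ_kl` of the covariant derivative of a spinor `ξ_AA'`. -/
def covDerivComponent (ξ : Fin 2 → Fin 2 → A) (i j k l : Fin 2) : A :=
  S.E i j (ξ k l) - ∑ n, (S.Γ i j k n * ξ n l + S.Γb i j l n * ξ k n)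

/-- The projected Killing spinor equation for a spinor `K_AB` with `K_00 = 0`, `K_01 = K₁`,
`K_11 = K₂`, when the first dyad spinor is geodesic and shear-free. -/
structure IsProjectedKillingSpinor (K₁ K₂ : A) : Prop where
  shear_free : ∀ j, S.Γ 0 j 0 1 = 0
  deriv_one : ∀ j, S.E 0 j K₁ = S.Γ 1 j 0 1 * K₁
  deriv_two : ∀ j, S.E 0 j K₂ - 2 * (S.Γ 0 j 1 0 * K₁) + 2 * (S.Γ 0 j 0 0 * K₂)
    + 2 * S.E 1 j K₁ - 2 * (S.Γ 1 j 0 1 * K₂) = 0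

theorem derivation_three (i j : Fin 2) : S.E i j 3 = 0 := by
  simpa using (S.E i j).map_natCast 3

variable {S} {K₁ K₂ : A}

/-- Here only components of the form `ξ_0l = -3 Γ 1 l 0 1 * K₁` are differentiated, along `e₀`. The
derivative of `Γ 1 l 0 1` comes from a Ricci identity without source: the one curvature component
that can occur, `X_0100`, is `Ψ_1 = 0`, with no contribution of `Λ`. That identity also contains
`e₁`-derivatives of `Γ 0 j 0 1`, which vanish because the shear-free condition may be
differentiated. -/
theorem projectedKilling_000 (h : S.IsProjectedKillingSpinor K₁ K₂) :
    S.covDerivComponent (S.divergenceComponent K₁ K₂) 0 0 0 0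
      + S.covDerivComponent (S.divergenceComponent K₁ K₂) 0 0 0 0 = 0 := by
  simp only [covDerivComponent, Fin.sum_univ_two, divergenceComponent_zero,
    divergenceComponent_one, S.trace, S.traceb]
  have h001001 := S.curv 0 0 1 0 0 1
  have k100 := congrArg (S.E 1 0) (h.shear_free 0)
  simp only [Fin.sum_univ_two, levi_zero_zero, levi_zero_one, levi_one_zero, levi_one_one,
    S.trace, S.traceb, curvatureComponent, S.Ψ_zero, S.Ψ_one, weylIndex, Fin.val_zero,
    Fin.val_one, Nat.reduceAdd, mul_zero, zero_mul, mul_one, one_mul, mul_neg, neg_mul,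
    neg_neg, neg_zero, zero_add, add_zero, map_zero, map_neg, map_sub, S.derivation_three,
    Derivation.leibniz, smul_eq_mul] at *
  linear_combination (- 6 * K₁) * h001001 + (- 6 * K₁) * k100 + (- 6 * S.Γ 1 0 0 1) *
    (h.deriv_one 0) + (- 6 * S.E 1 0 (K₁) + 6 * S.Γb 1 0 0 0 * K₁ - 6 * S.Γ 0 0 1 0 * K₁ + 18 *
    S.Γ 1 0 0 0 * K₁ + 6 * S.Γ 1 0 0 1 * K₂) * (h.shear_free 0) + (6 * S.Γb 1 0 0 1 * K₁) *
    (h.shear_free 1)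

theorem projectedKilling_001 (h : S.IsProjectedKillingSpinor K₁ K₂) :
    S.covDerivComponent (S.divergenceComponent K₁ K₂) 0 0 0 1
      + S.covDerivComponent (S.divergenceComponent K₁ K₂) 0 1 0 0 = 0 := by
  simp only [covDerivComponent, Fin.sum_univ_two, divergenceComponent_zero,
    divergenceComponent_one, S.trace, S.traceb]
  have h001101 := S.curv 0 0 1 1 0 1
  have h011001 := S.curv 0 1 1 0 0 1
  have k101 := congrArg (S.E 1 0) (h.shear_free 1)
  have k110 := congrArg (S.E 1 1) (h.shear_free 0)
  simp only [Fin.sum_univ_two, levi_zero_zero, levi_zero_one, levi_one_zero, levi_one_one,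
    S.trace, S.traceb, curvatureComponent, S.Ψ_zero, S.Ψ_one, weylIndex, Fin.val_zero,
    Fin.val_one, Nat.reduceAdd, mul_zero, zero_mul, mul_one, one_mul, mul_neg, neg_mul,
    neg_neg, neg_zero, zero_add, add_zero, map_zero, map_neg, map_sub, S.derivation_three,
    Derivation.leibniz, smul_eq_mul] at *
  linear_combination (- 3 * K₁) * h001101 + (- 3 * K₁) * h011001 + (- 3 * K₁) * k101 + (- 3 *
    K₁) * k110 + (- 3 * S.Γ 1 1 0 1) * (h.deriv_one 0) + (- 3 * S.Γ 1 0 0 1) * (h.deriv_one 1)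
    + (- 3 * S.E 1 1 (K₁) + 3 * S.Γb 1 0 1 0 * K₁ + 3 * S.Γb 1 1 0 0 * K₁ - 3 * S.Γ 0 1 1 0 *
    K₁ + 9 * S.Γ 1 1 0 0 * K₁ + 3 * S.Γ 1 1 0 1 * K₂) * (h.shear_free 0) + (- 3 * S.E 1 0 (K₁)
    - 3 * S.Γb 1 0 0 0 * K₁ + 3 * S.Γb 1 1 0 1 * K₁ - 3 * S.Γ 0 0 1 0 * K₁ + 9 * S.Γ 1 0 0 0 *
    K₁ + 3 * S.Γ 1 0 0 1 * K₂) * (h.shear_free 1)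

/-- By `deriv_one`, `ξ_0l` is `-3 E_0l K₁`, while `ξ_1j` contains `3 E_1j K₁`. The two second
derivatives of `K₁` therefore enter as a commutator. The terms with `K₂` need `deriv_two` and the
sourceless Ricci identity for `Γ 1 j 0 1`. The three remaining components of this type go the same
way. -/
theorem projectedKilling_010 (h : S.IsProjectedKillingSpinor K₁ K₂) :
    S.covDerivComponent (S.divergenceComponent K₁ K₂) 0 0 1 0
      + S.covDerivComponent (S.divergenceComponent K₁ K₂) 1 0 0 0 = 0 := by
  simp only [covDerivComponent, Fin.sum_univ_two, divergenceComponent_zero,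
    divergenceComponent_one, S.trace, S.traceb]
  have h001001 := S.curv 0 0 1 0 0 1
  have d100 := congrArg (S.E 1 0) (h.deriv_one 0)
  have k100 := congrArg (S.E 1 0) (h.shear_free 0)
  have m := S.comm 0 0 1 0 K₁
  simp only [Fin.sum_univ_two, levi_zero_zero, levi_zero_one, levi_one_zero, levi_one_one,
    S.trace, S.traceb, curvatureComponent, S.Ψ_zero, S.Ψ_one, weylIndex, Fin.val_zero,
    Fin.val_one, Nat.reduceAdd, mul_zero, zero_mul, mul_one, one_mul, mul_neg, neg_mul,
    neg_neg, neg_zero, zero_add, add_zero, map_zero, map_neg, map_sub, S.derivation_three,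
    Derivation.leibniz, smul_eq_mul] at *
  linear_combination (- 3 * K₂) * h001001 + (3) * d100 + (- 3 * K₂) * k100 + (3) * m + (- 3 *
    S.Γb 1 0 0 0 + 3 * S.Γ 0 0 1 0 - 3 * S.Γ 1 0 0 0) * (h.deriv_one 0) + (- 3 * S.Γb 1 0 0 1)
    * (h.deriv_one 1) + (- 3 * S.Γ 1 0 0 1) * (h.deriv_two 0) + (3 * S.Γb 1 0 0 0 * K₂ - 3 *
    S.Γ 0 0 1 0 * K₂ + 9 * S.Γ 1 0 0 0 * K₂) * (h.shear_free 0) + (3 * S.Γb 1 0 0 1 * K₂) *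
    (h.shear_free 1)

theorem projectedKilling_011 (h : S.IsProjectedKillingSpinor K₁ K₂) :
    S.covDerivComponent (S.divergenceComponent K₁ K₂) 0 0 1 1
      + S.covDerivComponent (S.divergenceComponent K₁ K₂) 1 1 0 0 = 0 := by
  simp only [covDerivComponent, Fin.sum_univ_two, divergenceComponent_zero,
    divergenceComponent_one, S.trace, S.traceb]
  have h001101 := S.curv 0 0 1 1 0 1
  have d110 := congrArg (S.E 1 1) (h.deriv_one 0)
  have k110 := congrArg (S.E 1 1) (h.shear_free 0)
  have m := S.comm 0 0 1 1 K₁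
  simp only [Fin.sum_univ_two, levi_zero_zero, levi_zero_one, levi_one_zero, levi_one_one,
    S.trace, S.traceb, curvatureComponent, S.Ψ_zero, S.Ψ_one, weylIndex, Fin.val_zero,
    Fin.val_one, Nat.reduceAdd, mul_zero, zero_mul, mul_one, one_mul, mul_neg, neg_mul,
    neg_neg, neg_zero, zero_add, add_zero, map_zero, map_neg, map_sub, S.derivation_three,
    Derivation.leibniz, smul_eq_mul] at *
  linear_combination (- 3 * K₂) * h001101 + (3) * d110 + (- 3 * K₂) * k110 + (3) * m + (- 3 *
    S.Γb 1 1 0 0 - 3 * S.Γ 1 1 0 0) * (h.deriv_one 0) + (- 3 * S.Γb 1 1 0 1 + 3 * S.Γ 0 0 1 0)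
    * (h.deriv_one 1) + (- 3 * S.Γ 1 1 0 1) * (h.deriv_two 0) + (3 * S.Γb 1 1 0 0 * K₂ + 9 *
    S.Γ 1 1 0 0 * K₂) * (h.shear_free 0) + (3 * S.Γb 1 1 0 1 * K₂ - 3 * S.Γ 0 0 1 0 * K₂) *
    (h.shear_free 1)

theorem projectedKilling_101 (h : S.IsProjectedKillingSpinor K₁ K₂) :
    S.covDerivComponent (S.divergenceComponent K₁ K₂) 0 1 0 1
      + S.covDerivComponent (S.divergenceComponent K₁ K₂) 0 1 0 1 = 0 := by
  simp only [covDerivComponent, Fin.sum_univ_two, divergenceComponent_zero,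
    divergenceComponent_one, S.trace, S.traceb]
  have h011101 := S.curv 0 1 1 1 0 1
  have k111 := congrArg (S.E 1 1) (h.shear_free 1)
  simp only [Fin.sum_univ_two, levi_zero_zero, levi_zero_one, levi_one_zero, levi_one_one,
    S.trace, S.traceb, curvatureComponent, S.Ψ_zero, S.Ψ_one, weylIndex, Fin.val_zero,
    Fin.val_one, Nat.reduceAdd, mul_zero, zero_mul, mul_one, one_mul, mul_neg, neg_mul,
    neg_neg, neg_zero, zero_add, add_zero, map_zero, map_neg, map_sub, S.derivation_three,
    Derivation.leibniz, smul_eq_mul] at *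
  linear_combination (- 6 * K₁) * h011101 + (- 6 * K₁) * k111 + (- 6 * S.Γ 1 1 0 1) *
    (h.deriv_one 1) + (6 * S.Γb 1 1 1 0 * K₁) * (h.shear_free 0) + (- 6 * S.E 1 1 (K₁) - 6 *
    S.Γb 1 1 0 0 * K₁ - 6 * S.Γ 0 1 1 0 * K₁ + 18 * S.Γ 1 1 0 0 * K₁ + 6 * S.Γ 1 1 0 1 * K₂) *
    (h.shear_free 1)

theorem projectedKilling_110 (h : S.IsProjectedKillingSpinor K₁ K₂) :
    S.covDerivComponent (S.divergenceComponent K₁ K₂) 0 1 1 0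
      + S.covDerivComponent (S.divergenceComponent K₁ K₂) 1 0 0 1 = 0 := by
  simp only [covDerivComponent, Fin.sum_univ_two, divergenceComponent_zero,
    divergenceComponent_one, S.trace, S.traceb]
  have h011001 := S.curv 0 1 1 0 0 1
  have d101 := congrArg (S.E 1 0) (h.deriv_one 1)
  have k101 := congrArg (S.E 1 0) (h.shear_free 1)
  have m := S.comm 0 1 1 0 K₁
  simp only [Fin.sum_univ_two, levi_zero_zero, levi_zero_one, levi_one_zero, levi_one_one,
    S.trace, S.traceb, curvatureComponent, S.Ψ_zero, S.Ψ_one, weylIndex, Fin.val_zero,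
    Fin.val_one, Nat.reduceAdd, mul_zero, zero_mul, mul_one, one_mul, mul_neg, neg_mul,
    neg_neg, neg_zero, zero_add, add_zero, map_zero, map_neg, map_sub, S.derivation_three,
    Derivation.leibniz, smul_eq_mul] at *
  linear_combination (- 3 * K₂) * h011001 + (3) * d101 + (- 3 * K₂) * k101 + (3) * m + (- 3 *
    S.Γb 1 0 1 0 + 3 * S.Γ 0 1 1 0) * (h.deriv_one 0) + (3 * S.Γb 1 0 0 0 - 3 * S.Γ 1 0 0 0) *
    (h.deriv_one 1) + (- 3 * S.Γ 1 0 0 1) * (h.deriv_two 1) + (3 * S.Γb 1 0 1 0 * K₂ - 3 * S.Γ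
    0 1 1 0 * K₂) * (h.shear_free 0) + (- 3 * S.Γb 1 0 0 0 * K₂ + 9 * S.Γ 1 0 0 0 * K₂) *
    (h.shear_free 1)

theorem projectedKilling_111 (h : S.IsProjectedKillingSpinor K₁ K₂) :
    S.covDerivComponent (S.divergenceComponent K₁ K₂) 0 1 1 1
      + S.covDerivComponent (S.divergenceComponent K₁ K₂) 1 1 0 1 = 0 := by
  simp only [covDerivComponent, Fin.sum_univ_two, divergenceComponent_zero,
    divergenceComponent_one, S.trace, S.traceb]
  have h011101 := S.curv 0 1 1 1 0 1
  have d111 := congrArg (S.E 1 1) (h.deriv_one 1)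
  have k111 := congrArg (S.E 1 1) (h.shear_free 1)
  have m := S.comm 0 1 1 1 K₁
  simp only [Fin.sum_univ_two, levi_zero_zero, levi_zero_one, levi_one_zero, levi_one_one,
    S.trace, S.traceb, curvatureComponent, S.Ψ_zero, S.Ψ_one, weylIndex, Fin.val_zero,
    Fin.val_one, Nat.reduceAdd, mul_zero, zero_mul, mul_one, one_mul, mul_neg, neg_mul,
    neg_neg, neg_zero, zero_add, add_zero, map_zero, map_neg, map_sub, S.derivation_three,
    Derivation.leibniz, smul_eq_mul] at *
  linear_combination (- 3 * K₂) * h011101 + (3) * d111 + (- 3 * K₂) * k111 + (3) * m + (- 3 *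
    S.Γb 1 1 1 0) * (h.deriv_one 0) + (3 * S.Γb 1 1 0 0 + 3 * S.Γ 0 1 1 0 - 3 * S.Γ 1 1 0 0) *
    (h.deriv_one 1) + (- 3 * S.Γ 1 1 0 1) * (h.deriv_two 1) + (3 * S.Γb 1 1 1 0 * K₂) *
    (h.shear_free 0) + (- 3 * S.Γb 1 1 0 0 * K₂ - 3 * S.Γ 0 1 1 0 * K₂ + 9 * S.Γ 1 1 0 0 * K₂)
    * (h.shear_free 1)

theorem projectedKilling (h : S.IsProjectedKillingSpinor K₁ K₂) (j k l : Fin 2) :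
    S.covDerivComponent (S.divergenceComponent K₁ K₂) 0 j k l
      + S.covDerivComponent (S.divergenceComponent K₁ K₂) k l 0 j = 0 := by
  fin_cases j <;> fin_cases k <;> fin_cases l
  -- The component 100 is the component 001 with its two summands exchanged, so seven computations
  -- cover eight cases.
  exacts [projectedKilling_000 h, projectedKilling_001 h, projectedKilling_010 h,
    projectedKilling_011 h, (add_comm _ _).trans (projectedKilling_001 h),
    projectedKilling_101 h, projectedKilling_110 h, projectedKilling_111 h]

/-! ### The spinor built from the Weyl scalars in type II -/

variable (S)

/-- The ring may have zero divisors, so factors are removed only by inverses; numerals are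
invertible because `A` is a complex algebra. -/
theorem eq_zero_of_three_mul {x : A} (h : 3 * x = 0) : x = 0 := by
  have e : algebraMap ℂ A (1 / 3) * 3 = 1 := by
    rw [← map_ofNat (algebraMap ℂ A) 3, ← map_mul]; norm_num
  linear_combination algebraMap ℂ A (1 / 3) * h - x * e

theorem eq_zero_of_two_mul {x : A} (h : 2 * x = 0) : x = 0 := by
  have e : algebraMap ℂ A (1 / 2) * 2 = 1 := by
    rw [← map_ofNat (algebraMap ℂ A) 2, ← map_mul]; norm_num
  linear_combination algebraMap ℂ A (1 / 2) * h - x * e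

theorem derivation_two (i j : Fin 2) : S.E i j 2 = 0 := by
  simpa using (S.E i j).map_natCast 2

/-- In type II, the repeated principal spinor is geodesic and shear-free. -/
theorem shear_free {p : A} (hp : p ^ 3 * S.Ψ 2 = 1) (j : Fin 2) : S.Γ 0 j 0 1 = 0 := by
  have b : 3 * S.Γ 0 j 0 1 * S.Ψ 2 = 0 := by
    fin_cases j
    exacts [S.bianchi_ooo_0, S.bianchi_ooo_1]
  refine eq_zero_of_three_mul ?_
  linear_combination p ^ 3 * b - 3 * S.Γ 0 j 0 1 * hp

/-- Here `p` plays the role of `Ψ_2^(-1/3)`. Since `p` scales with weight -1/3, the `ooi` identity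
turns into `deriv_one`. The factor in `K₂` is the one for which the `oii` identity turns into
`deriv_two`. The unknown `Ψ_4` occurs only with a factor `Γ 0 j 0 1` and disappears. -/
theorem isProjectedKillingSpinor {p K₁ K₂ : A} (hp : p ^ 3 * S.Ψ 2 = 1) (h₁ : 2 * K₁ = -p)
    (h₂ : 3 * K₂ = -(p ^ 4 * S.Ψ 3)) : S.IsProjectedKillingSpinor K₁ K₂ := by
  have hs := S.shear_free hp
  have b₁ (j : Fin 2) : S.E 0 j (S.Ψ 2) - 2 * S.Γ 0 j 0 1 * S.Ψ 3
      + 3 * S.Γ 1 j 0 1 * S.Ψ 2 = 0 := by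
    fin_cases j
    exacts [S.bianchi_ooi_0, S.bianchi_ooi_1]
  have b₂ (j : Fin 2) : S.E 0 j (S.Ψ 3) - S.E 1 j (S.Ψ 2) + 2 * S.Γ 0 j 0 0 * S.Ψ 3
      - S.Γ 0 j 0 1 * S.Ψ 4 - 3 * S.Γ 0 j 1 0 * S.Ψ 2 + 2 * S.Γ 1 j 0 1 * S.Ψ 3 = 0 := by
    fin_cases j
    exacts [S.bianchi_oii_0, S.bianchi_oii_1]
  -- Differentiating `p ^ 3 * Ψ_2 = 1` and multiplying by `p` makes the coefficient of `E p` equal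
  -- to 3, without division by `Ψ_2`.
  have dp (i j : Fin 2) : 3 * S.E i j p = -p ^ 4 * S.E i j (S.Ψ 2) := by
    have d := congrArg (S.E i j) hp
    simp only [Derivation.leibniz, Derivation.leibniz_pow, Derivation.map_one_eq_zero, smul_eq_mul,
      nsmul_eq_mul, Nat.cast_ofNat, Nat.add_one_sub_one] at d
    linear_combination p * d - 3 * S.E i j p * hp
  have dK₁ (i j : Fin 2) : 2 * S.E i j K₁ = -S.E i j p := by
    have d := congrArg (S.E i j) h₁
    simpa only [Derivation.leibniz, S.derivation_two, smul_eq_mul, map_neg, mul_zero, add_zero]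
      using d
  have dK₂ (i j : Fin 2) : 3 * S.E i j K₂ =
      -(p ^ 4 * S.E i j (S.Ψ 3) + S.Ψ 3 * (4 * p ^ 3 * S.E i j p)) := by
    have d := congrArg (S.E i j) h₂
    simp only [Derivation.leibniz, Derivation.leibniz_pow, S.derivation_three, smul_eq_mul,
      nsmul_eq_mul, Nat.cast_ofNat, Nat.add_one_sub_one, map_neg] at d
    linear_combination d
  have ep (j : Fin 2) : S.E 0 j p = S.Γ 1 j 0 1 * p := by
    refine sub_eq_zero.mp (eq_zero_of_three_mul ?_)
    linear_combination dp 0 j - p ^ 4 * b₁ j + 3 * S.Γ 1 j 0 1 * p * hp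
      - 2 * p ^ 4 * S.Ψ 3 * hs j
  refine ⟨hs, fun j ↦ ?_, fun j ↦ ?_⟩
  · refine sub_eq_zero.mp (eq_zero_of_two_mul ?_)
    linear_combination dK₁ 0 j - S.Γ 1 j 0 1 * h₁ - ep j
  · refine eq_zero_of_three_mul ?_
    linear_combination dK₂ 0 j - 4 * p ^ 3 * S.Ψ 3 * ep j - p ^ 4 * b₂ j
      - 3 * S.Γ 0 j 1 0 * h₁ + 2 * S.Γ 0 j 0 0 * h₂ - 2 * S.Γ 1 j 0 1 * h₂ + 3 * dK₁ 1 j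
      - dp 1 j - 3 * S.Γ 0 j 1 0 * p * hp - p ^ 4 * S.Ψ 4 * hs j

end SpinCoefficients

/-! ### Calculus of functions and sections smooth near a point -/

section Calculus

open Filter Topology

variable {M : Type*} [TopologicalSpace M] [ChartedSpace R4 M]
  {F F' : Type*} [NormedAddCommGroup F] [NormedSpace ℝ F] [NormedAddCommGroup F'] [NormedSpace ℝ F']
  {x : M}

/-- The function `f` is smooth on a neighborhood of `x`. -/
def SmoothFunNear (f : M → F) (x : M) : Prop :=
  ∀ᶠ y in 𝓝 x, ContMDiffAt (𝓡 4) 𝓘(ℝ, F) ∞ f y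

theorem SmoothFunNear.contMDiffAt {f : M → F} (hf : SmoothFunNear f x) :
    ContMDiffAt (𝓡 4) 𝓘(ℝ, F) ∞ f x := hf.self_of_nhds

theorem SmoothFunNear.mdiff {f : M → F} (hf : SmoothFunNear f x) :
    MDifferentiableAt (𝓡 4) 𝓘(ℝ, F) f x := hf.contMDiffAt.mdifferentiableAt (by simp)

/-- The reason for asking smoothness on a neighborhood: it is an open condition, so identities
between first derivatives hold near the point and can be differentiated again. Order `∞` at a single
point would give, for each finite order, only a neighborhood depending on it. -/
theorem SmoothFunNear.eventually {f : M → F} (hf : SmoothFunNear f x) :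
    ∀ᶠ y in 𝓝 x, SmoothFunNear f y := eventually_eventually_nhds.mpr hf

theorem SmoothFunNear.congr {f f' : M → F} (hf : SmoothFunNear f x) (h : f' =ᶠ[𝓝 x] f) :
    SmoothFunNear f' x := by
  filter_upwards [hf, h.eventuallyEq_nhds] with y h₁ h₂ using h₁.congr_of_eventuallyEq h₂

theorem smoothFunNear_of_contMDiffOn {f : M → F} {U : Set M}
    (hf : ContMDiffOn (𝓡 4) 𝓘(ℝ, F) ∞ f U) (hU : IsOpen U) (hx : x ∈ U) : SmoothFunNear f x := by
  filter_upwards [hU.mem_nhds hx] with y hy using hf.contMDiffAt (hU.mem_nhds hy)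

theorem smoothFunNear_const (c : F) : SmoothFunNear (fun _ : M ↦ c) x :=
  Eventually.of_forall fun _ ↦ contMDiffAt_const

theorem SmoothFunNear.clm_comp {f : M → F} (hf : SmoothFunNear f x) (L : F →L[ℝ] F') :
    SmoothFunNear (fun y ↦ L (f y)) x := by
  filter_upwards [hf] with y hy
  exact L.contMDiff.contMDiffAt.comp y hy

theorem SmoothFunNear.add {f g : M → F} (hf : SmoothFunNear f x) (hg : SmoothFunNear g x) :
    SmoothFunNear (fun y ↦ f y + g y) x := by
  filter_upwards [hf, hg] with y h₁ h₂ using h₁.add h₂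

theorem SmoothFunNear.mul {f g : M → ℂ} (hf : SmoothFunNear f x) (hg : SmoothFunNear g x) :
    SmoothFunNear (fun y ↦ f y * g y) x := by
  filter_upwards [hf, hg] with y h₁ h₂
  exact (contDiff_mul (𝕜 := ℝ) (𝔸 := ℂ)).contMDiff.contMDiffAt.comp y (h₁.prodMk_space h₂)

theorem mvfderiv_clm_comp {f : M → F} (hf : MDifferentiableAt (𝓡 4) 𝓘(ℝ, F) f x) (L : F →L[ℝ] F')
    (v : TangentSpace (𝓡 4) x) :
    mvfderiv (𝓡 4) (fun y ↦ L (f y)) x v = L (mvfderiv (𝓡 4) f x v) := by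
  have h := (L.hasMFDerivAt (x := f x)).comp x hf.hasMFDerivAt
  change mfderiv (𝓡 4) 𝓘(ℝ, F') (L ∘ f) x v = _
  rw [h.mfderiv]
  rfl

theorem mvfderiv_mul_apply {f g : M → ℂ} (hf : MDifferentiableAt (𝓡 4) 𝓘(ℝ, ℂ) f x)
    (hg : MDifferentiableAt (𝓡 4) 𝓘(ℝ, ℂ) g x) (v : TangentSpace (𝓡 4) x) :
    mvfderiv (𝓡 4) (fun y ↦ f y * g y) x v
      = f x * mvfderiv (𝓡 4) g x v + g x * mvfderiv (𝓡 4) f x v := by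
  have h := hf.hasMFDerivAt.mul hg.hasMFDerivAt
  change mfderiv (𝓡 4) 𝓘(ℝ, ℂ) (f * g) x v = _
  rw [h.mfderiv]
  rfl

theorem mvfderiv_add_apply {f g : M → F} (hf : MDifferentiableAt (𝓡 4) 𝓘(ℝ, F) f x)
    (hg : MDifferentiableAt (𝓡 4) 𝓘(ℝ, F) g x) (v : TangentSpace (𝓡 4) x) :
    mvfderiv (𝓡 4) (fun y ↦ f y + g y) x v
      = mvfderiv (𝓡 4) f x v + mvfderiv (𝓡 4) g x v := by
  rw [mvfderiv_fun_add hf hg]; rfl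

theorem mvfderiv_congr {f g : M → F} (h : f =ᶠ[𝓝 x] g) (v : TangentSpace (𝓡 4) x) :
    mvfderiv (𝓡 4) f x v = mvfderiv (𝓡 4) g x v := by
  change mfderiv (𝓡 4) 𝓘(ℝ, F) f x v = mfderiv (𝓡 4) 𝓘(ℝ, F) g x v
  rw [h.mfderiv_eq]
  rfl

variable {V : M → Type*} [TopologicalSpace (TotalSpace F V)] [∀ x, AddCommGroup (V x)]
  [∀ x, Module ℝ (V x)] [∀ x, TopologicalSpace (V x)] [FiberBundle F V] [VectorBundle ℝ F V]

/-- The section `s` of a vector bundle is smooth on a neighborhood of `x`. -/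
def SmoothSecNear (F : Type*) [NormedAddCommGroup F] [NormedSpace ℝ F] {V : M → Type*}
    [TopologicalSpace (TotalSpace F V)] [∀ x, TopologicalSpace (V x)] [FiberBundle F V]
    (s : ∀ x, V x) (x : M) : Prop :=
  ∀ᶠ y in 𝓝 x, ContMDiffAt (𝓡 4) ((𝓡 4).prod 𝓘(ℝ, F)) ∞ (fun z ↦ TotalSpace.mk' F z (s z)) y

namespace SmoothSecNear

variable {s t : ∀ x, V x} {f : M → ℝ}

theorem contMDiffAt (hs : SmoothSecNear F s x) :
    ContMDiffAt (𝓡 4) ((𝓡 4).prod 𝓘(ℝ, F)) ∞ (fun z ↦ TotalSpace.mk' F z (s z)) x :=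
  hs.self_of_nhds

theorem mdiff (hs : SmoothSecNear F s x) :
    MDifferentiableAt (𝓡 4) ((𝓡 4).prod 𝓘(ℝ, F)) (fun z ↦ TotalSpace.mk' F z (s z)) x :=
  hs.contMDiffAt.mdifferentiableAt (by simp)

theorem eventually (hs : SmoothSecNear F s x) : ∀ᶠ y in 𝓝 x, SmoothSecNear F s y :=
  eventually_eventually_nhds.mpr hs

theorem congr (hs : SmoothSecNear F s x) (h : ∀ᶠ y in 𝓝 x, t y = s y) : SmoothSecNear F t x := by
  filter_upwards [hs, eventually_eventually_nhds.mpr h] with y h₁ h₂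
  exact h₁.congr_of_eventuallyEq (h₂.mono fun z hz ↦ by simp only [hz])

theorem add (hs : SmoothSecNear F s x) (ht : SmoothSecNear F t x) : SmoothSecNear F (s + t) x := by
  filter_upwards [hs, ht] with y h₁ h₂ using h₁.add_section h₂

theorem smul (hf : SmoothFunNear f x) (hs : SmoothSecNear F s x) :
    SmoothSecNear F (f • s) x := by
  filter_upwards [hf, hs] with y h₁ h₂ using h₁.smul_section h₂

theorem sum {ι : Type*} {I : Finset ι} {s : ι → ∀ x, V x} (hs : ∀ i ∈ I, SmoothSecNear F (s i) x) :
    SmoothSecNear F (fun y ↦ ∑ i ∈ I, s i y) x := by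
  filter_upwards [(eventually_all_finset I).mpr hs] with y hy
  exact ContMDiffAt.sum_section hy

theorem of_contMDiffOn {U : Set M} (hs : ContMDiffOn (𝓡 4) ((𝓡 4).prod 𝓘(ℝ, F)) ∞
    (fun z ↦ TotalSpace.mk' F z (s z)) U) (hU : IsOpen U) (hx : x ∈ U) : SmoothSecNear F s x := by
  filter_upwards [hU.mem_nhds hx] with y hy using hs.contMDiffAt (hU.mem_nhds hy)

theorem exists_contMDiffOn (hs : SmoothSecNear F s x) : ∃ U : Set M, IsOpen U ∧ x ∈ U ∧
    ContMDiffOn (𝓡 4) ((𝓡 4).prod 𝓘(ℝ, F)) ∞ (fun z ↦ TotalSpace.mk' F z (s z)) U := by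
  obtain ⟨U, hU, ho, hx⟩ := eventually_nhds_iff.mp hs
  exact ⟨U, ho, hx, fun y hy ↦ (hU y hy).contMDiffWithinAt⟩

theorem extend [ContMDiffVectorBundle ∞ F V (𝓡 4)] (v : V x) :
    SmoothSecNear F (FiberBundle.extend F v) x := by
  obtain ⟨U, hU, hs⟩ := FiberBundle.exists_contMDiffOn_extend (𝓡 4) F (k := ∞) v
  filter_upwards [eventually_mem_nhds_iff.mpr hU] with y hy using hs.contMDiffAt hy

end SmoothSecNear

section Manifold

variable [IsManifold (𝓡 4) ∞ M] {X Y Z : ∀ x : M, TangentSpace (𝓡 4) x}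

/-- On an open set where `f` is smooth, its derivative along `X` is the fibre component of the
tangent map of `f` composed with the section `X` of the tangent bundle. -/
theorem SmoothFunNear.deriv {f : M → F} (hf : SmoothFunNear f x) (hX : SmoothSecNear R4 X x) :
    SmoothFunNear (fun y ↦ mvfderiv (𝓡 4) f y (X y)) x := by
  obtain ⟨U, hU, ho, hx⟩ := eventually_nhds_iff.mp hf
  filter_upwards [hX, ho.mem_nhds hx] with y h₁ hy
  have h₂ : ContMDiffOn (𝓡 4) 𝓘(ℝ, F) ∞ f U := fun z hz ↦ (hU z hz).contMDiffWithinAt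
  have h₃ := h₂.contMDiffOn_tangentMapWithin (m := ∞) (by simp) ho.uniqueMDiffOn
  have h₄ : ContMDiffAt (𝓡 4) (𝓘(ℝ, F).prod 𝓘(ℝ, F)) ∞
      (fun z ↦ tangentMapWithin (𝓡 4) 𝓘(ℝ, F) f U ⟨z, X z⟩) y := by
    refine ContMDiffAt.comp (g := tangentMapWithin (𝓡 4) 𝓘(ℝ, F) f U)
      (f := fun z ↦ (⟨z, X z⟩ : TangentBundle (𝓡 4) M)) y (h₃.contMDiffAt ?_) h₁
    exact (ho.preimage (FiberBundle.continuous_proj R4 _)).mem_nhds hy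
  have h₅ := (contMDiff_snd_tangentBundle_modelSpace (n := ∞) F 𝓘(ℝ, F)).contMDiffAt.comp y h₄
  refine h₅.congr_of_eventuallyEq ?_
  filter_upwards [ho.mem_nhds hy] with z hz
  change mfderiv (𝓡 4) 𝓘(ℝ, F) f z (X z) = mfderivWithin (𝓡 4) 𝓘(ℝ, F) f U z (X z)
  rw [mfderivWithin_of_isOpen ho hz]

theorem SmoothSecNear.mlieBracket (hX : SmoothSecNear R4 X x) (hY : SmoothSecNear R4 Y x) :
    SmoothSecNear R4 (VectorField.mlieBracket (𝓡 4) X Y) x := by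
  filter_upwards [hX, hY] with y h₁ h₂
  have : IsManifold (𝓡 4) (minSmoothness ℝ 2) M :=
    .of_le (n := ∞) (by simpa using ENat.LEInfty.out)
  have : IsManifold (𝓡 4) ((∞ : ℕ∞ω) + 1) M := by simpa using ‹IsManifold (𝓡 4) ∞ M›
  exact ContMDiffAt.mlieBracket_vectorField (m := ⊤) (n := ⊤) h₁ h₂ (by simp)

end Manifold

end Calculus

/-! ### Tensoriality and the curvature of a connection -/

section Curvature

open Filter Topology VectorField

variable {M : Type*} [TopologicalSpace M] [ChartedSpace R4 M]
  {F : Type*} [NormedAddCommGroup F] [NormedSpace ℝ F]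
  {V : M → Type*} [TopologicalSpace (TotalSpace F V)] [∀ x, AddCommGroup (V x)]
  [∀ x, Module ℝ (V x)] [∀ x, TopologicalSpace (V x)] [FiberBundle F V] [VectorBundle ℝ F V]
  {x : M}

/-- An operation on sections is tensorial at `x` if it is additive and linear over functions,
for sections and functions that are smooth near `x`. -/
structure SmoothTensorialAt (F : Type*) [NormedAddCommGroup F] [NormedSpace ℝ F] {V : M → Type*}
    [TopologicalSpace (TotalSpace F V)] [∀ x, AddCommGroup (V x)] [∀ x, Module ℝ (V x)]
    [∀ x, TopologicalSpace (V x)] [FiberBundle F V] {A : Type*} [AddCommGroup A] [Module ℝ A]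
    (Φ : (∀ x, V x) → A) (x : M) : Prop where
  smul : ∀ {f : M → ℝ} {s : ∀ x, V x}, SmoothFunNear f x → SmoothSecNear F s x →
    Φ (f • s) = f x • Φ s
  add : ∀ {s t : ∀ x, V x}, SmoothSecNear F s x → SmoothSecNear F t x → Φ (s + t) = Φ s + Φ t

namespace SmoothTensorialAt

variable {A : Type*} [AddCommGroup A] [Module ℝ A] {Φ : (∀ x, V x) → A} {s t : ∀ x, V x}

theorem congr (hΦ : SmoothTensorialAt F Φ x) (hs : SmoothSecNear F s x) (ht : SmoothSecNear F t x)
    (h : ∀ᶠ y in 𝓝 x, s y = t y) : Φ s = Φ t := by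
  classical
  -- No bump function is needed: `ψ` is identically 1 near `x`, hence smooth there, while `ψ • s = ψ
  -- • t` holds on the whole manifold.
  let ψ (y : M) : ℝ := if s y = t y then 1 else 0
  have hx : ψ x = 1 := by simp [ψ, h.self_of_nhds]
  have hψ : SmoothFunNear ψ x :=
    (smoothFunNear_const 1).congr (h.mono fun y hy ↦ by simp [ψ, hy])
  have e : ψ • s = ψ • t := by
    ext1 y
    by_cases hy : s y = t y <;> simp [ψ, hy]
  calc Φ s = Φ (ψ • s) := by simp [hΦ.smul hψ hs, hx]
    _ = Φ (ψ • t) := by rw [e]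
    _ = Φ t := by simp [hΦ.smul hψ ht, hx]

theorem zero (hΦ : SmoothTensorialAt F Φ x) : Φ 0 = 0 := by
  have h₀ : SmoothSecNear F (0 : ∀ x, V x) x :=
    Eventually.of_forall fun y ↦ (contMDiff_zeroSection ℝ V).contMDiffAt
  simpa using hΦ.add h₀ h₀

theorem sum (hΦ : SmoothTensorialAt F Φ x) {ι : Type*} {I : Finset ι} (s : ι → ∀ x, V x)
    (hs : ∀ i ∈ I, SmoothSecNear F (s i) x) :
    Φ (fun y ↦ ∑ i ∈ I, s i y) = ∑ i ∈ I, Φ (s i) := by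
  classical
  induction I using Finset.induction_on with
  | empty => simpa using! hΦ.zero
  | insert a I ha h =>
    simp only [Finset.mem_insert, forall_eq_or_imp] at hs
    simp only [Finset.sum_insert ha, ← h hs.2]
    exact hΦ.add hs.1 (.sum hs.2)

variable [FiniteDimensional ℝ F] [ContMDiffVectorBundle ∞ F V (𝓡 4)]

/-- A tensorial operation depends only on the value of the section at the point. -/
theorem pointwise (hΦ : SmoothTensorialAt F Φ x) (hs : SmoothSecNear F s x)
    (ht : SmoothSecNear F t x) (h : s x = t x) : Φ s = Φ t := by
  have : ContMDiffVectorBundle 1 F V (𝓡 4) := .of_le (n := ∞) (by simp)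
  let e := trivializationAt F V x
  have hx : x ∈ e.baseSet := FiberBundle.mem_baseSet_trivializationAt F V x
  have he := e.open_baseSet.mem_nhds hx
  let b := Module.Basis.ofVectorSpace ℝ F
  have hb (i) : SmoothSecNear F (e.localFrame b i) x := by
    filter_upwards [he] with y hy using contMDiffAt_localFrame_of_mem ∞ _ b i hy
  have hc {s : ∀ x, V x} (hs : SmoothSecNear F s x) (i) :
      SmoothFunNear (LinearMap.piApply (e.localFrameCoeff (𝓡 4) b i) s) x := by
    filter_upwards [he, hs] with y hy h using contMDiffAt_localFrameCoeff b hy h i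
  -- Expansion in a local frame shows that `Φ s` involves the section only through its frame
  -- coefficients at `x`.
  have key {s : ∀ x, V x} (hs : SmoothSecNear F s x) :
      Φ s = ∑ i, e.localFrameCoeff (𝓡 4) b i x (s x) • Φ (e.localFrame b i) := by
    rw [hΦ.congr hs (t := fun y ↦ ∑ i, e.localFrameCoeff (𝓡 4) b i y (s y) • e.localFrame b i y)
      (.sum fun i _ ↦ .smul (hc hs i) (hb i)) (e.eventually_eq_localFrame_sum_coeff_smul b hx)]
    refine (hΦ.sum (fun i ↦ LinearMap.piApply (e.localFrameCoeff (𝓡 4) b i) s • e.localFrame b i)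
      fun i _ ↦ .smul (hc hs i) (hb i)).trans ?_
    exact Finset.sum_congr rfl fun i _ ↦ hΦ.smul (hc hs i) (hb i)
  rw [key hs, key ht, h]

end SmoothTensorialAt

variable [IsManifold (𝓡 4) ∞ M] {X X' Y Y' Z : ∀ x : M, TangentSpace (𝓡 4) x}

theorem isManifold_two : IsManifold (𝓡 4) 2 M :=
  .of_le (n := ∞) (by simpa using ENat.LEInfty.out)

theorem isManifold_three : IsManifold (𝓡 4) (minSmoothness ℝ 3) M :=
  .of_le (n := ∞) (by simpa using ENat.LEInfty.out)

theorem SmoothSecNear.contMDiffAt_two (hX : SmoothSecNear R4 X x) :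
    ContMDiffAt (𝓡 4) ((𝓡 4).prod 𝓘(ℝ, R4)) (minSmoothness ℝ 2)
      (fun y ↦ TotalSpace.mk' R4 y (X y)) x :=
  hX.contMDiffAt.of_le (by simpa using ENat.LEInfty.out)

theorem jacobi_mlieBracket (hX : SmoothSecNear R4 X x) (hY : SmoothSecNear R4 Y x)
    (hZ : SmoothSecNear R4 Z x) :
    mlieBracket (𝓡 4) X (mlieBracket (𝓡 4) Y Z) x =
      mlieBracket (𝓡 4) (mlieBracket (𝓡 4) X Y) Z x
        + mlieBracket (𝓡 4) Y (mlieBracket (𝓡 4) X Z) x := by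
  have : IsManifold (𝓡 4) (minSmoothness ℝ 3) M := isManifold_three
  exact leibniz_identity_mlieBracket_apply hX.contMDiffAt_two hY.contMDiffAt_two hZ.contMDiffAt_two

theorem eventuallyEq_mlieBracket_smul {f : M → ℝ}
    (hf : SmoothFunNear f x) (hZ : SmoothSecNear R4 Z x) :
    mlieBracket (𝓡 4) Y (f • Z) =ᶠ[𝓝 x]
      (fun y ↦ mvfderiv (𝓡 4) f y (Y y)) • Z + f • mlieBracket (𝓡 4) Y Z := by
  have : IsManifold (𝓡 4) 2 M := isManifold_two
  filter_upwards [hf.eventually, hZ.eventually] with y h₁ h₂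
  exact mlieBracket_smul_right h₁.mdiff h₂.mdiff

/-- The Lie bracket of vector fields acts on real functions as the commutator. -/
theorem mvfderiv_mlieBracket_real {f : M → ℝ} (hX : SmoothSecNear R4 X x)
    (hY : SmoothSecNear R4 Y x) (hf : SmoothFunNear f x) :
    mvfderiv (𝓡 4) f x (mlieBracket (𝓡 4) X Y x) =
      mvfderiv (𝓡 4) (fun y ↦ mvfderiv (𝓡 4) f y (Y y)) x (X x)
        - mvfderiv (𝓡 4) (fun y ↦ mvfderiv (𝓡 4) f y (X y)) x (Y x) := by
  have : IsManifold (𝓡 4) 2 M := isManifold_two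
  -- The commutator formula is extracted from the Jacobi identity for `X`, `Y` and `f • Z`. Modulo
  -- the Jacobi identity for `X`, `Y`, `Z`, what remains is the desired scalar equation times `Z x`,
  -- so any `Z` with `Z x ≠ 0` suffices.
  obtain ⟨v, hv⟩ := exists_ne (0 : R4)
  let v' : TangentSpace (𝓡 4) x := v
  set Z : ∀ x : M, TangentSpace (𝓡 4) x := FiberBundle.extend R4 v'
  have hZ : SmoothSecNear R4 Z x := .extend _
  have hZx : Z x = v' := FiberBundle.extend_apply_self ..
  have key {X Y : ∀ x : M, TangentSpace (𝓡 4) x} (hX : SmoothSecNear R4 X x)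
      (hY : SmoothSecNear R4 Y x) : mlieBracket (𝓡 4) X (mlieBracket (𝓡 4) Y (f • Z)) x =
        (mvfderiv (𝓡 4) (fun y ↦ mvfderiv (𝓡 4) f y (Y y)) x (X x)) • Z x
        + mvfderiv (𝓡 4) f x (Y x) • mlieBracket (𝓡 4) X Z x
        + mvfderiv (𝓡 4) f x (X x) • mlieBracket (𝓡 4) Y Z x
        + f x • mlieBracket (𝓡 4) X (mlieBracket (𝓡 4) Y Z) x := by
    rw [(EventuallyEq.refl _ X).mlieBracket_vectorField_eq (eventuallyEq_mlieBracket_smul hf hZ),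
      mlieBracket_add_right (SmoothSecNear.smul (hf.deriv hY) hZ).mdiff
        (SmoothSecNear.smul hf (hY.mlieBracket hZ)).mdiff,
      mlieBracket_smul_right (hf.deriv hY).mdiff hZ.mdiff,
      mlieBracket_smul_right hf.mdiff (hY.mlieBracket hZ).mdiff]
    abel
  have h₁ := jacobi_mlieBracket hX hY (SmoothSecNear.smul hf hZ)
  have h₂ := jacobi_mlieBracket hX hY hZ
  rw [key hX hY, key hY hX, h₂,
    (eventuallyEq_mlieBracket_smul hf hZ).self_of_nhds] at h₁
  have h₃ : (mvfderiv (𝓡 4) f x (mlieBracket (𝓡 4) X Y x) -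
      (mvfderiv (𝓡 4) (fun y ↦ mvfderiv (𝓡 4) f y (Y y)) x (X x)
        - mvfderiv (𝓡 4) (fun y ↦ mvfderiv (𝓡 4) f y (X y)) x (Y x))) • v' = 0 := by
    simp only [Pi.add_apply, Pi.smul_apply', hZx] at h₁
    linear_combination (norm := module) -h₁
  rcases smul_eq_zero.mp h₃ with h | h
  · exact sub_eq_zero.mp h
  · exact absurd h hv

/-- The Lie bracket of vector fields acts on functions as the commutator. -/
theorem mvfderiv_mlieBracket {f : M → ℂ} (hX : SmoothSecNear R4 X x)
    (hY : SmoothSecNear R4 Y x) (hf : SmoothFunNear f x) :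
    mvfderiv (𝓡 4) f x (mlieBracket (𝓡 4) X Y x) =
      mvfderiv (𝓡 4) (fun y ↦ mvfderiv (𝓡 4) f y (Y y)) x (X x)
        - mvfderiv (𝓡 4) (fun y ↦ mvfderiv (𝓡 4) f y (X y)) x (Y x) := by
  have key (L : ℂ →L[ℝ] ℝ) : L (mvfderiv (𝓡 4) f x (mlieBracket (𝓡 4) X Y x)) =
      L (mvfderiv (𝓡 4) (fun y ↦ mvfderiv (𝓡 4) f y (Y y)) x (X x)
        - mvfderiv (𝓡 4) (fun y ↦ mvfderiv (𝓡 4) f y (X y)) x (Y x)) := by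
    have e (W : ∀ x : M, TangentSpace (𝓡 4) x) : (fun y ↦ L (mvfderiv (𝓡 4) f y (W y))) =ᶠ[𝓝 x]
        fun y ↦ mvfderiv (𝓡 4) (fun z ↦ L (f z)) y (W y) := by
      filter_upwards [hf.eventually] with y hy using (mvfderiv_clm_comp hy.mdiff L _).symm
    rw [map_sub, ← mvfderiv_clm_comp hf.mdiff, ← mvfderiv_clm_comp (hf.deriv hY).mdiff,
      ← mvfderiv_clm_comp (hf.deriv hX).mdiff, mvfderiv_congr (e X), mvfderiv_congr (e Y)]
    exact mvfderiv_mlieBracket_real hX hY (hf.clm_comp L)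
  exact Complex.ext (key Complex.reCLM) (key Complex.imCLM)

/-- The covariant derivative preserves smoothness of sections. -/
def IsSmoothConnection [∀ x, IsTopologicalAddGroup (V x)] [∀ x, ContinuousSMul ℝ (V x)]
    (cov : CovariantDerivative (𝓡 4) F V) : Prop :=
  ∀ U : Set M, IsOpen U → ContMDiffCovariantDerivativeOn F ∞ cov.toFun U

variable [∀ x, IsTopologicalAddGroup (V x)] [∀ x, ContinuousSMul ℝ (V x)]
  {cov : CovariantDerivative (𝓡 4) F V} {s t : ∀ x, V x} {f : M → ℝ}

theorem CovariantDerivative.add_apply (cov : CovariantDerivative (𝓡 4) F V)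
    (hs : SmoothSecNear F s x) (ht : SmoothSecNear F t x) (v : TangentSpace (𝓡 4) x) :
    cov (s + t) x v = cov s x v + cov t x v := by
  rw [cov.isCovariantDerivativeOnUniv.add hs.mdiff ht.mdiff]; rfl

theorem CovariantDerivative.smul_apply (cov : CovariantDerivative (𝓡 4) F V)
    (hf : SmoothFunNear f x) (hs : SmoothSecNear F s x) (v : TangentSpace (𝓡 4) x) :
    cov (f • s) x v = f x • cov s x v + mvfderiv (𝓡 4) f x v • s x := by
  rw [cov.isCovariantDerivativeOnUniv.leibniz hs.mdiff hf.mdiff]; rfl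

theorem CovariantDerivative.congr (cov : CovariantDerivative (𝓡 4) F V)
    (hs : SmoothSecNear F s x) (h : ∀ᶠ y in 𝓝 x, t y = s y) : cov t x = cov s x :=
  cov.isCovariantDerivativeOnUniv.congr_of_eventuallyEq (hs.congr h).mdiff hs.mdiff univ_mem h

theorem IsSmoothConnection.near (hc : IsSmoothConnection cov) (hs : SmoothSecNear F s x)
    (hX : SmoothSecNear R4 X x) : SmoothSecNear F (fun y ↦ cov s y (X y)) x := by
  obtain ⟨U, ho, hx, hU⟩ := hs.exists_contMDiffOn
  have h := (hc U ho).contMDiff (σ := s) (by simpa using hU)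
  filter_upwards [hX, ho.mem_nhds hx] with y h₁ hy
  exact (h.contMDiffAt (ho.mem_nhds hy)).clm_bundle_apply h₁

/-- The curvature `R(X,Y)s = ∇_X ∇_Y s - ∇_Y ∇_X s - ∇_[X,Y] s`. -/
def curvature (cov : CovariantDerivative (𝓡 4) F V) (X Y : ∀ x : M, TangentSpace (𝓡 4) x)
    (s : ∀ x, V x) (x : M) : V x :=
  cov (fun y ↦ cov s y (Y y)) x (X x) - cov (fun y ↦ cov s y (X y)) x (Y x)
    - cov s x (mlieBracket (𝓡 4) X Y x)

theorem curvature_swap : curvature cov X Y s x = -curvature cov Y X s x := by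
  simp only [curvature, mlieBracket_swap_apply (V := X), map_neg]
  abel

/-- The derivative of `f` along `Y` arises twice, from the Leibniz rule in `∇_Y (f ∇_X s)` and from
`[fX, Y]`, with opposite signs. -/
theorem curvature_tensorial_left (hc : IsSmoothConnection cov)
    (hs : SmoothSecNear F s x) : SmoothTensorialAt R4 (fun X ↦ curvature cov X Y s x) x where
  smul {f X} hf hX := by
    have : IsManifold (𝓡 4) 2 M := isManifold_two
    have e : (fun y ↦ cov s y ((f • X) y)) = f • fun y ↦ cov s y (X y) := by
      ext1 y; simp
    have h₁ : cov (fun y ↦ cov s y (Y y)) x ((f • X) x)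
        = f x • cov (fun y ↦ cov s y (Y y)) x (X x) :=
      (cov (fun y ↦ cov s y (Y y)) x).map_smul (f x) (X x)
    have h₂ : cov s x (mlieBracket (𝓡 4) (f • X) Y x)
        = f x • cov s x (mlieBracket (𝓡 4) X Y x) - mvfderiv (𝓡 4) f x (Y x) • cov s x (X x) := by
      rw [mlieBracket_smul_left hf.mdiff hX.mdiff, map_add, map_smul, map_smul]
      module
    simp only [curvature]
    rw [e, h₁, h₂, cov.smul_apply hf (hc.near hs hX)]
    module
  add {X X'} hX hX' := by
    have : IsManifold (𝓡 4) 2 M := isManifold_two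
    have e : (fun y ↦ cov s y ((X + X') y))
        = (fun y ↦ cov s y (X y)) + fun y ↦ cov s y (X' y) := by
      ext1 y; simp
    have h₁ : cov (fun y ↦ cov s y (Y y)) x ((X + X') x) =
        cov (fun y ↦ cov s y (Y y)) x (X x) + cov (fun y ↦ cov s y (Y y)) x (X' x) :=
      map_add _ _ _
    have h₂ : cov s x (mlieBracket (𝓡 4) (X + X') Y x)
        = cov s x (mlieBracket (𝓡 4) X Y x) + cov s x (mlieBracket (𝓡 4) X' Y x) := by
      rw [mlieBracket_add_left hX.mdiff hX'.mdiff, map_add]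
    simp only [curvature]
    rw [e, h₁, h₂, cov.add_apply (hc.near hs hX) (hc.near hs hX')]
    module

theorem curvature_tensorial_right (hc : IsSmoothConnection cov)
    (hs : SmoothSecNear F s x) :
    SmoothTensorialAt R4 (fun Y ↦ curvature cov X Y s x) x where
  smul {f Y} hf hY := by
    simp only [curvature_swap (X := X), (curvature_tensorial_left hc hs).smul hf hY, smul_neg]
  add {Y Y'} hY hY' := by
    simp only [curvature_swap (X := X), (curvature_tensorial_left hc hs).add hY hY', neg_add]

/-- The terms with one derivative of `f` are symmetric in `X` and `Y`. The second derivatives leave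
the commutator applied to `f`, which the bracket term cancels. -/
theorem curvature_tensorial_section (hc : IsSmoothConnection cov)
    (hX : SmoothSecNear R4 X x) (hY : SmoothSecNear R4 Y x) :
    SmoothTensorialAt F (fun s ↦ curvature cov X Y s x) x where
  smul {f s} hf hs := by
    have key {X Y : ∀ x : M, TangentSpace (𝓡 4) x} (hX : SmoothSecNear R4 X x)
        (hY : SmoothSecNear R4 Y x) : cov (fun y ↦ cov (f • s) y (Y y)) x (X x) =
          f x • cov (fun y ↦ cov s y (Y y)) x (X x)
          + mvfderiv (𝓡 4) f x (X x) • cov s x (Y x) + mvfderiv (𝓡 4) f x (Y x) • cov s x (X x)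
          + mvfderiv (𝓡 4) (fun y ↦ mvfderiv (𝓡 4) f y (Y y)) x (X x) • s x := by
      have e : ∀ᶠ y in 𝓝 x, cov (f • s) y (Y y) = (f • (fun y ↦ cov s y (Y y)) +
          (fun y ↦ mvfderiv (𝓡 4) f y (Y y)) • s) y := by
        filter_upwards [hf.eventually, hs.eventually] with y h₁ h₂ using cov.smul_apply h₁ h₂ _
      have h₁ := SmoothSecNear.smul hf (hc.near hs hY)
      have h₂ := SmoothSecNear.smul (hf.deriv hY) hs
      rw [cov.congr (h₁.add h₂) e, cov.add_apply h₁ h₂, cov.smul_apply hf (hc.near hs hY),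
        cov.smul_apply (hf.deriv hY) hs]
      module
    simp only [curvature, key hX hY, key hY hX, cov.smul_apply hf hs,
      mvfderiv_mlieBracket_real hX hY hf]
    module
  add {s t} hs ht := by
    have key {X Y : ∀ x : M, TangentSpace (𝓡 4) x} (hY : SmoothSecNear R4 Y x) :
        cov (fun y ↦ cov (s + t) y (Y y)) x (X x) =
          cov (fun y ↦ cov s y (Y y)) x (X x) + cov (fun y ↦ cov t y (Y y)) x (X x) := by
      have e : ∀ᶠ y in 𝓝 x, cov (s + t) y (Y y) =
          ((fun y ↦ cov s y (Y y)) + fun y ↦ cov t y (Y y)) y := by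
        filter_upwards [hs.eventually, ht.eventually] with y h₁ h₂ using cov.add_apply h₁ h₂ _
      rw [cov.congr ((hc.near hs hY).add (hc.near ht hY)) e,
        cov.add_apply (hc.near hs hY) (hc.near ht hY)]
    simp only [curvature, key hX, key hY, cov.add_apply hs ht]
    module

theorem curvature_congr [FiniteDimensional ℝ F] [ContMDiffVectorBundle ∞ F V (𝓡 4)]
    (hc : IsSmoothConnection cov) (hX : SmoothSecNear R4 X x) (hX' : SmoothSecNear R4 X' x)
    (hY : SmoothSecNear R4 Y x) (hY' : SmoothSecNear R4 Y' x) (hs : SmoothSecNear F s x)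
    (ht : SmoothSecNear F t x) (hXX : X x = X' x) (hYY : Y x = Y' x) (hst : s x = t x) :
    curvature cov X Y s x = curvature cov X' Y' t x :=
  ((curvature_tensorial_left hc hs).pointwise hX hX' hXX).trans
    (((curvature_tensorial_right hc hs).pointwise hY hY' hYY).trans
      ((curvature_tensorial_section hc hX' hY').pointwise hs ht hst))

end Curvature

/-! ### Complexified tangent vectors as pairs of spinors -/

section Spinors

open Filter Topology VectorField

variable {M : Type*} [TopologicalSpace M] [ChartedSpace R4 M] [IsManifold (𝓡 4) ∞ M]
  {S : M → Type*} [TopologicalSpace (TotalSpace C2 S)]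
  [∀ x, AddCommGroup (S x)] [∀ x, Module ℝ (S x)] [∀ x, Module ℂ (S x)]
  [∀ x, IsScalarTower ℝ ℂ (S x)] [∀ x, TopologicalSpace (S x)]
  [∀ x, IsTopologicalAddGroup (S x)] [∀ x, ContinuousSMul ℝ (S x)]
  [FiberBundle C2 S] [VectorBundle ℝ C2 S]
  {g : LorentzMetric M} (σ : SpinStructure S g) {x : M}

namespace SpinStructure

section complexify

variable {W : Type*} [AddCommGroup W] [Module ℝ W] [Module ℂ W] [IsScalarTower ℝ ℂ W]
  {L L' : TangentSpace (𝓡 4) x → W} {a a' b b' : S x}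

/-- The value of the complex linear extension of `L` at the complex vector `a^A (conj b)^A'`. -/
def complexify (L : TangentSpace (𝓡 4) x → W) (a b : S x) : W :=
  L (σ.vec x a b) - Complex.I • L (σ.vec x (Complex.I • a) b)

theorem cext_eq (L : TangentSpace (𝓡 4) x → ℂ) : σ.cext L = σ.complexify L := rfl

theorem vec_right_I_smul (a b : S x) :
    σ.vec x a (Complex.I • b) = -σ.vec x (Complex.I • a) b := by
  rw [← σ.vec_I_smul x a (Complex.I • b), smul_smul, Complex.I_mul_I, neg_one_smul, map_neg]

/-- The imaginary part of `a^A (conj a)^A'` is antisymmetric by `vec_right_I_smul` and symmetric by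
`vec_symm`: the vector is real. -/
theorem vec_I_smul_self (a : S x) : σ.vec x (Complex.I • a) a = 0 := by
  have h := σ.vec_right_I_smul a a
  rw [σ.vec_symm] at h
  linear_combination (norm := module) (1 / 2 : ℝ) • h

theorem complexify_sub_left (hL : IsLinearMap ℝ L) :
    σ.complexify L (a - a') b = σ.complexify L a b - σ.complexify L a' b := by
  simp only [complexify, map_sub, smul_sub, LinearMap.sub_apply, hL.map_sub]
  abel

theorem complexify_add_left (hL : IsLinearMap ℝ L) :
    σ.complexify L (a + a') b = σ.complexify L a b + σ.complexify L a' b := by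
  simp only [complexify, map_add, smul_add, LinearMap.add_apply, hL.map_add]
  abel

theorem complexify_add_right (hL : IsLinearMap ℝ L) :
    σ.complexify L a (b + b') = σ.complexify L a b + σ.complexify L a b' := by
  simp only [complexify, map_add, smul_add, LinearMap.add_apply, hL.map_add]
  abel

theorem complexify_I_smul_left (hL : IsLinearMap ℝ L) :
    σ.complexify L (Complex.I • a) b = Complex.I • σ.complexify L a b := by
  have h : σ.vec x (Complex.I • Complex.I • a) b = -σ.vec x a b := by
    rw [σ.vec_symm, vec_right_I_smul, vec_symm, vec_I_smul]
  simp only [complexify, h, hL.map_neg, smul_sub, smul_neg]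
  rw [smul_smul Complex.I Complex.I, Complex.I_mul_I]
  module

theorem complexify_I_smul_right (hL : IsLinearMap ℝ L) :
    σ.complexify L a (Complex.I • b) = -Complex.I • σ.complexify L a b := by
  rw [complexify, vec_I_smul, vec_right_I_smul, hL.map_neg, complexify, smul_sub, smul_smul,
    neg_mul, Complex.I_mul_I]
  module

theorem complexify_real_smul_left (hL : IsLinearMap ℝ L) (r : ℝ) :
    σ.complexify L (r • a) b = r • σ.complexify L a b := by
  simp only [complexify, smul_comm Complex.I r, map_smul, LinearMap.smul_apply, hL.map_smul,
    smul_sub]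

theorem complexify_real_smul_right (hL : IsLinearMap ℝ L) (r : ℝ) :
    σ.complexify L a (r • b) = r • σ.complexify L a b := by
  simp only [complexify, smul_comm Complex.I r, map_smul, LinearMap.smul_apply, hL.map_smul,
    smul_sub]

end complexify

end SpinStructure

/-- The fibres carry separate real and complex module structures, joined by the scalar tower.
Splitting a scalar this way upgrades real linearity plus compatibility with `i` to complex
linearity. -/
theorem complex_smul_eq {W : Type*} [AddCommGroup W] [Module ℝ W] [Module ℂ W]
    [IsScalarTower ℝ ℂ W] (z : ℂ) (w : W) : z • w = z.re • w + z.im • Complex.I • w := by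
  conv_lhs => rw [← z.re_add_im, add_smul, mul_smul]
  exact congrArg₂ _ (algebraMap_smul ℂ z.re w) (algebraMap_smul ℂ z.im _)

namespace SpinStructure

variable {W : Type*} [AddCommGroup W] [Module ℝ W] [Module ℂ W] [IsScalarTower ℝ ℂ W]
  {L L' : TangentSpace (𝓡 4) x → W} {a a' b b' : S x}

theorem complexify_smul_left (hL : IsLinearMap ℝ L) (z : ℂ) :
    σ.complexify L (z • a) b = z • σ.complexify L a b := by
  rw [complex_smul_eq, σ.complexify_add_left hL, σ.complexify_real_smul_left hL,
    σ.complexify_real_smul_left hL, σ.complexify_I_smul_left hL, ← complex_smul_eq]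

theorem complexify_smul_right (hL : IsLinearMap ℝ L) (z : ℂ) :
    σ.complexify L a (z • b) = conj z • σ.complexify L a b := by
  rw [complex_smul_eq, σ.complexify_add_right hL, σ.complexify_real_smul_right hL,
    σ.complexify_real_smul_right hL, σ.complexify_I_smul_right hL, complex_smul_eq (conj z)]
  simp

theorem complexify_add (L L' : TangentSpace (𝓡 4) x → W) (a b : S x) :
    σ.complexify (fun v ↦ L v + L' v) a b = σ.complexify L a b + σ.complexify L' a b := by
  simp only [complexify, smul_add]; abel

/-- Complex conjugation sends the vector `a (conj b)` to `b (conj a)`, whence the exchange of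
arguments. This is the origin of the transposed index pairs in all conjugate formulas. -/
theorem complexify_conj {L : TangentSpace (𝓡 4) x → ℂ} (hL : IsLinearMap ℝ L) (a b : S x) :
    σ.complexify (fun v ↦ conj (L v)) a b = conj (σ.complexify L b a) := by
  simp only [complexify, σ.vec_symm x b a, σ.vec_symm x _ a, vec_right_I_smul, hL.map_neg,
    smul_eq_mul, map_sub, map_mul, map_neg, Complex.conj_I]
  ring

theorem complexify_comm (B : TangentSpace (𝓡 4) x → TangentSpace (𝓡 4) x → W) (a a' b b' : S x) :
    σ.complexify (fun u ↦ σ.complexify (fun v ↦ B u v) b b') a a'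
      = σ.complexify (fun v ↦ σ.complexify (fun u ↦ B u v) a a') b b' := by
  simp only [complexify, smul_sub]; abel

/-- A real part is half the sum of a complex vector and its conjugate; this recovers a real linear
map from its spinor components. -/
theorem apply_vec {L : TangentSpace (𝓡 4) x → W} (hL : IsLinearMap ℝ L) (a b : S x) :
    (2 : ℂ) • L (σ.vec x a b) = σ.complexify L a b + σ.complexify L b a := by
  simp only [complexify, σ.vec_symm x b a, σ.vec_symm x _ a, vec_right_I_smul, hL.map_neg]
  module

theorem isLinearMap_complexify {B : TangentSpace (𝓡 4) x → TangentSpace (𝓡 4) x → W}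
    (hB : ∀ v, IsLinearMap ℝ fun u ↦ B u v) :
    IsLinearMap ℝ fun u ↦ σ.complexify (fun v ↦ B u v) b b' where
  map_add u u' := by simp only [complexify, (hB _).map_add, smul_add]; abel
  map_smul r u := by
    simp only [complexify, (hB _).map_smul, smul_sub, smul_comm Complex.I r]

end SpinStructure

section smooth

variable {s t : ∀ x, S x}

/-- Smoothness refers to the real bundle structure. The trivializations are complex linear as well,
so in them multiplication by `i` is a constant linear map. -/
theorem SmoothSecNear.I_smul [VectorBundle ℂ C2 S] (hs : SmoothSecNear C2 s x) :
    SmoothSecNear C2 (fun y ↦ Complex.I • s y) x := by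
  filter_upwards [hs] with y hy
  rw [contMDiffAt_section] at hy ⊢
  have h := (Complex.I • ContinuousLinearMap.id ℝ C2).contMDiff.contMDiffAt.comp (n := ∞) y hy
  refine h.congr_of_eventuallyEq ?_
  filter_upwards [(trivializationAt C2 S y).open_baseSet.mem_nhds
    (FiberBundle.mem_baseSet_trivializationAt C2 S y)] with z hz
  exact ((trivializationAt C2 S y).linear ℂ hz).map_smul _ _

end smooth

end Spinors

/-! ### Curvature as a multilinear map at a point -/

section Curvature

open Filter Topology VectorField

variable {M : Type*} [TopologicalSpace M] [ChartedSpace R4 M] [IsManifold (𝓡 4) ∞ M]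
  {F : Type*} [NormedAddCommGroup F] [NormedSpace ℝ F] [FiniteDimensional ℝ F]
  {V : M → Type*} [TopologicalSpace (TotalSpace F V)] [∀ x, AddCommGroup (V x)]
  [∀ x, Module ℝ (V x)] [∀ x, TopologicalSpace (V x)] [FiberBundle F V] [VectorBundle ℝ F V]
  [∀ x, IsTopologicalAddGroup (V x)] [∀ x, ContinuousSMul ℝ (V x)]
  [ContMDiffVectorBundle ∞ F V (𝓡 4)]
  {cov : CovariantDerivative (𝓡 4) F V} {x : M}

theorem SmoothSecNear.neg {s : ∀ x, V x} (hs : SmoothSecNear F s x) :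
    SmoothSecNear F (-s) x := by
  filter_upwards [hs] with y h₁ using h₁.neg_section

theorem SmoothSecNear.sub {s t : ∀ x, V x} (hs : SmoothSecNear F s x)
    (ht : SmoothSecNear F t x) : SmoothSecNear F (s - t) x := by
  filter_upwards [hs, ht] with y h₁ h₂ using h₁.sub_section h₂

theorem SmoothSecNear.curvature (hc : IsSmoothConnection cov)
    {X Y : ∀ x : M, TangentSpace (𝓡 4) x} {s : ∀ x, V x} (hX : SmoothSecNear R4 X x)
    (hY : SmoothSecNear R4 Y x) (hs : SmoothSecNear F s x) :
    SmoothSecNear F (curvature cov X Y s) x :=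
  ((hc.near (hc.near hs hY) hX).sub (hc.near (hc.near hs hX) hY)).sub
    (hc.near hs (hX.mlieBracket hY))

/-- The curvature as a tensor at a point. -/
def curvatureAt (cov : CovariantDerivative (𝓡 4) F V) (x : M) (u v : TangentSpace (𝓡 4) x)
    (a : V x) : V x :=
  curvature cov (FiberBundle.extend R4 u) (FiberBundle.extend R4 v) (FiberBundle.extend F a) x

theorem curvature_eq (hc : IsSmoothConnection cov) {X Y : ∀ x : M, TangentSpace (𝓡 4) x}
    {s : ∀ x, V x} (hX : SmoothSecNear R4 X x) (hY : SmoothSecNear R4 Y x)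
    (hs : SmoothSecNear F s x) : curvature cov X Y s x = curvatureAt cov x (X x) (Y x) (s x) :=
  curvature_congr hc hX (.extend _) hY (.extend _) hs (.extend _)
    (FiberBundle.extend_apply_self ..).symm (FiberBundle.extend_apply_self ..).symm
    (FiberBundle.extend_apply_self ..).symm

theorem curvatureAt_swap (u v : TangentSpace (𝓡 4) x) (a : V x) :
    curvatureAt cov x u v a = -curvatureAt cov x v u a := curvature_swap

theorem curvatureAt_isLinearMap_left (hc : IsSmoothConnection cov) (v : TangentSpace (𝓡 4) x)
    (a : V x) : IsLinearMap ℝ fun u ↦ curvatureAt cov x u v a where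
  map_add u u' := by
    have h := (curvature_tensorial_left (Y := FiberBundle.extend R4 v) hc (.extend a)).add
      (s := FiberBundle.extend R4 u)
      (t := FiberBundle.extend R4 u') (.extend u) (.extend u')
    rw [curvature_eq hc (.add (.extend u) (.extend u')) (.extend v) (.extend a)] at h
    simpa only [Pi.add_apply, FiberBundle.extend_apply_self] using! h
  map_smul r u := by
    have hr : SmoothFunNear (fun _ : M ↦ r) x := smoothFunNear_const r
    have h := (curvature_tensorial_left (Y := FiberBundle.extend R4 v) hc (.extend a)).smul
      (s := FiberBundle.extend R4 u) hr (.extend u)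
    rw [curvature_eq hc (.smul hr (.extend u)) (.extend v) (.extend a)] at h
    simpa only [Pi.smul_apply', FiberBundle.extend_apply_self] using! h

theorem curvatureAt_isLinearMap_right (hc : IsSmoothConnection cov) (u : TangentSpace (𝓡 4) x)
    (a : V x) : IsLinearMap ℝ fun v ↦ curvatureAt cov x u v a where
  map_add v v' := by
    simp only [curvatureAt_swap u, (curvatureAt_isLinearMap_left hc u a).map_add, neg_add]
  map_smul r v := by
    simp only [curvatureAt_swap u, (curvatureAt_isLinearMap_left hc u a).map_smul, smul_neg]

theorem curvatureAt_add (hc : IsSmoothConnection cov) (u v : TangentSpace (𝓡 4) x)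
    (a b : V x) :
    curvatureAt cov x u v (a + b) = curvatureAt cov x u v a + curvatureAt cov x u v b := by
  have h := (curvature_tensorial_section hc (.extend u) (.extend v)).add (.extend a) (.extend b)
  rw [curvature_eq hc (.extend u) (.extend v) (.add (.extend a) (.extend b))] at h
  simpa only [Pi.add_apply, FiberBundle.extend_apply_self] using! h

theorem curvatureAt_smul (hc : IsSmoothConnection cov) (u v : TangentSpace (𝓡 4) x)
    (r : ℝ) (a : V x) : curvatureAt cov x u v (r • a) = r • curvatureAt cov x u v a := by
  have hr : SmoothFunNear (fun _ : M ↦ r) x := smoothFunNear_const r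
  have h := (curvature_tensorial_section hc (.extend u) (.extend v)).smul hr (.extend a)
  rw [curvature_eq hc (.extend u) (.extend v) (.smul hr (.extend a))] at h
  simpa only [Pi.smul_apply', FiberBundle.extend_apply_self] using! h

end Curvature

/-! ### The first Bianchi identity -/

section LeviCivita

open Filter Topology VectorField

variable {M : Type*} [TopologicalSpace M] [ChartedSpace R4 M] [IsManifold (𝓡 4) ∞ M]
  {g : LorentzMetric M}
  {nabla : CovariantDerivative (𝓡 4) R4 (TangentSpace (𝓡 4) : M → Type _)} {x : M}
  {X Y Z : ∀ x : M, TangentSpace (𝓡 4) x}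

theorem riemann_eq (x : M) (u v w : TangentSpace (𝓡 4) x) :
    riemann nabla x u v w = curvatureAt nabla x u v w := by
  simp only [riemann, curvatureAt, curvature, FiberBundle.extend_apply_self]

theorem IsLeviCivita.isSmoothConnection (hn : IsLeviCivita g nabla) :
    IsSmoothConnection nabla := hn.smooth

theorem IsLeviCivita.mlieBracket_eq (hn : IsLeviCivita g nabla) (hX : SmoothSecNear R4 X x)
    (hY : SmoothSecNear R4 Y x) :
    mlieBracket (𝓡 4) X Y x = nabla Y x (X x) - nabla X x (Y x) :=
  (hn.torsion_free X Y x hX.mdiff hY.mdiff).symm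

/-- The first Bianchi identity. -/
theorem IsLeviCivita.bianchi (hn : IsLeviCivita g nabla) (u v w : TangentSpace (𝓡 4) x) :
    riemann nabla x u v w + riemann nabla x v w u + riemann nabla x w u v = 0 := by
  have hc := hn.isSmoothConnection
  simp only [riemann_eq, curvatureAt, curvature]
  have hX : SmoothSecNear R4 (FiberBundle.extend R4 u) x := .extend u
  have hY : SmoothSecNear R4 (FiberBundle.extend R4 v) x := .extend v
  have hZ : SmoothSecNear R4 (FiberBundle.extend R4 w) x := .extend w
  set X := FiberBundle.extend R4 u
  set Y := FiberBundle.extend R4 v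
  set Z := FiberBundle.extend R4 w
  have key {X Y Z : ∀ x : M, TangentSpace (𝓡 4) x} (hX : SmoothSecNear R4 X x)
      (hY : SmoothSecNear R4 Y x) (hZ : SmoothSecNear R4 Z x) :
      mlieBracket (𝓡 4) X (mlieBracket (𝓡 4) Y Z) x =
        nabla (fun y ↦ nabla Z y (Y y)) x (X x) - nabla (fun y ↦ nabla Y y (Z y)) x (X x)
          - nabla X x (mlieBracket (𝓡 4) Y Z x) := by
    have h₁ := hc.near hZ hY
    have h₂ := hc.near hY hZ
    have e : ∀ᶠ y in 𝓝 x, mlieBracket (𝓡 4) Y Z y =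
        ((fun y ↦ nabla Z y (Y y)) + -fun y ↦ nabla Y y (Z y)) y := by
      filter_upwards [hY.eventually, hZ.eventually] with y hy hz
      simpa [sub_eq_add_neg] using hn.mlieBracket_eq hy hz
    have h₃ : nabla (-fun y ↦ nabla Y y (Z y)) x (X x)
        = -nabla (fun y ↦ nabla Y y (Z y)) x (X x) := by
      have hr : SmoothFunNear (fun _ : M ↦ (-1 : ℝ)) x := smoothFunNear_const (-1)
      have := nabla.smul_apply hr h₂ (X x)
      simpa [mvfderiv_const, Pi.neg_def, Pi.smul_def'] using this
    rw [hn.mlieBracket_eq hX (hY.mlieBracket hZ), nabla.congr (h₁.add h₂.neg) e,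
      nabla.add_apply h₁ h₂.neg, h₃]
    abel
  -- Vanishing torsion has turned each double bracket into second covariant derivatives and one
  -- derivative along a bracket. Once signs are normalized by antisymmetry of the bracket, the
  -- Jacobi identity is the cyclic sum of curvatures.
  have j := jacobi_mlieBracket hX hY hZ
  rw [key hX hY hZ, mlieBracket_swap_apply (V := mlieBracket (𝓡 4) X Y), key hZ hX hY,
    key hY hX hZ, mlieBracket_swap_apply (V := X) (W := Z)] at j
  rw [map_neg] at j
  linear_combination (norm := skip) j
  abel

end LeviCivita

/-! ### Commutators and curvature along complex null fields -/

section SpinConnection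

open Filter Topology VectorField

variable {M : Type*} [TopologicalSpace M] [ChartedSpace R4 M] [IsManifold (𝓡 4) ∞ M]
  {S : M → Type*} [TopologicalSpace (TotalSpace C2 S)]
  [∀ x, AddCommGroup (S x)] [∀ x, Module ℝ (S x)] [∀ x, Module ℂ (S x)]
  [∀ x, IsScalarTower ℝ ℂ (S x)] [∀ x, TopologicalSpace (S x)]
  [∀ x, IsTopologicalAddGroup (S x)] [∀ x, ContinuousSMul ℝ (S x)]
  [FiberBundle C2 S] [VectorBundle ℝ C2 S] [VectorBundle ℂ C2 S]
  {g : LorentzMetric M} {σ : SpinStructure S g} {x : M}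
  {nabla : CovariantDerivative (𝓡 4) R4 (TangentSpace (𝓡 4) : M → Type _)}
  {D : CovariantDerivative (𝓡 4) C2 S}
  {r s t s' t' : ∀ x, S x} {X Y : ∀ x : M, TangentSpace (𝓡 4) x}

theorem CovariantDerivative.isLinearMap (D : CovariantDerivative (𝓡 4) C2 S) (s : ∀ x, S x)
    (x : M) : IsLinearMap ℝ fun v ↦ D s x v := (D s x).toLinearMap.isLinear

theorem isLinearMap_mvfderiv (f : M → ℂ) (x : M) :
    IsLinearMap ℝ fun v ↦ mvfderiv (𝓡 4) f x v := (mvfderiv (𝓡 4) f x).toLinearMap.isLinear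

namespace SpinStructure

/-- The field of the real parts of `s^A (conj t)^A'`. -/
def vecField (σ : SpinStructure S g) (s t : ∀ x, S x) (x : M) : TangentSpace (𝓡 4) x :=
  σ.vec x (s x) (t x)

theorem smoothSecNear_vecField (hs : SmoothSecNear C2 s x) (ht : SmoothSecNear C2 t x) :
    SmoothSecNear R4 (σ.vecField s t) x := by
  obtain ⟨U, hU, hx, hs⟩ := hs.exists_contMDiffOn
  obtain ⟨U', hU', hx', ht⟩ := ht.exists_contMDiffOn
  exact .of_contMDiffOn (σ.vec_smooth _ (hU.inter hU') s t (hs.mono Set.inter_subset_left)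
    (ht.mono Set.inter_subset_right)) (hU.inter hU') ⟨hx, hx'⟩

theorem smoothFunNear_eps (hs : SmoothSecNear C2 s x) (ht : SmoothSecNear C2 t x) :
    SmoothFunNear (fun y ↦ σ.eps y (s y) (t y)) x := by
  obtain ⟨U, hU, hx, hs⟩ := hs.exists_contMDiffOn
  obtain ⟨U', hU', hx', ht⟩ := ht.exists_contMDiffOn
  exact smoothFunNear_of_contMDiffOn (σ.eps_smooth _ (hU.inter hU') s t
    (hs.mono Set.inter_subset_left) (ht.mono Set.inter_subset_right)) (hU.inter hU') ⟨hx, hx'⟩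

/-- The derivative of a spinor field along the complex vector field `s^A (conj t)^A'`. -/
def nablaC (σ : SpinStructure S g) (D : CovariantDerivative (𝓡 4) C2 S) (s t r : ∀ x, S x)
    (x : M) : S x :=
  σ.complexify (fun v ↦ D r x v) (s x) (t x)

/-- The derivative of a function along the complex vector field `s^A (conj t)^A'`. -/
def derivC (σ : SpinStructure S g) (s t : ∀ x, S x) (f : M → ℂ) (x : M) : ℂ :=
  σ.complexify (fun v ↦ mvfderiv (𝓡 4) f x v) (s x) (t x)

/-- The complex bilinear extension of an operation on vector fields. -/
def complexifyTwo {W : Type*} [AddCommGroup W] [Module ℂ W] (σ : SpinStructure S g)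
    (B : (∀ x : M, TangentSpace (𝓡 4) x) → (∀ x : M, TangentSpace (𝓡 4) x) → W)
    (s t s' t' : ∀ x, S x) : W :=
  B (σ.vecField s t) (σ.vecField s' t')
    - Complex.I • B (σ.vecField s t) (σ.vecField (fun y ↦ Complex.I • s' y) t')
    - Complex.I • (B (σ.vecField (fun y ↦ Complex.I • s y) t) (σ.vecField s' t')
      - Complex.I • B (σ.vecField (fun y ↦ Complex.I • s y) t)
        (σ.vecField (fun y ↦ Complex.I • s' y) t'))

theorem complexifyTwo_congr {W : Type*} [AddCommGroup W] [Module ℂ W]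
    {B B' : (∀ x : M, TangentSpace (𝓡 4) x) → (∀ x : M, TangentSpace (𝓡 4) x) → W}
    (h : ∀ X Y, SmoothSecNear R4 X x → SmoothSecNear R4 Y x → B X Y = B' X Y)
    (hs : SmoothSecNear C2 s x) (ht : SmoothSecNear C2 t x)
    (hs' : SmoothSecNear C2 s' x) (ht' : SmoothSecNear C2 t' x) :
    σ.complexifyTwo B s t s' t' = σ.complexifyTwo B' s t s' t' := by
  have h₁ := smoothSecNear_vecField (σ := σ) hs ht
  have h₂ := smoothSecNear_vecField (σ := σ) hs.I_smul ht
  have h₃ := smoothSecNear_vecField (σ := σ) hs' ht'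
  have h₄ := smoothSecNear_vecField (σ := σ) hs'.I_smul ht'
  simp only [complexifyTwo, h _ _ h₁ h₃, h _ _ h₁ h₄, h _ _ h₂ h₃, h _ _ h₂ h₄]

theorem nablaC_eq : σ.nablaC D s t r x = D r x (σ.vec x (s x) (t x))
    - Complex.I • D r x (σ.vec x (Complex.I • s x) (t x)) := rfl

theorem derivC_eq (f : M → ℂ) : σ.derivC s t f x = mvfderiv (𝓡 4) f x (σ.vec x (s x) (t x))
    - Complex.I • mvfderiv (𝓡 4) f x (σ.vec x (Complex.I • s x) (t x)) := rfl

namespace IsSpinConnection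

theorem isSmoothConnection (hD : σ.IsSpinConnection nabla D) : IsSmoothConnection D := hD.smooth

/-- Vanishing torsion writes the bracket as a difference of covariant derivatives, and since `vec`
is parallel these fall on the spinor factors. -/
theorem mlieBracket_vecField (hD : σ.IsSpinConnection nabla D) (hn : IsLeviCivita g nabla)
    (hs : SmoothSecNear C2 s x) (ht : SmoothSecNear C2 t x)
    (hs' : SmoothSecNear C2 s' x) (ht' : SmoothSecNear C2 t' x) :
    mlieBracket (𝓡 4) (σ.vecField s t) (σ.vecField s' t') x =
      σ.vec x (D s' x (σ.vec x (s x) (t x))) (t' x) + σ.vec x (s' x) (D t' x (σ.vec x (s x) (t x)))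
      - σ.vec x (D s x (σ.vec x (s' x) (t' x))) (t x)
      - σ.vec x (s x) (D t x (σ.vec x (s' x) (t' x))) := by
  rw [hn.mlieBracket_eq (smoothSecNear_vecField hs ht) (smoothSecNear_vecField hs' ht')]
  have h₁ := hD.vec_parallel s t x hs.mdiff ht.mdiff (σ.vec x (s' x) (t' x))
  have h₂ := hD.vec_parallel s' t' x hs'.mdiff ht'.mdiff (σ.vec x (s x) (t x))
  rw [sub_sub]
  exact congrArg₂ _ h₂ h₁

/-- The Lie bracket of two complex null vector fields. -/
theorem complexifyTwo_mlieBracket {W : Type*} [AddCommGroup W] [Module ℝ W] [Module ℂ W]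
    [IsScalarTower ℝ ℂ W] (hD : σ.IsSpinConnection nabla D) (hn : IsLeviCivita g nabla)
    {L : TangentSpace (𝓡 4) x → W} (hL : IsLinearMap ℝ L)
    (hs : SmoothSecNear C2 s x) (ht : SmoothSecNear C2 t x)
    (hs' : SmoothSecNear C2 s' x) (ht' : SmoothSecNear C2 t' x) :
    σ.complexifyTwo (fun X Y ↦ L (mlieBracket (𝓡 4) X Y x)) s t s' t' =
      σ.complexify L (σ.nablaC D s t s' x) (t' x) + σ.complexify L (s' x) (σ.nablaC D t s t' x)
      - σ.complexify L (σ.nablaC D s' t' s x) (t x)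
      - σ.complexify L (s x) (σ.nablaC D t' s' t x) := by
  have key {s t s' t' : ∀ x, S x} (hs : SmoothSecNear C2 s x) (ht : SmoothSecNear C2 t x)
      (hs' : SmoothSecNear C2 s' x) (ht' : SmoothSecNear C2 t' x) :
      L (mlieBracket (𝓡 4) (σ.vecField s t) (σ.vecField s' t') x) =
        L (σ.vec x (D s' x (σ.vec x (s x) (t x))) (t' x))
        + L (σ.vec x (s' x) (D t' x (σ.vec x (s x) (t x))))
        - L (σ.vec x (D s x (σ.vec x (s' x) (t' x))) (t x))
        - L (σ.vec x (s x) (D t x (σ.vec x (s' x) (t' x)))) := by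
    rw [hD.mlieBracket_vecField hn hs ht hs' ht', hL.map_sub, hL.map_sub, hL.map_add]
  have h₁ (s t s' : ∀ x, S x) (b : S x) : σ.complexify L (σ.nablaC D s t s' x) b =
      σ.complexify L (D s' x (σ.vec x (s x) (t x))) b
        - Complex.I • σ.complexify L (D s' x (σ.vec x (Complex.I • s x) (t x))) b := by
    rw [nablaC_eq, σ.complexify_sub_left hL, σ.complexify_I_smul_left hL]
  -- A primed factor is the conjugate of a spinor field, so its derivative along `s (conj t)` is the
  -- conjugate of the derivative along `t (conj s)`. The sign from conjugate linearity in the second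
  -- slot and the sign from moving `i` across `vec` compensate.
  have h₂ (s t t' : ∀ x, S x) (b : S x) : σ.complexify L b (σ.nablaC D t s t' x) =
      σ.complexify L b (D t' x (σ.vec x (s x) (t x)))
        - Complex.I • σ.complexify L b (D t' x (σ.vec x (Complex.I • s x) (t x))) := by
    rw [nablaC_eq, sub_eq_add_neg, ← smul_neg, σ.complexify_add_right hL,
      σ.complexify_I_smul_right hL, ← map_neg, ← vec_right_I_smul, σ.vec_symm,
      σ.vec_symm x (Complex.I • s x), sub_eq_add_neg, neg_smul]
  simp only [complexifyTwo, key hs ht hs' ht', key hs ht hs'.I_smul ht',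
    key hs.I_smul ht hs' ht', key hs.I_smul ht hs'.I_smul ht', hD.complex_linear _ _ hs.mdiff,
    hD.complex_linear _ _ hs'.mdiff]
  rw [h₁, h₁, h₂, h₂]
  simp only [complexify]
  module

/-- The connection satisfies the Leibniz rule for real functions only; `complex_linear` supplies it
for the imaginary part. -/
theorem apply_smul (hD : σ.IsSpinConnection nabla D) {f : M → ℂ} (hf : SmoothFunNear f x)
    (hr : SmoothSecNear C2 r x) (v : TangentSpace (𝓡 4) x) : D (fun y ↦ f y • r y) x v =
      mvfderiv (𝓡 4) f x v • r x + f x • D r x v := by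
  have e : (fun y ↦ f y • r y) = (fun y ↦ Complex.reCLM (f y)) • r
      + (fun y ↦ Complex.imCLM (f y)) • fun y ↦ Complex.I • r y := by
    ext1 y
    exact complex_smul_eq _ _
  rw [e, D.add_apply (.smul (hf.clm_comp _) hr) (.smul (hf.clm_comp _) hr.I_smul),
    D.smul_apply (hf.clm_comp _) hr, D.smul_apply (hf.clm_comp _) hr.I_smul,
    mvfderiv_clm_comp hf.mdiff, mvfderiv_clm_comp hf.mdiff, hD.complex_linear _ _ hr.mdiff,
    complex_smul_eq (f x), complex_smul_eq (mvfderiv (𝓡 4) f x v)]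
  simp only [Complex.reCLM_apply, Complex.imCLM_apply]
  module

theorem nablaC_smul (hD : σ.IsSpinConnection nabla D) {f : M → ℂ} (hf : SmoothFunNear f x)
    (hr : SmoothSecNear C2 r x) : σ.nablaC D s t (fun y ↦ f y • r y) x =
      σ.derivC s t f x • r x + f x • σ.nablaC D s t r x := by
  simp only [nablaC_eq, derivC_eq, hD.apply_smul hf hr]
  module

theorem D_sub_I_smul (hD : σ.IsSpinConnection nabla D) (hs : SmoothSecNear C2 s x)
    (ht : SmoothSecNear C2 t x) (v : TangentSpace (𝓡 4) x) :
    D (fun y ↦ s y - Complex.I • t y) x v = D s x v - Complex.I • D t x v := by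
  have e : (fun y ↦ s y - Complex.I • t y) =
      s + (fun _ : M ↦ (-1 : ℝ)) • fun y ↦ Complex.I • t y := by
    ext1 y
    simp [sub_eq_add_neg]
  have hr : SmoothFunNear (fun _ : M ↦ (-1 : ℝ)) x := smoothFunNear_const (-1)
  rw [e, D.add_apply hs (.smul hr ht.I_smul), D.smul_apply hr ht.I_smul,
    hD.complex_linear _ _ ht.mdiff]
  simp [mvfderiv_const, sub_eq_add_neg]

/-- The definition of curvature extends complex bilinearly, because `D` commutes with the constant
factor `i`; only the bracket term needs the spinor form of the Lie bracket. -/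
theorem complexifyTwo_curvature (hD : σ.IsSpinConnection nabla D) (hn : IsLeviCivita g nabla)
    (hr : SmoothSecNear C2 r x) (hs : SmoothSecNear C2 s x) (ht : SmoothSecNear C2 t x)
    (hs' : SmoothSecNear C2 s' x) (ht' : SmoothSecNear C2 t' x) :
    σ.complexifyTwo (fun X Y ↦ curvature D X Y r x) s t s' t' =
      σ.nablaC D s t (σ.nablaC D s' t' r) x - σ.nablaC D s' t' (σ.nablaC D s t r) x
      - (σ.complexify (fun v ↦ D r x v) (σ.nablaC D s t s' x) (t' x)
        + σ.complexify (fun v ↦ D r x v) (s' x) (σ.nablaC D t s t' x)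
        - σ.complexify (fun v ↦ D r x v) (σ.nablaC D s' t' s x) (t x)
        - σ.complexify (fun v ↦ D r x v) (s x) (σ.nablaC D t' s' t x)) := by
  rw [← hD.complexifyTwo_mlieBracket hn (D.isLinearMap r x) hs ht hs' ht']
  have key {s t : ∀ x, S x} (hs : SmoothSecNear C2 s x) (ht : SmoothSecNear C2 t x)
      (v : TangentSpace (𝓡 4) x) : D (σ.nablaC D s t r) x v =
        D (fun y ↦ D r y (σ.vecField s t y)) x v
        - Complex.I • D (fun y ↦ D r y (σ.vecField (fun y ↦ Complex.I • s y) t y)) x v :=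
    hD.D_sub_I_smul (hD.isSmoothConnection.near hr (smoothSecNear_vecField hs ht))
      (hD.isSmoothConnection.near hr (smoothSecNear_vecField hs.I_smul ht)) v
  rw [nablaC_eq, nablaC_eq (s := s')]
  simp only [key hs ht, key hs' ht', complexifyTwo, curvature]
  simp only [vecField]
  module

theorem derivC_commutator (hD : σ.IsSpinConnection nabla D) (hn : IsLeviCivita g nabla)
    {f : M → ℂ} (hf : SmoothFunNear f x) (hs : SmoothSecNear C2 s x) (ht : SmoothSecNear C2 t x)
    (hs' : SmoothSecNear C2 s' x) (ht' : SmoothSecNear C2 t' x) :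
    σ.derivC s t (σ.derivC s' t' f) x - σ.derivC s' t' (σ.derivC s t f) x =
      σ.complexify (fun v ↦ mvfderiv (𝓡 4) f x v) (σ.nablaC D s t s' x) (t' x)
        + σ.complexify (fun v ↦ mvfderiv (𝓡 4) f x v) (s' x) (σ.nablaC D t s t' x)
        - σ.complexify (fun v ↦ mvfderiv (𝓡 4) f x v) (σ.nablaC D s' t' s x) (t x)
        - σ.complexify (fun v ↦ mvfderiv (𝓡 4) f x v) (s x) (σ.nablaC D t' s' t x) := by
  rw [← hD.complexifyTwo_mlieBracket hn (isLinearMap_mvfderiv f x) hs ht hs' ht',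
    complexifyTwo_congr (fun X Y hX hY ↦ mvfderiv_mlieBracket hX hY hf) hs ht hs' ht']
  have key {s t : ∀ x, S x} (hs : SmoothSecNear C2 s x) (ht : SmoothSecNear C2 t x)
      (v : TangentSpace (𝓡 4) x) : mvfderiv (𝓡 4) (σ.derivC s t f) x v =
        mvfderiv (𝓡 4) (fun y ↦ mvfderiv (𝓡 4) f y (σ.vecField s t y)) x v
        - Complex.I • mvfderiv (𝓡 4) (fun y ↦ mvfderiv (𝓡 4) f y
          (σ.vecField (fun y ↦ Complex.I • s y) t y)) x v := by
    have h₁ := hf.deriv (smoothSecNear_vecField (σ := σ) hs ht)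
    have h₂ := hf.deriv (smoothSecNear_vecField (σ := σ) hs.I_smul ht)
    let m : ℂ →L[ℝ] ℂ := -(Complex.I • ContinuousLinearMap.id ℝ ℂ)
    have h₃ := mvfderiv_add_apply h₁.mdiff (h₂.clm_comp m).mdiff v
    rw [mvfderiv_clm_comp h₂.mdiff] at h₃
    simpa [m, ← sub_eq_add_neg] using! h₃
  rw [derivC_eq, derivC_eq (s := s')]
  simp only [key hs ht, key hs' ht', complexifyTwo]
  simp only [vecField]
  module

end IsSpinConnection
end SpinStructure
end SpinConnection

/-! ### Symmetries of the spinor curvature -/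

section SpinCurvature

open Filter Topology VectorField

variable {M : Type*} [TopologicalSpace M] [ChartedSpace R4 M] [IsManifold (𝓡 4) ∞ M]
  {S : M → Type*} [TopologicalSpace (TotalSpace C2 S)]
  [∀ x, AddCommGroup (S x)] [∀ x, Module ℝ (S x)] [∀ x, Module ℂ (S x)]
  [∀ x, IsScalarTower ℝ ℂ (S x)] [∀ x, TopologicalSpace (S x)]
  [∀ x, IsTopologicalAddGroup (S x)] [∀ x, ContinuousSMul ℝ (S x)]
  [FiberBundle C2 S] [VectorBundle ℝ C2 S]
  {g : LorentzMetric M} {σ : SpinStructure S g} {x : M}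
  {nabla : CovariantDerivative (𝓡 4) R4 (TangentSpace (𝓡 4) : M → Type _)}
  {D : CovariantDerivative (𝓡 4) C2 S}
  {r s t s' t' : ∀ x, S x} {X Y : ∀ x : M, TangentSpace (𝓡 4) x}

/-- A sesquilinear form that vanishes on the diagonal is zero. -/
theorem sesquilinear_eq_zero {W : Type*} [AddCommGroup W] [Module ℂ W] {f : W → W → ℂ}
    (add_left : ∀ a a' b, f (a + a') b = f a b + f a' b)
    (add_right : ∀ a b b', f a (b + b') = f a b + f a b')
    (I_left : ∀ a b, f (Complex.I • a) b = Complex.I * f a b)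
    (I_right : ∀ a b, f a (Complex.I • b) = -Complex.I * f a b)
    (diag : ∀ a, f a a = 0) (a b : W) : f a b = 0 := by
  have h₁ := diag (a + b)
  have h₂ := diag (a + Complex.I • b)
  simp only [add_left, add_right, I_left, I_right, diag] at h₁ h₂
  linear_combination (1 / 2 : ℂ) * h₁ + (Complex.I / 2) * h₂
    + ((f a b - f b a) / 2) * Complex.I_sq

namespace SpinStructure

variable (σ) in
theorem eps_swap (a b : S x) : σ.eps x a b = -σ.eps x b a := by
  have h := σ.eps_self x (a + b)
  simp only [map_add, LinearMap.add_apply, σ.eps_self] at h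
  linear_combination h

theorem isLinearMap_inner_left (z : TangentSpace (𝓡 4) x) :
    IsLinearMap ℝ fun w : TangentSpace (𝓡 4) x ↦ ((g.inner x w z : ℝ) : ℂ) where
  map_add u v := by simp
  map_smul r u := by simp

theorem isLinearMap_inner_right (w : TangentSpace (𝓡 4) x) :
    IsLinearMap ℝ fun z : TangentSpace (𝓡 4) x ↦ ((g.inner x w z : ℝ) : ℂ) where
  map_add u v := by simp
  map_smul r u := by simp

variable (σ) in
theorem isLinearMap_complexify_inner (d d' : S x) : IsLinearMap ℝ fun w ↦
    σ.complexify (fun z ↦ ((g.inner x w z : ℝ) : ℂ)) d d' :=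
  σ.isLinearMap_complexify fun z ↦ isLinearMap_inner_left z

/-- The identity `g_ab = ε_AB ε_A'B'`. -/
theorem complexify_inner (a a' b b' : S x) :
    σ.complexify (fun w ↦ σ.complexify (fun z ↦ ((g.inner x w z : ℝ) : ℂ)) b b') a a' =
      σ.eps x a b * conj (σ.eps x a' b') := by
  have hl := σ.isLinearMap_complexify_inner (x := x)
  have hr (a a' : S x) : IsLinearMap ℝ fun z ↦
      σ.complexify (fun w ↦ ((g.inner x w z : ℝ) : ℂ)) a a' :=
    σ.isLinearMap_complexify fun z ↦ isLinearMap_inner_right z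
  rw [σ.complexify_comm, ← sub_eq_zero]
  -- The axiom `inner_vec` concerns only the real null vectors `a (conj a)` and `b (conj b)`. Two
  -- polarizations, first in `b`, then in `a`, reach all four arguments.
  refine sesquilinear_eq_zero (f := fun b b' ↦ σ.complexify (fun z ↦ σ.complexify
    (fun w ↦ ((g.inner x w z : ℝ) : ℂ)) a a') b b' - σ.eps x a b * conj (σ.eps x a' b'))
    ?_ ?_ ?_ ?_ (fun b ↦ ?_) b b'
  · intro a a' b
    simp only [σ.complexify_add_left (hr _ _), map_add]
    ring
  · intro a a' b
    simp only [σ.complexify_add_right (hr _ _), map_add]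
    ring
  · intro a b
    simp only [σ.complexify_I_smul_left (hr _ _), map_smul, smul_eq_mul]
    ring
  · intro a b
    simp only [σ.complexify_I_smul_right (hr _ _), map_smul, smul_eq_mul,
      map_mul, Complex.conj_I]
    ring
  rw [σ.complexify_comm]
  refine sesquilinear_eq_zero (f := fun a a' ↦ σ.complexify (fun w ↦ σ.complexify
    (fun z ↦ ((g.inner x w z : ℝ) : ℂ)) b b) a a' - σ.eps x a b * conj (σ.eps x a' b))
    ?_ ?_ ?_ ?_ (fun a ↦ ?_) a a'
  · intro a a' b
    simp only [σ.complexify_add_left (hl _ _), map_add, LinearMap.add_apply]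
    ring
  · intro a a' b
    simp only [σ.complexify_add_right (hl _ _), map_add, LinearMap.add_apply]
    ring
  · intro a b
    simp only [σ.complexify_I_smul_left (hl _ _), map_smul, LinearMap.smul_apply, smul_eq_mul]
    ring
  · intro a b
    simp only [σ.complexify_I_smul_right (hl _ _), map_smul, LinearMap.smul_apply, smul_eq_mul,
      map_mul, Complex.conj_I]
    ring
  · simp only [complexify, vec_I_smul_self, σ.inner_vec, Complex.mul_conj, map_zero,
      Complex.normSq_eq_norm_sq]
    simp

section

variable [VectorBundle ℂ C2 S]

theorem IsSpinConnection.curvatureAt_I_smul [ContMDiffVectorBundle ∞ C2 S (𝓡 4)]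
    (hD : σ.IsSpinConnection nabla D) (u v : TangentSpace (𝓡 4) x) (a : S x) :
    curvatureAt D x u v (Complex.I • a) = Complex.I • curvatureAt D x u v a := by
  have hc := hD.isSmoothConnection
  have hX : SmoothSecNear R4 (FiberBundle.extend R4 u) x := .extend u
  have hY : SmoothSecNear R4 (FiberBundle.extend R4 v) x := .extend v
  have ha : SmoothSecNear C2 (FiberBundle.extend C2 a) x := .extend a
  have h := curvature_eq hc hX hY ha.I_smul
  simp only [FiberBundle.extend_apply_self] at h
  rw [← h]
  have key {X Y : ∀ x : M, TangentSpace (𝓡 4) x} (hY : SmoothSecNear R4 Y x) :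
      D (fun y ↦ D (fun z ↦ Complex.I • FiberBundle.extend C2 a z) y (Y y)) x (X x) =
        Complex.I • D (fun y ↦ D (FiberBundle.extend C2 a) y (Y y)) x (X x) := by
    have e : ∀ᶠ y in 𝓝 x, D (fun z ↦ Complex.I • FiberBundle.extend C2 a z) y (Y y) =
        Complex.I • D (FiberBundle.extend C2 a) y (Y y) := by
      filter_upwards [ha.eventually] with y hy using hD.complex_linear _ _ hy.mdiff _
    rw [D.congr (hc.near ha hY).I_smul e, hD.complex_linear _ _ (hc.near ha hY).mdiff]
  simp only [curvatureAt, curvature, key hX, key hY, hD.complex_linear _ _ ha.mdiff, smul_sub]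

/-- As `ε` is parallel, differentiating `ε(a,b)` twice and antisymmetrizing removes the mixed
first-order terms. The curvature thus takes values in the trace-free endomorphisms, and its
components are symmetric in the last two slots. -/
theorem IsSpinConnection.eps_curvatureAt [ContMDiffVectorBundle ∞ C2 S (𝓡 4)]
    (hD : σ.IsSpinConnection nabla D) (u v : TangentSpace (𝓡 4) x) (a b : S x) :
    σ.eps x (curvatureAt D x u v a) b + σ.eps x a (curvatureAt D x u v b) = 0 := by
  have hc := hD.isSmoothConnection
  have hX : SmoothSecNear R4 (FiberBundle.extend R4 u) x := .extend u
  have hY : SmoothSecNear R4 (FiberBundle.extend R4 v) x := .extend v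
  have ha : SmoothSecNear C2 (FiberBundle.extend C2 a) x := .extend a
  have hb : SmoothSecNear C2 (FiberBundle.extend C2 b) x := .extend b
  have key {X Y : ∀ x : M, TangentSpace (𝓡 4) x} (hY : SmoothSecNear R4 Y x) :
      mvfderiv (𝓡 4) (fun y ↦ mvfderiv (𝓡 4) (fun z ↦ σ.eps z (FiberBundle.extend C2 a z)
        (FiberBundle.extend C2 b z)) y (Y y)) x (X x) =
        σ.eps x (D (fun y ↦ D (FiberBundle.extend C2 a) y (Y y)) x (X x)) b
        + σ.eps x (D (FiberBundle.extend C2 a) x (Y x)) (D (FiberBundle.extend C2 b) x (X x))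
        + (σ.eps x (D (FiberBundle.extend C2 a) x (X x)) (D (FiberBundle.extend C2 b) x (Y x))
        + σ.eps x a (D (fun y ↦ D (FiberBundle.extend C2 b) y (Y y)) x (X x))) := by
    have e : (fun y ↦ mvfderiv (𝓡 4) (fun z ↦ σ.eps z (FiberBundle.extend C2 a z)
        (FiberBundle.extend C2 b z)) y (Y y)) =ᶠ[𝓝 x]
        fun y ↦ σ.eps y (D (FiberBundle.extend C2 a) y (Y y)) (FiberBundle.extend C2 b y)
          + σ.eps y (FiberBundle.extend C2 a y) (D (FiberBundle.extend C2 b) y (Y y)) := by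
      filter_upwards [ha.eventually, hb.eventually] with y h₁ h₂
      exact hD.eps_parallel _ _ _ h₁.mdiff h₂.mdiff _
    have h₁ := hc.near ha hY
    have h₂ := hc.near hb hY
    rw [mvfderiv_congr e, mvfderiv_add_apply (smoothFunNear_eps h₁ hb).mdiff
      (smoothFunNear_eps ha h₂).mdiff, hD.eps_parallel _ _ _ h₁.mdiff hb.mdiff,
      hD.eps_parallel _ _ _ ha.mdiff h₂.mdiff, FiberBundle.extend_apply_self,
      FiberBundle.extend_apply_self]
  have h := mvfderiv_mlieBracket hX hY (smoothFunNear_eps (σ := σ) ha hb)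
  rw [key hX, key hY, hD.eps_parallel _ _ _ ha.mdiff hb.mdiff, FiberBundle.extend_apply_self,
    FiberBundle.extend_apply_self] at h
  simp only [curvatureAt, curvature, map_sub, LinearMap.sub_apply]
  linear_combination -h

/-- Since `vec` is parallel, curvature acts on it as a derivation; this ties the Riemann tensor to
the curvature of the spin connection. -/
theorem IsSpinConnection.riemann_vec [ContMDiffVectorBundle ∞ C2 S (𝓡 4)]
    (hD : σ.IsSpinConnection nabla D) (hn : IsLeviCivita g nabla)
    (u v : TangentSpace (𝓡 4) x) (a b : S x) :
    riemann nabla x u v (σ.vec x a b) =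
      σ.vec x (curvatureAt D x u v a) b + σ.vec x a (curvatureAt D x u v b) := by
  have hc := hD.isSmoothConnection
  have hX : SmoothSecNear R4 (FiberBundle.extend R4 u) x := .extend u
  have hY : SmoothSecNear R4 (FiberBundle.extend R4 v) x := .extend v
  have ha : SmoothSecNear C2 (FiberBundle.extend C2 a) x := .extend a
  have hb : SmoothSecNear C2 (FiberBundle.extend C2 b) x := .extend b
  have hp {s t : ∀ x, S x} {y : M} (hs : SmoothSecNear C2 s y) (ht : SmoothSecNear C2 t y)
      (v : TangentSpace (𝓡 4) y) : nabla (σ.vecField s t) y v =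
        σ.vec y (D s y v) (t y) + σ.vec y (s y) (D t y v) :=
    hD.vec_parallel _ _ _ hs.mdiff ht.mdiff _
  have key {X Y : ∀ x : M, TangentSpace (𝓡 4) x} (hY : SmoothSecNear R4 Y x) :
      nabla (fun y ↦ nabla (σ.vecField (FiberBundle.extend C2 a)
        (FiberBundle.extend C2 b)) y (Y y)) x (X x) =
        σ.vec x (D (fun y ↦ D (FiberBundle.extend C2 a) y (Y y)) x (X x)) b
        + σ.vec x (D (FiberBundle.extend C2 a) x (Y x)) (D (FiberBundle.extend C2 b) x (X x))
        + (σ.vec x (D (FiberBundle.extend C2 a) x (X x)) (D (FiberBundle.extend C2 b) x (Y x))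
        + σ.vec x a (D (fun y ↦ D (FiberBundle.extend C2 b) y (Y y)) x (X x))) := by
    have h₁ := hc.near ha hY
    have h₂ := hc.near hb hY
    have e : ∀ᶠ y in 𝓝 x, nabla (σ.vecField (FiberBundle.extend C2 a)
        (FiberBundle.extend C2 b)) y (Y y) =
        (σ.vecField (fun y ↦ D (FiberBundle.extend C2 a) y (Y y)) (FiberBundle.extend C2 b)
          + σ.vecField (FiberBundle.extend C2 a) fun y ↦ D (FiberBundle.extend C2 b) y (Y y)) y := by
      filter_upwards [ha.eventually, hb.eventually] with y h₁ h₂ using hp h₁ h₂ _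
    have h₃ := smoothSecNear_vecField (σ := σ) h₁ hb
    have h₄ := smoothSecNear_vecField (σ := σ) ha h₂
    rw [nabla.congr (h₃.add h₄) e, nabla.add_apply h₃ h₄, hp h₁ hb, hp ha h₂,
      FiberBundle.extend_apply_self, FiberBundle.extend_apply_self]
  have h := curvature_eq hn.isSmoothConnection hX hY (smoothSecNear_vecField (σ := σ) ha hb)
  have e : σ.vecField (FiberBundle.extend C2 a) (FiberBundle.extend C2 b) x = σ.vec x a b := by
    simp [vecField]
  rw [e, FiberBundle.extend_apply_self, FiberBundle.extend_apply_self] at h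
  rw [riemann_eq, ← h]
  simp only [curvature, key hX, key hY, hp ha hb]
  simp only [curvatureAt, curvature, map_sub, LinearMap.sub_apply, FiberBundle.extend_apply_self]
  abel

end
end SpinStructure
end SpinCurvature

/-! ### Algebraic reduction of the curvature to Weyl spinor and scalar -/

section CurvatureAlgebra

/-- The components of the totally symmetric part of the curvature spinor, in terms of the
components `f i j k l m q` of the curvature of the spinor connection. -/
def weylComponents (f : Fin 2 → Fin 2 → Fin 2 → Fin 2 → Fin 2 → Fin 2 → ℂ) : ℕ → ℂ
  | 0 => f 0 0 0 1 0 0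
  | 1 => f 0 0 0 1 0 1
  | 2 => (f 0 0 0 1 1 1 + 2 * f 0 0 1 1 0 1) / 3
  | 3 => f 0 0 1 1 1 1
  | _ => f 1 0 1 1 1 1

/-- The components of the Riemann tensor in the null tetrad of a spin dyad, in terms of the
components `f i j k l m q` of the curvature of the spinor connection. -/
def riemannComponent (f : Fin 2 → Fin 2 → Fin 2 → Fin 2 → Fin 2 → Fin 2 → ℂ)
    (i j k l m n p q : Fin 2) : ℂ :=
  f i j k l m p * levi n q + levi m p * conj (f j i l k n q)

/-- The first Bianchi identity and the Einstein equations determine the curvature of the spinor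
connection in terms of the Weyl spinor and the cosmological constant. -/
theorem spinCurvature_component_eq
    {f : Fin 2 → Fin 2 → Fin 2 → Fin 2 → Fin 2 → Fin 2 → ℂ} {c : ℝ}
    (hswap : ∀ i j k l m q, f i j k l m q = -f k l i j m q)
    (hsymm : ∀ i j k l m q, f i j k l m q = f i j k l q m)
    (hB : ∀ i j k l m n p q, riemannComponent f i j k l m n p q
      + riemannComponent f k l m n i j p q + riemannComponent f m n i j k l p q = 0)
    (hE : ∀ i j m n, riemannComponent f i j 0 0 m n 1 1 + riemannComponent f i j 1 1 m n 0 0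
      - riemannComponent f i j 0 1 m n 1 0 - riemannComponent f i j 1 0 m n 0 1
      = c * levi i m * levi j n)
    (i j k l m q : Fin 2) :
    f i j k l m q = levi j l * curvatureComponent (weylComponents f) (c / 6) i k m q := by
  -- The symmetries are used as rewrite rules to a normal form, with ordered planes and with the
  -- last pair ordered, so that the identities below become linear relations between few unknowns
  -- and their conjugates.
  have h0 (i j m q) : f i j i j m q = 0 := self_eq_neg.mp (hswap i j i j m q)
  have h1 (i j k l) : f i j k l 1 0 = f i j k l 0 1 := hsymm i j k l 1 0
  have s1 (m q) := hswap 0 1 0 0 m q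
  have s2 (m q) := hswap 1 0 0 0 m q
  have s3 (m q) := hswap 1 1 0 0 m q
  have s4 (m q) := hswap 1 0 0 1 m q
  have s5 (m q) := hswap 1 1 0 1 m q
  have s6 (m q) := hswap 1 1 1 0 m q
  have b1 := hB 0 0 0 1 1 0 0 0
  have b2 := hB 0 0 0 1 1 1 0 1
  have b3 := hB 0 0 0 1 1 1 0 0
  have b4 := hB 0 0 1 0 1 1 0 0
  have b5 := hB 0 0 0 1 1 1 1 1
  have b6 := hB 0 0 1 0 1 1 0 1
  have b7 := hB 0 1 1 0 1 1 0 0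
  have b8 := hB 0 0 1 0 1 1 1 0
  have b9 := hB 0 1 1 0 1 1 1 1
  have b10 := hB 0 1 1 0 1 1 1 0
  have b11 := hB 0 0 0 1 1 1 1 0
  have b12 := hB 0 0 1 0 1 1 1 1
  simp only [riemannComponent, levi_zero_zero, levi_zero_one, levi_one_zero, levi_one_one, h0, h1,
    s1, s2, s3, s4, s5, s6, map_neg, map_zero, mul_zero, zero_mul, mul_one, one_mul, mul_neg,
    neg_mul, neg_neg, neg_zero, add_zero, zero_add] at b1 b2 b3 b4 b5 b6 b7 b8 b9 b10 b11 b12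
  have e0000 := hE 0 0 0 0
  have e0101 := hE 0 1 0 1
  have e0100 := hE 0 1 0 0
  have e0010 := hE 0 0 1 0
  have e1101 := hE 1 1 0 1
  have e0110 := hE 0 1 1 0
  have e0011 := hE 0 0 1 1
  have e1010 := hE 1 0 1 0
  have e1111 := hE 1 1 1 1
  have e1110 := hE 1 1 1 0
  have e0001 := hE 0 0 0 1
  have e1001 := hE 1 0 0 1
  have e1100 := hE 1 1 0 0
  clear hE hB hswap hsymm
  simp only [riemannComponent, levi_zero_zero, levi_zero_one, levi_one_zero, levi_one_one, h0, h1,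
    s1, s2, s3, s4, s5, s6, map_neg, map_zero, mul_zero, zero_mul, mul_one, one_mul, mul_neg,
    neg_mul, neg_neg, neg_zero, add_zero, zero_add]
    at e0000 e0101 e0100 e0010 e1101 e0110 e0011 e1010 e1111 e1110 e0001 e1001 e1100
  -- The relations `p1` to `p9` say that the part of the curvature symmetric in the primed indices
  -- vanishes. This is the part carrying the trace-free Ricci tensor, and the Einstein equations
  -- enter each of them.
  have p1 : f 0 0 1 0 0 0 = 0 := by linear_combination (-1 / 2 : ℂ) * e0000 + (1 / 2 : ℂ) * b1
  have p2 : f 0 1 1 1 0 0 = 0 := by linear_combination (-1 / 2 : ℂ) * e0101 + (1 / 2 : ℂ) * b2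
  have p3 : f 0 1 1 0 0 0 = -f 0 0 1 1 0 0 := by linear_combination b3 - e0100
  have p4 : f 0 0 1 0 0 1 = 0 := by linear_combination (-1 / 2 : ℂ) * e0010 - (1 / 2 : ℂ) * b4
  have p5 : f 0 1 1 1 0 1 = 0 := by linear_combination (-1 / 2 : ℂ) * e1101 + (1 / 2 : ℂ) * b5
  have p6 : f 0 1 1 0 0 1 = -f 0 0 1 1 0 1 := by
    linear_combination (-1 / 2 : ℂ) * (e0110 + e0011 + b6 + b7)
  have p7 : f 0 0 1 0 1 1 = 0 := by linear_combination (-1 / 2 : ℂ) * (e1010 + b8)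
  have p8 : f 0 1 1 1 1 1 = 0 := by linear_combination (-1 / 2 : ℂ) * (e1111 + b9)
  have p9 : f 0 1 1 0 1 1 = -f 0 0 1 1 1 1 := by linear_combination -b10 - e1110
  -- The remaining spinor `X_ABCD` is symmetric under exchange of its pairs: `X_0100 = X_0001`, then
  -- `X_1100 = X_0011` and `X_1101 = X_0111`.
  have x1 : f 0 0 1 1 0 0 = f 0 0 0 1 0 1 := by
    linear_combination (1 / 2 : ℂ) * (b3 - e0001)
  have x2 : f 1 0 1 1 0 0 = f 0 0 0 1 1 1 := by
    linear_combination (-1 / 2 : ℂ) * (e1001 - e0110 - b6 - b11)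
  have x3 : f 1 0 1 1 0 1 = f 0 0 1 1 1 1 := by
    linear_combination (1 / 2 : ℂ) * (b12 + e1110)
  -- With `Λ = c / 6` the components are `X_0011 = Ψ_2 + 2Λ` and `X_0101 = Ψ_2 - Λ`; their
  -- difference `3Λ` is `c / 2`. It also explains the weights 1 and 2 in `weylComponents` at 2.
  have x4 : f 0 0 0 1 1 1 = f 0 0 1 1 0 1 + c / 2 := by
    linear_combination (1 / 2 : ℂ) * b6 + (-1 / 4 : ℂ) * e1100 + (1 / 4 : ℂ) * e1001
      - (1 / 4 : ℂ) * e0110 + (3 / 4 : ℂ) * e0011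
  fin_cases i <;> fin_cases j <;> fin_cases k <;> fin_cases l <;>
    simp only [Fin.zero_eta, Fin.mk_one, h0, s1, s2, s3, s4, s5, s6, levi_zero_zero,
      levi_zero_one, levi_one_zero, levi_one_one, zero_mul, one_mul, neg_mul, neg_inj] <;>
    fin_cases m <;> fin_cases q <;>
    simp only [Fin.zero_eta, Fin.mk_one, h1, p1, p2, p3, p4, p5, p6, p7, p8, p9, x1, x2, x3, x4,
      neg_zero, curvatureComponent, weylIndex, Fin.val_zero, Fin.val_one, Nat.reduceAdd,
      weylComponents, levi_zero_zero, levi_zero_one, levi_one_zero, levi_one_one] <;>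
    ring

end CurvatureAlgebra

/-! ### The Riemann tensor in spinor form -/

section RiemannSpinor

variable {M : Type*} [TopologicalSpace M] [ChartedSpace R4 M] [IsManifold (𝓡 4) ∞ M]
  {S : M → Type*} [TopologicalSpace (TotalSpace C2 S)]
  [∀ x, AddCommGroup (S x)] [∀ x, Module ℝ (S x)] [∀ x, Module ℂ (S x)]
  [∀ x, IsScalarTower ℝ ℂ (S x)] [∀ x, TopologicalSpace (S x)]
  [∀ x, IsTopologicalAddGroup (S x)] [∀ x, ContinuousSMul ℝ (S x)]
  [FiberBundle C2 S] [VectorBundle ℝ C2 S] [ContMDiffVectorBundle ∞ C2 S (𝓡 4)]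
  {g : LorentzMetric M} {σ : SpinStructure S g} {x : M}
  {nabla : CovariantDerivative (𝓡 4) R4 (TangentSpace (𝓡 4) : M → Type _)}
  {D : CovariantDerivative (𝓡 4) C2 S} {a a' b b' c c' d d' o ι : S x}

namespace SpinStructure

/-- The curvature of the spinor connection along two complex vectors `a (conj a')`,
`b (conj b')`. -/
def curvatureC (σ : SpinStructure S g) (D : CovariantDerivative (𝓡 4) C2 S)
    (a a' b b' c : S x) : S x :=
  σ.complexify (fun u ↦ σ.complexify (fun v ↦ curvatureAt D x u v c) b b') a a'

theorem curvatureC_swap : σ.curvatureC D a a' b b' c = -σ.curvatureC D b b' a a' c := by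
  simp only [curvatureC, complexify, curvatureAt_swap (σ.vec x a a'),
    curvatureAt_swap (σ.vec x (Complex.I • a) a')]
  module

variable [VectorBundle ℂ C2 S]

theorem IsSpinConnection.curvatureAt_smul (hD : σ.IsSpinConnection nabla D)
    (u v : TangentSpace (𝓡 4) x) (z : ℂ) (a : S x) :
    curvatureAt D x u v (z • a) = z • curvatureAt D x u v a := by
  have hc := hD.isSmoothConnection
  rw [complex_smul_eq, curvatureAt_add hc, _root_.curvatureAt_smul hc, _root_.curvatureAt_smul hc,
    hD.curvatureAt_I_smul, ← complex_smul_eq]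

/-- The components of the curvature of the spinor connection as a multilinear form. -/
theorem complexify_eps_curvatureAt (c d a a' b b' : S x) :
    σ.complexify (fun u ↦ σ.complexify (fun v ↦ σ.eps x (curvatureAt D x u v c) d) b b') a a' =
      σ.eps x (σ.curvatureC D a a' b b' c) d := by
  simp only [curvatureC, complexify, map_sub, map_smul, LinearMap.sub_apply, LinearMap.smul_apply]

theorem IsSpinConnection.eps_curvatureC_symm (hD : σ.IsSpinConnection nabla D) :
    σ.eps x (σ.curvatureC D a a' b b' c) d = σ.eps x (σ.curvatureC D a a' b b' d) c := by
  have h (u v : TangentSpace (𝓡 4) x) :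
      σ.eps x (curvatureAt D x u v c) d = σ.eps x (curvatureAt D x u v d) c := by
    have h := hD.eps_curvatureAt u v c d
    rw [σ.eps_swap c] at h
    linear_combination h
  simp only [← complexify_eps_curvatureAt, h]

theorem IsSpinConnection.isLinearMap_curvatureAt_left (hD : σ.IsSpinConnection nabla D)
    (v : TangentSpace (𝓡 4) x) (c d : S x) :
    IsLinearMap ℝ fun u ↦ σ.eps x (curvatureAt D x u v c) d where
  map_add u u' := by
    simp [(curvatureAt_isLinearMap_left hD.isSmoothConnection v c).map_add]
  map_smul r u := by
    have h := (curvatureAt_isLinearMap_left hD.isSmoothConnection v c).map_smul r u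
    simp only [h, ← algebraMap_smul ℂ r (curvatureAt D x u v c), map_smul, LinearMap.smul_apply]
    simp

theorem IsSpinConnection.isLinearMap_curvatureAt_right (hD : σ.IsSpinConnection nabla D)
    (u : TangentSpace (𝓡 4) x) (c d : S x) :
    IsLinearMap ℝ fun v ↦ σ.eps x (curvatureAt D x u v c) d where
  map_add v v' := by
    simp [(curvatureAt_isLinearMap_right hD.isSmoothConnection u c).map_add]
  map_smul r v := by
    have h := (curvatureAt_isLinearMap_right hD.isSmoothConnection u c).map_smul r v
    simp only [h, ← algebraMap_smul ℂ r (curvatureAt D x u v c), map_smul, LinearMap.smul_apply]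
    simp

/-- The Riemann tensor in terms of the curvature of the spinor connection. -/
theorem IsSpinConnection.riemannSpinor_eq (hD : σ.IsSpinConnection nabla D)
    (hn : IsLeviCivita g nabla) : σ.riemannSpinor nabla a a' b b' c c' d d' =
      σ.eps x (σ.curvatureC D a a' b b' c) d * conj (σ.eps x c' d')
      + σ.eps x c d * conj (σ.eps x (σ.curvatureC D a' a b' b c') d') := by
  have key (u v : TangentSpace (𝓡 4) x) : σ.complexify (fun w ↦ σ.complexify
      (fun z ↦ ((g.inner x (riemann nabla x u v w) z : ℝ) : ℂ)) d d') c c' =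
      σ.eps x (curvatureAt D x u v c) d * conj (σ.eps x c' d')
      + σ.eps x c d * conj (σ.eps x (curvatureAt D x u v c') d') := by
    have gen (L : TangentSpace (𝓡 4) x → ℂ) (hL : IsLinearMap ℝ L) :
        σ.complexify (fun w ↦ L (riemann nabla x u v w)) c c' =
          σ.complexify L (curvatureAt D x u v c) c'
          + σ.complexify L c (curvatureAt D x u v c') := by
      simp only [complexify, hD.riemann_vec hn, hD.curvatureAt_I_smul, hL.map_add]
      module
    rw [gen _ (σ.isLinearMap_complexify_inner d d'), complexify_inner, complexify_inner]
  simp only [riemannSpinor, cext_eq, key]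
  -- Pulling the conjugation out of `complexify` exchanges the two spinors of each vector; hence the
  -- order `a' a b' b` in the second term.
  have h₁ (u : TangentSpace (𝓡 4) x) : σ.complexify (fun v ↦
      σ.eps x (curvatureAt D x u v c) d * conj (σ.eps x c' d')
      + σ.eps x c d * conj (σ.eps x (curvatureAt D x u v c') d')) b b' =
      σ.complexify (fun v ↦ σ.eps x (curvatureAt D x u v c) d) b b' * conj (σ.eps x c' d')
      + σ.eps x c d * conj (σ.complexify (fun v ↦ σ.eps x (curvatureAt D x u v c') d') b' b) := by
    rw [complexify_add, ← σ.complexify_conj (hD.isLinearMap_curvatureAt_right u c' d')]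
    simp only [complexify, smul_eq_mul]
    ring
  simp only [h₁]
  rw [complexify_add, ← complexify_eps_curvatureAt, ← complexify_eps_curvatureAt,
    ← σ.complexify_conj (σ.isLinearMap_complexify
      fun v ↦ hD.isLinearMap_curvatureAt_left v c' d')]
  simp only [complexify, smul_eq_mul]
  ring

/-- Contraction over `C'D'` gives 2 on the factor `ε_C'D'` and kills the conjugate curvature term,
which is symmetric in `C'D'`; so 1/4 becomes 1/2. -/
theorem IsSpinConnection.curvatureSpinor_eq (hD : σ.IsSpinConnection nabla D)
    (hn : IsLeviCivita g nabla) (h : σ.IsDyad o ι) : σ.curvatureSpinor nabla o ι a b c d =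
      (σ.eps x (σ.curvatureC D a o b ι c) d - σ.eps x (σ.curvatureC D a ι b o c) d) / 2 := by
  have h' : σ.eps x ι o = -1 := by rw [σ.eps_swap, h]
  have h : σ.eps x o ι = 1 := h
  simp only [curvatureSpinor, epsContract, hD.riemannSpinor_eq hn, σ.eps_self, h, h', map_one,
    map_neg, map_zero, hD.eps_curvatureC_symm (c := ι) (d := o)]
  ring

theorem riemannSpinor_bianchi (hn : IsLeviCivita g nabla) :
    σ.riemannSpinor nabla a a' b b' c c' d d' + σ.riemannSpinor nabla b b' c c' a a' d d'
      + σ.riemannSpinor nabla c c' a a' b b' d d' = 0 := by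
  have h (u v w z : TangentSpace (𝓡 4) x) : ((g.inner x (riemann nabla x w u v) z : ℝ) : ℂ) =
      -((g.inner x (riemann nabla x u v w) z : ℝ) : ℂ)
        - ((g.inner x (riemann nabla x v w u) z : ℝ) : ℂ) := by
    have := congrArg (fun w ↦ ((g.inner x w z : ℝ) : ℂ)) (hn.bianchi u v w)
    simp only [map_add, add_apply, Complex.ofReal_add, map_zero,
      zero_apply, Complex.ofReal_zero] at this
    linear_combination this
  have e : σ.riemannSpinor nabla c c' a a' b b' d d' =
      -σ.riemannSpinor nabla a a' b b' c c' d d' - σ.riemannSpinor nabla b b' c c' a a' d d' := by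
    rw [riemannSpinor]
    simp only [cext_eq, h _ _ (σ.vec x c c'), h _ _ (σ.vec x (Complex.I • c) c'), complexify,
      riemannSpinor, smul_eq_mul]
    ring
  rw [e]
  ring

end SpinStructure
end RiemannSpinor

/-! ### Ricci trace and Einstein equations in a null tetrad -/

section Ricci

variable {M : Type*} [TopologicalSpace M] [ChartedSpace R4 M] [IsManifold (𝓡 4) ∞ M]
  {S : M → Type*} [TopologicalSpace (TotalSpace C2 S)]
  [∀ x, AddCommGroup (S x)] [∀ x, Module ℝ (S x)] [∀ x, Module ℂ (S x)]
  [∀ x, IsScalarTower ℝ ℂ (S x)] [∀ x, TopologicalSpace (S x)]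
  [∀ x, IsTopologicalAddGroup (S x)] [∀ x, ContinuousSMul ℝ (S x)]
  [FiberBundle C2 S] [VectorBundle ℝ C2 S]
  {g : LorentzMetric M} {σ : SpinStructure S g} {x : M}
  {nabla : CovariantDerivative (𝓡 4) R4 (TangentSpace (𝓡 4) : M → Type _)}
  {D : CovariantDerivative (𝓡 4) C2 S} {a a' b b' c c' d d' o ι : S x}

/-- The trace of an endomorphism, computed in two dual bases. -/
theorem trace_eq_sum_of_dual {E : Type*} [AddCommGroup E] [Module ℝ E] {n : ℕ}
    (hE : Module.finrank ℝ E = n + 1) (v : Fin (n + 1) → E) (l : Fin (n + 1) → E →ₗ[ℝ] ℝ)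
    (h : ∀ i j, l i (v j) = if i = j then 1 else 0) (T : E →ₗ[ℝ] E) :
    LinearMap.trace ℝ E T = ∑ i, l i (T (v i)) := by
  have hv : LinearIndependent ℝ v := by
    rw [Fintype.linearIndependent_iff]
    intro c hc i
    simpa [map_sum, h] using congrArg (l i) hc
  let b := basisOfLinearIndependentOfCardEqFinrank hv (by simp [hE])
  have hb (i) : b i = v i := by simp [b]
  rw [LinearMap.trace_eq_matrix_trace ℝ b, Matrix.trace]
  refine Finset.sum_congr rfl fun i _ ↦ ?_
  rw [Matrix.diag_apply, LinearMap.toMatrix_apply, hb]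
  conv_rhs => rw [← b.sum_repr (T (v i))]
  simp [map_sum, hb, h]

namespace SpinStructure

theorem inner_vec_vec (a b c d : S x) : 4 * ((g.inner x (σ.vec x a b) (σ.vec x c d) : ℝ) : ℂ) =
    σ.eps x a c * conj (σ.eps x b d) + σ.eps x a d * conj (σ.eps x b c)
    + σ.eps x b c * conj (σ.eps x a d) + σ.eps x b d * conj (σ.eps x a c) := by
  have h₁ (w : TangentSpace (𝓡 4) x) := σ.apply_vec (isLinearMap_inner_right (g := g) w) c d
  have h₂ (c d : S x) := σ.apply_vec (σ.isLinearMap_complexify_inner c d) a b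
  simp only [complexify_inner, smul_eq_mul] at h₁ h₂
  linear_combination 2 * h₁ (σ.vec x a b) + h₂ c d + h₂ d c

/-- The trace of an endomorphism, computed in a null tetrad. -/
theorem trace_eq_complexify (h : σ.IsDyad o ι)
    (T : TangentSpace (𝓡 4) x →ₗ[ℝ] TangentSpace (𝓡 4) x)
    (B : S x → S x → S x → S x → ℂ) (hB : ∀ a a' b b', B a a' b b' =
      σ.complexify (fun u ↦ σ.complexify (fun z ↦ ((g.inner x (T u) z : ℝ) : ℂ)) b b') a a') :
    ((LinearMap.trace ℝ _ T : ℝ) : ℂ) = B o o ι ι + B ι ι o o - B o ι ι o - B ι o o ι := by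
  have h' : σ.eps x ι o = -1 := by rw [σ.eps_swap, h]
  have h : σ.eps x o ι = 1 := h
  let v : Fin 4 → TangentSpace (𝓡 4) x :=
    ![σ.vec x o o, σ.vec x ι ι, σ.vec x o ι, σ.vec x (Complex.I • o) ι]
  -- The metric dual of the basis `v`: the two null vectors pair to 1, while `vec o ι` and `vec (i
  -- o) ι` have square -1/2, which explains the factors -2.
  let w : Fin 4 → TangentSpace (𝓡 4) x :=
    ![σ.vec x ι ι, σ.vec x o o, (-2 : ℝ) • σ.vec x o ι, (-2 : ℝ) • σ.vec x (Complex.I • o) ι]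
  let l (i : Fin 4) : TangentSpace (𝓡 4) x →ₗ[ℝ] ℝ := (g.inner x (w i)).toLinearMap
  have hl : ∀ i j, l i (v j) = if i = j then 1 else 0 := by
    intro i j
    apply Complex.ofReal_injective
    refine mul_left_cancel₀ (show (4 : ℂ) ≠ 0 by norm_num) ?_
    fin_cases i <;> fin_cases j <;>
      simp [l, v, w, mul_left_comm (4 : ℂ), inner_vec_vec, h, h', σ.eps_self] <;> norm_num
  have hE : Module.finrank ℝ (TangentSpace (𝓡 4) x) = 3 + 1 :=
    finrank_euclideanSpace_fin (𝕜 := ℝ) (n := 4)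
  rw [trace_eq_sum_of_dual hE v l hl T, Fin.sum_univ_four]
  simp only [hB, complexify, vec_I_smul_self, l, v, w]
  simp [g.symm x _ (T _), σ.vec_symm x ι o, σ.vec_symm x (Complex.I • ι), vec_right_I_smul]
  linear_combination (-2 * ((g.inner x (T (σ.vec x (Complex.I • o) ι))
    (σ.vec x (Complex.I • o) ι) : ℝ) : ℂ)) * Complex.I_sq

variable [ContMDiffVectorBundle ∞ C2 S (𝓡 4)] [VectorBundle ℂ C2 S]

/-- The Einstein equations in a null tetrad. -/
theorem riemannSpinor_einstein (hn : IsLeviCivita g nabla) {k : ℝ}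
    (hk : ∀ v w : TangentSpace (𝓡 4) x, ricci nabla x v w = k * g.inner x v w)
    (h : σ.IsDyad o ι) (a a' b b' : S x) :
    σ.riemannSpinor nabla a a' o o b b' ι ι + σ.riemannSpinor nabla a a' ι ι b b' o o
      - σ.riemannSpinor nabla a a' o ι b b' ι o - σ.riemannSpinor nabla a a' ι o b b' o ι =
      k * (σ.eps x a b * conj (σ.eps x a' b')) := by
  -- The traced slots are complexified first, with `v` and `w` still real. The Einstein equation
  -- then holds between real bilinear forms in `v`, `w`, and complexifying both sides gives the
  -- claim.
  let Q (p p' r r' : S x) (v w : TangentSpace (𝓡 4) x) : ℂ :=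
    σ.complexify (fun u ↦ σ.complexify (fun z ↦
      ((g.inner x (riemann nabla x v u w) z : ℝ) : ℂ)) r r') p p'
  have htr (v w : TangentSpace (𝓡 4) x) : ((k * g.inner x v w : ℝ) : ℂ) =
      Q o o ι ι v w + Q ι ι o o v w - Q o ι ι o v w - Q ι o o ι v w := by
    let T : TangentSpace (𝓡 4) x →ₗ[ℝ] TangentSpace (𝓡 4) x :=
      (curvatureAt_isLinearMap_right hn.isSmoothConnection v w).mk' _
    have hT (u : TangentSpace (𝓡 4) x) : T u = riemann nabla x v u w := (riemann_eq _ _ _ _).symm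
    rw [← σ.trace_eq_complexify h T (fun p p' r r' ↦ Q p p' r r' v w) (fun p p' r r' ↦ by
      simp only [hT, Q]), ← hk]
    let e : Module.Basis (Fin 4) ℝ (TangentSpace (𝓡 4) x) :=
      (EuclideanSpace.basisFun (Fin 4) ℝ).toBasis
    rw [LinearMap.trace_eq_matrix_trace ℝ e, Matrix.trace]
    simp only [Matrix.diag_apply, LinearMap.toMatrix_apply, ricci, hT]
    rfl
  have hQ (p p' r r' : S x) : σ.riemannSpinor nabla a a' p p' b b' r r' =
      σ.complexify (fun v ↦ σ.complexify (fun w ↦ Q p p' r r' v w) b b') a a' := by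
    simp only [riemannSpinor, cext_eq]
    exact congrArg (fun L ↦ σ.complexify L a a') (funext fun v ↦ σ.complexify_comm _ _ _ _ _)
  have hL := congrArg (fun L : TangentSpace (𝓡 4) x → TangentSpace (𝓡 4) x → ℂ ↦
    σ.complexify (fun v ↦ σ.complexify (fun w ↦ L v w) b b') a a') (funext₂ htr)
  rw [← complexify_inner, hQ, hQ, hQ, hQ]
  clear_value Q
  simp only [complexify, smul_eq_mul, Complex.ofReal_mul] at hL ⊢
  linear_combination -hL

/-- The components of the curvature of the spinor connection in a spin dyad. -/
def spinCurvatureComponent (σ : SpinStructure S g) (D : CovariantDerivative (𝓡 4) C2 S)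
    (e : Fin 2 → S x) (i j k l m q : Fin 2) : ℂ :=
  σ.eps x (σ.curvatureC D (e i) (e j) (e k) (e l) (e m)) (e q)

theorem eps_dyad {e : Fin 2 → S x} (h : σ.IsDyad (e 0) (e 1)) (i j : Fin 2) :
    σ.eps x (e i) (e j) = levi i j := by
  have h : σ.eps x (e 0) (e 1) = 1 := h
  fin_cases i <;> fin_cases j <;> simp [levi, σ.eps_self, h, σ.eps_swap (e 1) (e 0)]

theorem levi_conj (i j : Fin 2) : conj (levi i j : ℂ) = levi i j := by
  fin_cases i <;> fin_cases j <;> simp [levi]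

theorem IsSpinConnection.riemannSpinor_dyad (hD : σ.IsSpinConnection nabla D)
    (hn : IsLeviCivita g nabla) {e : Fin 2 → S x} (h : σ.IsDyad (e 0) (e 1))
    (i j k l m n p q : Fin 2) :
    σ.riemannSpinor nabla (e i) (e j) (e k) (e l) (e m) (e n) (e p) (e q) =
      riemannComponent (σ.spinCurvatureComponent D e) i j k l m n p q := by
  rw [hD.riemannSpinor_eq hn, eps_dyad h, eps_dyad h, levi_conj]
  rfl

theorem IsSpinConnection.spinCurvatureComponent_eq (hD : σ.IsSpinConnection nabla D)
    (hn : IsLeviCivita g nabla) {c : ℝ}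
    (hc : ∀ v w : TangentSpace (𝓡 4) x, ricci nabla x v w = c * g.inner x v w)
    {e : Fin 2 → S x} (h : σ.IsDyad (e 0) (e 1)) (i j k l m q : Fin 2) :
    σ.spinCurvatureComponent D e i j k l m q = levi j l *
      curvatureComponent (weylComponents (σ.spinCurvatureComponent D e)) (c / 6) i k m q := by
  refine spinCurvature_component_eq (fun i j k l m q ↦ ?_) (fun i j k l m q ↦ ?_)
    (fun i j k l m n p q ↦ ?_) (fun i j m n ↦ ?_) i j k l m q
  · rw [spinCurvatureComponent, curvatureC_swap, map_neg]
    rfl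
  · exact hD.eps_curvatureC_symm
  · simp only [← hD.riemannSpinor_dyad hn h]
    exact riemannSpinor_bianchi hn
  · simp only [← hD.riemannSpinor_dyad hn h, riemannSpinor_einstein hn hc h, eps_dyad h,
      levi_conj]
    ring

/-- In the symmetrization of `X_ABCD` the six terms with `Λ` cancel in pairs by antisymmetry of `ε`.
What survives depends only on the number of indices equal to 1. -/
theorem IsSpinConnection.weylSpinor_dyad (hD : σ.IsSpinConnection nabla D)
    (hn : IsLeviCivita g nabla) {c : ℝ}
    (hc : ∀ v w : TangentSpace (𝓡 4) x, ricci nabla x v w = c * g.inner x v w)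
    {e : Fin 2 → S x} (h : σ.IsDyad (e 0) (e 1)) (i j k l : Fin 2) :
    σ.weylSpinor nabla (e 0) (e 1) (e i) (e j) (e k) (e l) =
      weylComponents (σ.spinCurvatureComponent D e) (weylIndex i j k l) := by
  have key (i j k l : Fin 2) : σ.curvatureSpinor nabla (e 0) (e 1) (e i) (e j) (e k) (e l) =
      curvatureComponent (weylComponents (σ.spinCurvatureComponent D e)) (c / 6) i j k l := by
    rw [hD.curvatureSpinor_eq hn h]
    change (σ.spinCurvatureComponent D e i 0 j 1 k l
      - σ.spinCurvatureComponent D e i 1 j 0 k l) / 2 = _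
    rw [hD.spinCurvatureComponent_eq hn hc h, hD.spinCurvatureComponent_eq hn hc h, levi_zero_one,
      levi_one_zero]
    ring
  have h₁ : weylIndex i k j l = weylIndex i j k l := by simp only [weylIndex]; omega
  have h₂ : weylIndex i l j k = weylIndex i j k l := by simp only [weylIndex]; omega
  simp only [weylSpinor, key, curvatureComponent, h₁, h₂]
  have h₃ (i j : Fin 2) : (levi i j : ℂ) = -levi j i := by
    rw [← eps_dyad h, ← eps_dyad h, σ.eps_swap]
  rw [h₃ l j, h₃ k j, h₃ l k]
  ring

end SpinStructure

end Ricci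

/-! ### The ring of smooth functions on the open set -/

section FunctionRing

open Filter Topology

variable {M : Type*} [TopologicalSpace M] [ChartedSpace R4 M]

theorem SmoothFunNear.conj {f : M → ℂ} {x : M} (hf : SmoothFunNear f x) :
    SmoothFunNear (fun y ↦ conj (f y)) x :=
  hf.clm_comp (Complex.conjCLE : ℂ →L[ℝ] ℂ)

theorem SmoothFunNear.inv {f : M → ℂ} {x : M} (hf : SmoothFunNear f x) (h : ∀ᶠ y in 𝓝 x, f y ≠ 0) :
    SmoothFunNear (fun y ↦ (f y)⁻¹) x := by
  filter_upwards [hf, h] with y h₁ h₂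
  exact (contDiffAt_inv (𝕜' := ℂ) ℝ h₂).contMDiffAt.comp y h₁

/-- The functions on `U` that are smooth. -/
def smoothFunctions (U : Set M) : Subalgebra ℂ (U → ℂ) where
  carrier := {f | ∃ F : M → ℂ, (∀ x ∈ U, SmoothFunNear F x) ∧ ∀ x : U, F x = f x}
  mul_mem' := by
    rintro f f' ⟨F, hF, h⟩ ⟨F', hF', h'⟩
    exact ⟨_, fun x hx ↦ (hF x hx).mul (hF' x hx), fun x ↦ by simp [h, h']⟩
  add_mem' := by
    rintro f f' ⟨F, hF, h⟩ ⟨F', hF', h'⟩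
    exact ⟨_, fun x hx ↦ (hF x hx).add (hF' x hx), fun x ↦ by simp [h, h']⟩
  algebraMap_mem' c := ⟨fun _ ↦ c, fun _ _ ↦ smoothFunNear_const c, fun x ↦ by simp⟩

namespace smoothFunctions

variable {U : Set M}

/-- The restriction to `U` of a function that is smooth on `U`. -/
def mk (F : M → ℂ) (hF : ∀ x ∈ U, SmoothFunNear F x) : smoothFunctions U :=
  ⟨fun x ↦ F x, F, hF, fun _ ↦ rfl⟩

/-- A function on the whole manifold that restricts to `f`. -/
def rep (f : smoothFunctions U) : M → ℂ := f.2.choose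

theorem rep_smooth (f : smoothFunctions U) : ∀ x ∈ U, SmoothFunNear (rep f) x :=
  f.2.choose_spec.1

theorem rep_apply (f : smoothFunctions U) (x : U) : rep f x = f.1 x := f.2.choose_spec.2 x

@[simp] theorem mk_apply (F : M → ℂ) (hF : ∀ x ∈ U, SmoothFunNear F x) (x : U) :
    (mk F hF).1 x = F x := rfl

/-- Elements of the ring are functions on `U`, while derivatives are taken of functions on `M`. As
`U` is open, any two extensions agree near each of its points, so the choice made in `rep` has no
effect on derivatives there. -/
theorem rep_eventuallyEq (hU : IsOpen U) (f : smoothFunctions U) {F : M → ℂ}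
    (h : ∀ x : U, f.1 x = F x) (x : U) : rep f =ᶠ[𝓝 x.1] F := by
  filter_upwards [hU.mem_nhds x.2] with y hy
  exact (rep_apply f ⟨y, hy⟩).trans (h ⟨y, hy⟩)

@[ext] theorem ext {f f' : smoothFunctions U} (h : ∀ x : U, f.1 x = f'.1 x) : f = f' :=
  Subtype.ext (funext h)

end smoothFunctions

end FunctionRing

/-! ### Components in a dyad and derivations along null fields -/

section Dyad

open Filter Topology smoothFunctions

variable {M : Type*} [TopologicalSpace M] [ChartedSpace R4 M] [IsManifold (𝓡 4) ∞ M]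
  {S : M → Type*} [TopologicalSpace (TotalSpace C2 S)]
  [∀ x, AddCommGroup (S x)] [∀ x, Module ℝ (S x)] [∀ x, Module ℂ (S x)]
  [∀ x, IsScalarTower ℝ ℂ (S x)] [∀ x, TopologicalSpace (S x)]
  [∀ x, IsTopologicalAddGroup (S x)] [∀ x, ContinuousSMul ℝ (S x)]
  [FiberBundle C2 S] [VectorBundle ℝ C2 S] [VectorBundle ℂ C2 S]
  [ContMDiffVectorBundle ∞ C2 S (𝓡 4)]
  {g : LorentzMetric M} {σ : SpinStructure S g} {x : M}
  {nabla : CovariantDerivative (𝓡 4) R4 (TangentSpace (𝓡 4) : M → Type _)}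
  {D : CovariantDerivative (𝓡 4) C2 S} {r s t : ∀ x, S x} {f f' : M → ℂ}

theorem finrank_spinor (x : M) : Module.finrank ℂ (S x) = 2 := by
  have h := ((trivializationAt C2 S x).linearEquivAt ℂ x
    (FiberBundle.mem_baseSet_trivializationAt C2 S x)).finrank_eq
  rw [h, Module.finrank_fin_fun]

namespace SpinStructure

/-- The component of the spinor `a` along the dyad spinor `e m`. -/
def dyadCoeff (σ : SpinStructure S g) (e : Fin 2 → S x) (a : S x) (m : Fin 2) : ℂ :=
  ∑ q, levi m q * σ.eps x a (e q)

theorem eps_dyadCoeff {e : Fin 2 → S x} (a : S x) (m : Fin 2) :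
    σ.dyadCoeff e a m = if m = 0 then σ.eps x a (e 1) else -σ.eps x a (e 0) := by
  fin_cases m <;> simp [dyadCoeff, levi]

/-- Pairing with `ε` makes the dyad independent, and the fibre has complex dimension two; the same
pairing reads off the coefficients. -/
theorem sum_dyadCoeff {e : Fin 2 → S x} (h : σ.IsDyad (e 0) (e 1)) (a : S x) :
    a = ∑ m, σ.dyadCoeff e a m • e m := by
  have h₀ : σ.eps x (e 0) (e 1) = 1 := h
  have h₁ : σ.eps x (e 1) (e 0) = -1 := by rw [σ.eps_swap, h₀]
  have hi : LinearIndependent ℂ e := by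
    rw [Fintype.linearIndependent_iff]
    intro c hc i
    rw [Fin.sum_univ_two] at hc
    have k₀ := congrArg (fun z ↦ σ.eps x z (e 1)) hc
    have k₁ := congrArg (fun z ↦ σ.eps x z (e 0)) hc
    simp [h₀, h₁, σ.eps_self] at k₀ k₁
    fin_cases i
    exacts [k₀, k₁]
  let b := basisOfLinearIndependentOfCardEqFinrank hi (by simp [finrank_spinor])
  have hb (i) : b i = e i := by simp [b]
  obtain ⟨z₀, z₁, hz⟩ : ∃ z₀ z₁ : ℂ, a = z₀ • e 0 + z₁ • e 1 :=
    ⟨b.repr a 0, b.repr a 1, by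
      conv_lhs => rw [← b.sum_repr a, Fin.sum_univ_two, hb, hb]⟩
  rw [Fin.sum_univ_two, eps_dyadCoeff, eps_dyadCoeff, hz]
  simp [h₀, h₁, σ.eps_self]

theorem dyadCoeff_dyad {e : Fin 2 → S x} (h : σ.IsDyad (e 0) (e 1)) (k m : Fin 2) :
    σ.dyadCoeff e (e k) m = if k = m then 1 else 0 := by
  rw [eps_dyadCoeff, eps_dyad h, eps_dyad h]
  fin_cases k <;> fin_cases m <;> simp [levi]

theorem dyadCoeff_add {e : Fin 2 → S x} (a b : S x) (m : Fin 2) :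
    σ.dyadCoeff e (a + b) m = σ.dyadCoeff e a m + σ.dyadCoeff e b m := by
  simp only [eps_dyadCoeff, map_add, LinearMap.add_apply]; split_ifs <;> ring

theorem dyadCoeff_sub {e : Fin 2 → S x} (a b : S x) (m : Fin 2) :
    σ.dyadCoeff e (a - b) m = σ.dyadCoeff e a m - σ.dyadCoeff e b m := by
  simp only [eps_dyadCoeff, map_sub, LinearMap.sub_apply]; split_ifs <;> ring

theorem dyadCoeff_smul {e : Fin 2 → S x} (z : ℂ) (a : S x) (m : Fin 2) :
    σ.dyadCoeff e (z • a) m = z * σ.dyadCoeff e a m := by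
  simp only [eps_dyadCoeff, map_smul, LinearMap.smul_apply, smul_eq_mul]; split_ifs <;> ring

theorem smoothFunNear_dyadCoeff {e : Fin 2 → ∀ x, S x} (he : ∀ k, SmoothSecNear C2 (e k) x)
    (hs : SmoothSecNear C2 s x) (m : Fin 2) :
    SmoothFunNear (fun y ↦ σ.dyadCoeff (fun k ↦ e k y) (s y) m) x := by
  simp only [dyadCoeff, Fin.sum_univ_two]
  exact ((smoothFunNear_const _).mul (smoothFunNear_eps hs (he 0))).add
    ((smoothFunNear_const _).mul (smoothFunNear_eps hs (he 1)))

theorem smoothFunNear_derivC (hf : SmoothFunNear f x) (hs : SmoothSecNear C2 s x)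
    (ht : SmoothSecNear C2 t x) : SmoothFunNear (σ.derivC s t f) x := by
  have h₁ := hf.deriv (smoothSecNear_vecField (σ := σ) hs ht)
  have h₂ := hf.deriv (smoothSecNear_vecField (σ := σ) hs.I_smul ht)
  exact (h₁.add ((smoothFunNear_const (-Complex.I)).mul h₂)).congr
    (.of_forall fun y ↦ by simp only [derivC_eq, smul_eq_mul, vecField]; ring)

theorem derivC_add (hf : SmoothFunNear f x) (hf' : SmoothFunNear f' x) :
    σ.derivC s t (fun y ↦ f y + f' y) x = σ.derivC s t f x + σ.derivC s t f' x := by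
  simp only [derivC_eq, mvfderiv_add_apply hf.mdiff hf'.mdiff, smul_eq_mul]; ring

theorem derivC_mul (hf : SmoothFunNear f x) (hf' : SmoothFunNear f' x) :
    σ.derivC s t (fun y ↦ f y * f' y) x = f x * σ.derivC s t f' x + f' x * σ.derivC s t f x := by
  simp only [derivC_eq, mvfderiv_mul_apply hf.mdiff hf'.mdiff, smul_eq_mul]; ring

theorem derivC_congr (h : f =ᶠ[𝓝 x] f') : σ.derivC s t f x = σ.derivC s t f' x := by
  simp only [derivC_eq, mvfderiv_congr h]

theorem derivC_const (c : ℂ) : σ.derivC s t (fun _ ↦ c) x = 0 := by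
  simp [derivC_eq, mvfderiv_const]

theorem derivC_conj (hf : SmoothFunNear f x) :
    σ.derivC s t (fun y ↦ conj (f y)) x = conj (σ.derivC t s f x) := by
  have h (v : TangentSpace (𝓡 4) x) : mvfderiv (𝓡 4) (fun y ↦ conj (f y)) x v =
      conj (mvfderiv (𝓡 4) f x v) :=
    mvfderiv_clm_comp hf.mdiff (Complex.conjCLE : ℂ →L[ℝ] ℂ) v
  simp only [derivC, h]
  exact σ.complexify_conj (isLinearMap_mvfderiv f x) _ _

theorem IsSpinConnection.smoothSecNear_nablaC (hD : σ.IsSpinConnection nabla D)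
    (hr : SmoothSecNear C2 r x) (hs : SmoothSecNear C2 s x) (ht : SmoothSecNear C2 t x) :
    SmoothSecNear C2 (σ.nablaC D s t r) x := by
  have hc := hD.isSmoothConnection
  exact (hc.near hr (smoothSecNear_vecField (σ := σ) hs ht)).sub
    (hc.near hr (smoothSecNear_vecField (σ := σ) hs.I_smul ht)).I_smul

theorem nablaC_congr (hr : SmoothSecNear C2 r x) {r' : ∀ x, S x} (h : ∀ᶠ y in 𝓝 x, r' y = r y) :
    σ.nablaC D s t r' x = σ.nablaC D s t r x := by
  simp only [nablaC_eq, D.congr hr h]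

theorem nablaC_add {r r' : ∀ x, S x} (hr : SmoothSecNear C2 r x) (hr' : SmoothSecNear C2 r' x) :
    σ.nablaC D s t (r + r') x = σ.nablaC D s t r x + σ.nablaC D s t r' x := by
  simp only [nablaC_eq, D.add_apply hr hr']
  module

/-- The derivation of the ring of smooth functions on `U` along `s (conj t)`. -/
def derivation (σ : SpinStructure S g) {U : Set M} (hU : IsOpen U)
    (hs : ∀ x ∈ U, SmoothSecNear C2 s x) (ht : ∀ x ∈ U, SmoothSecNear C2 t x) :
    Derivation ℂ (smoothFunctions U) (smoothFunctions U) :=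
  Derivation.mk' (R := ℂ)
    { toFun := fun f ↦ smoothFunctions.mk (σ.derivC s t (rep f)) fun x hx ↦
        smoothFunNear_derivC (rep_smooth f x hx) (hs x hx) (ht x hx)
      map_add' := fun f f' ↦ by
        ext x
        have h := rep_eventuallyEq hU (f + f') (F := fun y ↦ rep f y + rep f' y)
          (fun y ↦ by simp [rep_apply]) x
        exact (derivC_congr h).trans
          (derivC_add (rep_smooth f x x.2) (rep_smooth f' x x.2))
      map_smul' := fun c f ↦ by
        ext x
        have h := rep_eventuallyEq hU (c • f) (F := fun y ↦ c * rep f y)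
          (fun y ↦ by simp [rep_apply]) x
        refine (derivC_congr h).trans
          ((derivC_mul (smoothFunNear_const c) (rep_smooth f x x.2)).trans ?_)
        rw [derivC_const, mul_zero, add_zero]
        rfl }
    fun f f' ↦ by
      ext x
      have h := rep_eventuallyEq hU (f * f') (F := fun y ↦ rep f y * rep f' y)
        (fun y ↦ by simp [rep_apply]) x
      refine (derivC_congr h).trans
        ((derivC_mul (rep_smooth f x x.2) (rep_smooth f' x x.2)).trans ?_)
      rw [rep_apply, rep_apply]
      rfl

theorem derivation_apply {U : Set M} (hU : IsOpen U)
    (hs : ∀ x ∈ U, SmoothSecNear C2 s x) (ht : ∀ x ∈ U, SmoothSecNear C2 t x)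
    (f : smoothFunctions U) {F : M → ℂ} (h : ∀ x : U, f.1 x = F x) (x : U) :
    (σ.derivation hU hs ht f).1 x = σ.derivC s t F x :=
  derivC_congr (rep_eventuallyEq hU f h x)

end SpinStructure

end Dyad

/-! ### Structure equations of a smooth dyad -/

section SpinCoefficients

open Filter Topology smoothFunctions

variable {M : Type*} [TopologicalSpace M] [ChartedSpace R4 M] [IsManifold (𝓡 4) ∞ M]
  {S : M → Type*} [TopologicalSpace (TotalSpace C2 S)]
  [∀ x, AddCommGroup (S x)] [∀ x, Module ℝ (S x)] [∀ x, Module ℂ (S x)]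
  [∀ x, IsScalarTower ℝ ℂ (S x)] [∀ x, TopologicalSpace (S x)]
  [∀ x, IsTopologicalAddGroup (S x)] [∀ x, ContinuousSMul ℝ (S x)]
  [FiberBundle C2 S] [VectorBundle ℝ C2 S] [VectorBundle ℂ C2 S]
  [ContMDiffVectorBundle ∞ C2 S (𝓡 4)]
  {g : LorentzMetric M} {σ : SpinStructure S g} {x : M}
  {nabla : CovariantDerivative (𝓡 4) R4 (TangentSpace (𝓡 4) : M → Type _)}
  {D : CovariantDerivative (𝓡 4) C2 S} {r s t s' t' : ∀ x, S x} {f : M → ℂ}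

namespace SpinStructure

/-- A smooth spin dyad on an open set. -/
structure IsSmoothDyadOn (σ : SpinStructure S g) (e : Fin 2 → ∀ x, S x) (U : Set M) : Prop where
  isOpen : IsOpen U
  smooth : ∀ k, ∀ x ∈ U, SmoothSecNear C2 (e k) x
  dyad : ∀ x ∈ U, σ.IsDyad (e 0 x) (e 1 x)

theorem IsSpinConnection.complexifyTwo_curvature_eq (hD : σ.IsSpinConnection nabla D)
    (hr : SmoothSecNear C2 r x) (hs : SmoothSecNear C2 s x) (ht : SmoothSecNear C2 t x)
    (hs' : SmoothSecNear C2 s' x) (ht' : SmoothSecNear C2 t' x) :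
    σ.complexifyTwo (fun X Y ↦ curvature D X Y r x) s t s' t' =
      σ.curvatureC D (s x) (t x) (s' x) (t' x) (r x) := by
  rw [complexifyTwo_congr (fun X Y hX hY ↦ curvature_eq hD.isSmoothConnection hX hY hr)
    hs ht hs' ht']
  rfl

theorem IsSpinConnection.smoothSecNear_curvatureC (hD : σ.IsSpinConnection nabla D)
    (hr : SmoothSecNear C2 r x) (hs : SmoothSecNear C2 s x) (ht : SmoothSecNear C2 t x)
    (hs' : SmoothSecNear C2 s' x) (ht' : SmoothSecNear C2 t' x) :
    SmoothSecNear C2 (fun y ↦ σ.curvatureC D (s y) (t y) (s' y) (t' y) (r y)) x := by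
  have hc := hD.isSmoothConnection
  have h₁ := smoothSecNear_vecField (σ := σ) hs ht
  have h₂ := smoothSecNear_vecField (σ := σ) hs.I_smul ht
  have h₃ := smoothSecNear_vecField (σ := σ) hs' ht'
  have h₄ := smoothSecNear_vecField (σ := σ) hs'.I_smul ht'
  have key := ((SmoothSecNear.curvature hc h₁ h₃ hr).sub
    (SmoothSecNear.curvature hc h₁ h₄ hr).I_smul).sub
    ((SmoothSecNear.curvature hc h₂ h₃ hr).sub
      (SmoothSecNear.curvature hc h₂ h₄ hr).I_smul).I_smul
  refine key.congr ?_
  filter_upwards [hr.eventually, hs.eventually, ht.eventually, hs'.eventually, ht'.eventually]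
    with y k₁ k₂ k₃ k₄ k₅
  exact (hD.complexifyTwo_curvature_eq k₁ k₂ k₃ k₄ k₅).symm

/-- The spin coefficients: the components of the derivatives of the dyad spinors. -/
def spinCoefficient (σ : SpinStructure S g) (D : CovariantDerivative (𝓡 4) C2 S)
    (e : Fin 2 → ∀ x, S x) (i j k m : Fin 2) (x : M) : ℂ :=
  σ.dyadCoeff (fun n ↦ e n x) (σ.nablaC D (e i) (e j) (e k) x) m

variable {e : Fin 2 → ∀ x, S x} {U : Set M}

theorem IsSmoothDyadOn.nablaC_eq_sum (he : σ.IsSmoothDyadOn e U) (hx : x ∈ U) (i j k : Fin 2) :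
    σ.nablaC D (e i) (e j) (e k) x = ∑ m, σ.spinCoefficient D e i j k m x • e m x :=
  σ.sum_dyadCoeff (e := fun n ↦ e n x) (he.dyad x hx) _

theorem IsSmoothDyadOn.smooth_spinCoefficient (he : σ.IsSmoothDyadOn e U)
    (hD : σ.IsSpinConnection nabla D) (i j k m : Fin 2) :
    ∀ x ∈ U, SmoothFunNear (σ.spinCoefficient D e i j k m) x := fun x hx ↦
  smoothFunNear_dyadCoeff (fun k ↦ he.smooth k x hx)
    (hD.smoothSecNear_nablaC (he.smooth k x hx) (he.smooth i x hx) (he.smooth j x hx)) m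

/-- The function `ε(e₀, e₁)` is constant and `ε` is parallel. -/
theorem IsSmoothDyadOn.spinCoefficient_trace (he : σ.IsSmoothDyadOn e U)
    (hD : σ.IsSpinConnection nabla D) (hx : x ∈ U) (i j : Fin 2) :
    σ.spinCoefficient D e i j 1 1 x = -σ.spinCoefficient D e i j 0 0 x := by
  have h (v : TangentSpace (𝓡 4) x) :
      σ.eps x (D (e 0) x v) (e 1 x) + σ.eps x (e 0 x) (D (e 1) x v) = 0 := by
    rw [← hD.eps_parallel _ _ _ (he.smooth 0 x hx).mdiff (he.smooth 1 x hx).mdiff]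
    have h₁ : (fun y ↦ σ.eps y (e 0 y) (e 1 y)) =ᶠ[𝓝 x] fun _ ↦ 1 := by
      filter_upwards [he.isOpen.mem_nhds hx] with y hy using he.dyad y hy
    rw [mvfderiv_congr h₁]
    simp [mvfderiv_const]
  simp only [spinCoefficient, eps_dyadCoeff, nablaC_eq, map_sub, map_smul, LinearMap.sub_apply,
    LinearMap.smul_apply, smul_eq_mul, one_ne_zero, if_true, if_false, σ.eps_swap _ (e 0 x)]
  linear_combination h (σ.vec x (e i x) (e j x))
    - Complex.I * h (σ.vec x (Complex.I • e i x) (e j x))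

theorem IsSmoothDyadOn.complexify_nablaC_left (he : σ.IsSmoothDyadOn e U) (hx : x ∈ U)
    {W : Type*} [AddCommGroup W] [Module ℝ W] [Module ℂ W] [IsScalarTower ℝ ℂ W]
    {L : TangentSpace (𝓡 4) x → W} (hL : IsLinearMap ℝ L) (i j k l : Fin 2) :
    σ.complexify L (σ.nablaC D (e i) (e j) (e k) x) (e l x) =
      ∑ n, σ.spinCoefficient D e i j k n x • σ.complexify L (e n x) (e l x) := by
  rw [he.nablaC_eq_sum hx]
  simp only [Fin.sum_univ_two, σ.complexify_add_left hL, σ.complexify_smul_left hL]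

theorem IsSmoothDyadOn.complexify_nablaC_right (he : σ.IsSmoothDyadOn e U) (hx : x ∈ U)
    {W : Type*} [AddCommGroup W] [Module ℝ W] [Module ℂ W] [IsScalarTower ℝ ℂ W]
    {L : TangentSpace (𝓡 4) x → W} (hL : IsLinearMap ℝ L) (i j k l : Fin 2) :
    σ.complexify L (e l x) (σ.nablaC D (e i) (e j) (e k) x) =
      ∑ n, conj (σ.spinCoefficient D e i j k n x) • σ.complexify L (e l x) (e n x) := by
  rw [he.nablaC_eq_sum hx]
  simp only [Fin.sum_univ_two, σ.complexify_add_right hL, σ.complexify_smul_right hL]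

theorem IsSmoothDyadOn.commutator (he : σ.IsSmoothDyadOn e U) (hD : σ.IsSpinConnection nabla D)
    (hn : IsLeviCivita g nabla) (hx : x ∈ U) (hf : SmoothFunNear f x) (i j k l : Fin 2) :
    σ.derivC (e i) (e j) (σ.derivC (e k) (e l) f) x
      - σ.derivC (e k) (e l) (σ.derivC (e i) (e j) f) x =
      ∑ n, (σ.spinCoefficient D e i j k n x * σ.derivC (e n) (e l) f x
        + conj (σ.spinCoefficient D e j i l n x) * σ.derivC (e k) (e n) f x
        - σ.spinCoefficient D e k l i n x * σ.derivC (e n) (e j) f x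
        - conj (σ.spinCoefficient D e l k j n x) * σ.derivC (e i) (e n) f x) := by
  have hL := isLinearMap_mvfderiv f x
  rw [hD.derivC_commutator hn hf (he.smooth i x hx) (he.smooth j x hx) (he.smooth k x hx)
    (he.smooth l x hx), he.complexify_nablaC_left hx hL, he.complexify_nablaC_right hx hL,
    he.complexify_nablaC_left hx hL, he.complexify_nablaC_right hx hL]
  simp only [Fin.sum_univ_two, derivC, smul_eq_mul]
  ring

theorem IsSmoothDyadOn.dyadCoeff_nablaC_nablaC (he : σ.IsSmoothDyadOn e U)
    (hD : σ.IsSpinConnection nabla D) (hx : x ∈ U) (i j k l m p : Fin 2) :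
    σ.dyadCoeff (fun n ↦ e n x) (σ.nablaC D (e i) (e j) (σ.nablaC D (e k) (e l) (e m)) x) p =
      σ.derivC (e i) (e j) (σ.spinCoefficient D e k l m p) x
        + ∑ n, σ.spinCoefficient D e k l m n x * σ.spinCoefficient D e i j n p x := by
  have hs := fun n ↦ he.smooth_spinCoefficient hD k l m n x hx
  have h₁ : ∀ᶠ y in 𝓝 x, σ.nablaC D (e k) (e l) (e m) y =
      ((fun y ↦ σ.spinCoefficient D e k l m 0 y • e 0 y)
        + fun y ↦ σ.spinCoefficient D e k l m 1 y • e 1 y) y := by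
    filter_upwards [he.isOpen.mem_nhds hx] with y hy
    rw [he.nablaC_eq_sum hy, Fin.sum_univ_two]
    rfl
  have h₂ (n : Fin 2) : SmoothSecNear C2 (fun y ↦ σ.spinCoefficient D e k l m n y • e n y) x := by
    have h := ((SmoothSecNear.smul ((hs n).clm_comp Complex.reCLM) (he.smooth n x hx)).add
      (.smul ((hs n).clm_comp Complex.imCLM) (he.smooth n x hx).I_smul))
    exact h.congr (.of_forall fun y ↦ complex_smul_eq _ _)
  rw [nablaC_congr ((h₂ 0).add (h₂ 1)) h₁, nablaC_add (h₂ 0) (h₂ 1),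
    hD.nablaC_smul (hs 0) (he.smooth 0 x hx), hD.nablaC_smul (hs 1) (he.smooth 1 x hx)]
  simp only [dyadCoeff_add, dyadCoeff_smul, dyadCoeff_dyad (e := fun n ↦ e n x) (he.dyad x hx),
    Fin.sum_univ_two]
  fin_cases p <;> simp [spinCoefficient] <;> ring

/-- The Newman–Penrose Ricci identities: second derivatives of `e m` give derivatives and products
of coefficients. The bracket of the two tetrad vectors gives the first sum, where the primed factors
contribute conjugates with transposed direction indices. -/
theorem IsSmoothDyadOn.curvature (he : σ.IsSmoothDyadOn e U) (hD : σ.IsSpinConnection nabla D)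
    (hn : IsLeviCivita g nabla) (hx : x ∈ U) (i j k l m p : Fin 2) :
    σ.derivC (e i) (e j) (σ.spinCoefficient D e k l m p) x
      - σ.derivC (e k) (e l) (σ.spinCoefficient D e i j m p) x
      - ∑ n, (σ.spinCoefficient D e i j k n x * σ.spinCoefficient D e n l m p x
        + conj (σ.spinCoefficient D e j i l n x) * σ.spinCoefficient D e k n m p x
        - σ.spinCoefficient D e k l i n x * σ.spinCoefficient D e n j m p x
        - conj (σ.spinCoefficient D e l k j n x) * σ.spinCoefficient D e i n m p x)
      + ∑ n, (σ.spinCoefficient D e k l m n x * σ.spinCoefficient D e i j n p x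
        - σ.spinCoefficient D e i j m n x * σ.spinCoefficient D e k l n p x) =
      ∑ q, levi p q * σ.spinCurvatureComponent D (fun n ↦ e n x) i j k l m q := by
  have hL := D.isLinearMap (e m) x
  have hs := fun n ↦ he.smooth n x hx
  have h := hD.complexifyTwo_curvature hn (hs m) (hs i) (hs j) (hs k) (hs l)
  rw [hD.complexifyTwo_curvature_eq (hs m) (hs i) (hs j) (hs k) (hs l),
    he.complexify_nablaC_left hx hL, he.complexify_nablaC_right hx hL,
    he.complexify_nablaC_left hx hL, he.complexify_nablaC_right hx hL] at h
  have h := congrArg (fun a ↦ σ.dyadCoeff (fun n ↦ e n x) a p) h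
  simp only [dyadCoeff_sub, he.dyadCoeff_nablaC_nablaC hD hx] at h
  change ∑ q, levi p q * σ.spinCurvatureComponent D (fun n ↦ e n x) i j k l m q = _ at h
  rw [h]
  simp only [Fin.sum_univ_two, dyadCoeff_add, dyadCoeff_sub, dyadCoeff_smul]
  simp only [spinCoefficient, nablaC]
  ring

end SpinStructure
end SpinCoefficients

/-! ### A smooth dyad as a model of the abstract calculus -/

section Calculus

open Filter Topology smoothFunctions

variable {M : Type*} [TopologicalSpace M] [ChartedSpace R4 M] [IsManifold (𝓡 4) ∞ M]
  {S : M → Type*} [TopologicalSpace (TotalSpace C2 S)]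
  [∀ x, AddCommGroup (S x)] [∀ x, Module ℝ (S x)] [∀ x, Module ℂ (S x)]
  [∀ x, IsScalarTower ℝ ℂ (S x)] [∀ x, TopologicalSpace (S x)]
  [∀ x, IsTopologicalAddGroup (S x)] [∀ x, ContinuousSMul ℝ (S x)]
  [FiberBundle C2 S] [VectorBundle ℝ C2 S] [VectorBundle ℂ C2 S]
  [ContMDiffVectorBundle ∞ C2 S (𝓡 4)]
  {g : LorentzMetric M} {σ : SpinStructure S g} {x : M}
  {nabla : CovariantDerivative (𝓡 4) R4 (TangentSpace (𝓡 4) : M → Type _)}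
  {D : CovariantDerivative (𝓡 4) C2 S} {r s t s' t' : ∀ x, S x} {f : M → ℂ}
  {e : Fin 2 → ∀ x, S x} {U : Set M}

namespace SpinStructure

theorem IsSmoothDyadOn.smooth_spinCurvatureComponent (he : σ.IsSmoothDyadOn e U)
    (hD : σ.IsSpinConnection nabla D) (i j k l m q : Fin 2) : ∀ x ∈ U, SmoothFunNear
      (fun x ↦ σ.spinCurvatureComponent D (fun n ↦ e n x) i j k l m q) x := fun x hx ↦
  smoothFunNear_eps (hD.smoothSecNear_curvatureC (he.smooth m x hx) (he.smooth i x hx)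
    (he.smooth j x hx) (he.smooth k x hx) (he.smooth l x hx)) (he.smooth q x hx)

end SpinStructure

namespace smoothFunctions

/-- The evaluation of a function at a point. -/
def eval (x : U) : smoothFunctions U →ₐ[ℂ] ℂ :=
  (Pi.evalAlgHom ℂ (fun _ : U ↦ ℂ) x).comp (smoothFunctions U).val

theorem eval_apply (x : U) (f : smoothFunctions U) : eval x f = f.1 x := rfl

theorem eval_levi (x : U) (i j : Fin 2) : eval x (levi i j) = levi i j := by
  simp only [levi]
  split_ifs <;> simp

theorem eval_curvatureComponent (x : U) (Ψ : ℕ → smoothFunctions U) (Λ : smoothFunctions U)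
    (i j k l : Fin 2) : eval x (curvatureComponent Ψ Λ i j k l) =
      curvatureComponent (fun n ↦ eval x (Ψ n)) (eval x Λ) i j k l := by
  simp only [curvatureComponent, map_add, map_mul, eval_levi]

end smoothFunctions

namespace SpinStructure

/-- The Weyl scalars `Ψ_n` of a dyad field. -/
def weylScalar (σ : SpinStructure S g) (D : CovariantDerivative (𝓡 4) C2 S)
    (e : Fin 2 → ∀ x, S x) (n : ℕ) (x : M) : ℂ :=
  weylComponents (σ.spinCurvatureComponent D fun n ↦ e n x) n

theorem IsSmoothDyadOn.smooth_weylScalar (he : σ.IsSmoothDyadOn e U)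
    (hD : σ.IsSpinConnection nabla D) (n : ℕ) :
    ∀ x ∈ U, SmoothFunNear (σ.weylScalar D e n) x := fun x hx ↦ by
  have h i j k l m q := he.smooth_spinCurvatureComponent hD i j k l m q x hx
  match n with
  | 0 => exact h 0 0 0 1 0 0
  | 1 => exact h 0 0 0 1 0 1
  | 2 =>
    exact ((smoothFunNear_const (1 / 3)).mul ((h 0 0 0 1 1 1).add
      ((smoothFunNear_const 2).mul (h 0 0 1 1 0 1)))).congr
        (.of_forall fun y ↦ by simp only [weylScalar, weylComponents]; ring)
  | 3 => exact h 0 0 1 1 1 1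
  | n + 4 => exact h 1 0 1 1 1 1

theorem curvatureComponent_conj (Ψ : ℕ → ℂ) (c : ℝ) (i j k l : Fin 2) :
    conj (curvatureComponent Ψ (c / 6 : ℂ) i j k l) =
      curvatureComponent (fun n ↦ conj (Ψ n)) (c / 6 : ℂ) i j k l := by
  have h : (starRingEnd ℂ) 6 = 6 := Complex.conj_ofNat 6
  simp [curvatureComponent, levi_conj, h]

/-- The spin coefficient calculus of a smooth dyad, in the ring of smooth functions. -/
def IsSmoothDyadOn.spinCoefficients (he : σ.IsSmoothDyadOn e U)
    (hD : σ.IsSpinConnection nabla D) (hn : IsLeviCivita g nabla) {c : ℝ}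
    (hc : ∀ (x : M) (v w : TangentSpace (𝓡 4) x), ricci nabla x v w = c * g.inner x v w)
    (hΨ₀ : ∀ x ∈ U, σ.weylScalar D e 0 x = 0) (hΨ₁ : ∀ x ∈ U, σ.weylScalar D e 1 x = 0) :
    SpinCoefficients (smoothFunctions U) where
  E i j := σ.derivation he.isOpen (he.smooth i) (he.smooth j)
  Γ i j k m := smoothFunctions.mk (σ.spinCoefficient D e i j k m)
    (he.smooth_spinCoefficient hD i j k m)
  -- The direction indices are transposed because the conjugate of `e_i (conj e_j)` is `e_j (conj
  -- e_i)`.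
  Γb i j k m := smoothFunctions.mk (fun x ↦ conj (σ.spinCoefficient D e j i k m x)) fun x hx ↦
    (he.smooth_spinCoefficient hD j i k m x hx).conj
  Ψ n := smoothFunctions.mk (σ.weylScalar D e n) (he.smooth_weylScalar hD n)
  Ψb n := smoothFunctions.mk (fun x ↦ conj (σ.weylScalar D e n x)) fun x hx ↦
    (he.smooth_weylScalar hD n x hx).conj
  Λ := algebraMap ℂ _ (c / 6)
  trace i j := by ext x; exact he.spinCoefficient_trace hD x.2 i j
  traceb i j := by
    ext x
    exact (congrArg conj (he.spinCoefficient_trace hD x.2 j i)).trans (map_neg _ _)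
  Ψ_zero := by ext x; exact hΨ₀ x x.2
  Ψ_one := by ext x; exact hΨ₁ x x.2
  Ψb_zero := by ext x; exact (congrArg conj (hΨ₀ x x.2)).trans (map_zero _)
  Ψb_one := by ext x; exact (congrArg conj (hΨ₁ x x.2)).trans (map_zero _)
  derivation_Λ i j := Derivation.map_algebraMap _ _
  comm i j k l f := by
    refine smoothFunctions.ext fun x ↦ ?_
    have h := he.commutator hD hn x.2 (rep_smooth f x x.2) i j k l
    rw [← derivation_apply he.isOpen (he.smooth i) (he.smooth j)
      (σ.derivation he.isOpen (he.smooth k) (he.smooth l) f) (fun _ ↦ rfl) x,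
      ← derivation_apply he.isOpen (he.smooth k) (he.smooth l)
      (σ.derivation he.isOpen (he.smooth i) (he.smooth j) f) (fun _ ↦ rfl) x,
      Fin.sum_univ_two] at h
    rw [Fin.sum_univ_two]
    exact h
  curv i j k l m p := by
    refine smoothFunctions.ext fun x ↦ ?_
    have h := he.curvature hD hn x.2 i j k l m p
    have hk (i j k l m p : Fin 2) := derivation_apply (σ := σ) he.isOpen (he.smooth i) (he.smooth j)
      (smoothFunctions.mk (σ.spinCoefficient D e k l m p) (he.smooth_spinCoefficient hD k l m p))
      (F := σ.spinCoefficient D e k l m p) (fun _ ↦ rfl) x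
    simp only [hD.spinCurvatureComponent_eq hn (hc x) (e := fun n ↦ e n x) (he.dyad x x.2), ← hk,
      Fin.sum_univ_two] at h
    simp only [Fin.sum_univ_two]
    refine h.trans ?_
    rw [← eval_apply]
    simp only [map_add, map_mul, eval_levi, eval_curvatureComponent]
    simp only [eval_apply, mk_apply, weylScalar, AlgHom.commutes, Algebra.algebraMap_self,
      RingHom.id_apply]
    ring
  curvb i j k l m p := by
    refine smoothFunctions.ext fun x ↦ ?_
    -- Conjugating the identity for the transposed pairs `j i` and `l k` produces the one for `i j`
    -- and `k l`. The scalar `c / 6` is real, so the same `Λ` serves both.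
    have h := congrArg conj (he.curvature hD hn x.2 j i l k m p)
    have hk (i j k l m p : Fin 2) := derivation_apply (σ := σ) he.isOpen (he.smooth i) (he.smooth j)
      (smoothFunctions.mk (fun x ↦ conj (σ.spinCoefficient D e l k m p x)) fun x hx ↦
        (he.smooth_spinCoefficient hD l k m p x hx).conj)
      (F := fun x ↦ conj (σ.spinCoefficient D e l k m p x)) (fun _ ↦ rfl) x
    have hk' (i j k l m p : Fin 2) := (hk i j k l m p).trans
      (derivC_conj (he.smooth_spinCoefficient hD l k m p x x.2))
    simp only [hD.spinCurvatureComponent_eq hn (hc x) (e := fun n ↦ e n x) (he.dyad x x.2), map_sub,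
      map_add, map_mul, ← hk', Fin.sum_univ_two, Complex.conj_conj, levi_conj,
      curvatureComponent_conj] at h
    simp only [Fin.sum_univ_two]
    refine Eq.trans ?_ (h.trans ?_)
    · rw [← eval_apply]
      simp only [map_add, map_sub, map_mul]
      simp only [eval_apply, mk_apply]
      ring
    · rw [← eval_apply]
      simp only [map_add, map_mul, eval_levi, eval_curvatureComponent]
      simp only [eval_apply, mk_apply, weylScalar, AlgHom.commutes, Algebra.algebraMap_self,
        RingHom.id_apply]
      ring

end SpinStructure
end Calculus

/-! ### Covariant derivatives of bilinear and sesquilinear forms -/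

section Forms

open Filter Topology smoothFunctions

variable {M : Type*} [TopologicalSpace M] [ChartedSpace R4 M] [IsManifold (𝓡 4) ∞ M]
  {S : M → Type*} [TopologicalSpace (TotalSpace C2 S)]
  [∀ x, AddCommGroup (S x)] [∀ x, Module ℝ (S x)] [∀ x, Module ℂ (S x)]
  [∀ x, IsScalarTower ℝ ℂ (S x)] [∀ x, TopologicalSpace (S x)]
  [∀ x, IsTopologicalAddGroup (S x)] [∀ x, ContinuousSMul ℝ (S x)]
  [FiberBundle C2 S] [VectorBundle ℝ C2 S] [VectorBundle ℂ C2 S]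
  [ContMDiffVectorBundle ∞ C2 S (𝓡 4)]
  {g : LorentzMetric M} {σ : SpinStructure S g} {x : M}
  {nabla : CovariantDerivative (𝓡 4) R4 (TangentSpace (𝓡 4) : M → Type _)}
  {D : CovariantDerivative (𝓡 4) C2 S} {r s t s' t' : ∀ x, S x} {f : M → ℂ}
  {e : Fin 2 → ∀ x, S x} {U : Set M} {θ : ℂ →+* ℂ} {T : ∀ x, S x → S x → ℂ}

/-- `T` is a smooth field on `U` of forms on pairs of spinors, linear in the first and semilinear
in the second argument. -/
structure IsSmoothFormOn (θ : ℂ →+* ℂ) (T : ∀ x, S x → S x → ℂ) (U : Set M) : Prop where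
  isOpen : IsOpen U
  map_real (r : ℝ) : θ r = r
  add_left : ∀ x ∈ U, ∀ a a' b, T x (a + a') b = T x a b + T x a' b
  smul_left : ∀ x ∈ U, ∀ (z : ℂ) a b, T x (z • a) b = z * T x a b
  add_right : ∀ x ∈ U, ∀ a b b', T x a (b + b') = T x a b + T x a b'
  smul_right : ∀ x ∈ U, ∀ (z : ℂ) a b, T x a (z • b) = θ z * T x a b
  smooth : ∀ x ∈ U, ∀ s t : ∀ x, S x, SmoothSecNear C2 s x → SmoothSecNear C2 t x →
    SmoothFunNear (fun y ↦ T y (s y) (t y)) x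

namespace IsSmoothFormOn

/-- The covariant derivative of a form, evaluated on spinor fields. -/
def leibniz (D : CovariantDerivative (𝓡 4) C2 S) (T : ∀ x, S x → S x → ℂ) (x : M)
    (v : TangentSpace (𝓡 4) x) (s t : ∀ x, S x) : ℂ :=
  mvfderiv (𝓡 4) (fun y ↦ T y (s y) (t y)) x v - T x (D s x v) (t x) - T x (s x) (D t x v)

theorem real_smul_left (hT : IsSmoothFormOn θ T U) (hx : x ∈ U)
    (r : ℝ) (a b : S x) : T x (r • a) b = r * T x a b := by
  rw [← algebraMap_smul ℂ r a, hT.smul_left x hx]; rfl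

theorem real_smul_right (hT : IsSmoothFormOn θ T U) (hx : x ∈ U)
    (r : ℝ) (a b : S x) : T x a (r • b) = r * T x a b := by
  rw [← algebraMap_smul ℂ r b, hT.smul_right x hx]
  exact congrArg (· * _) (hT.map_real r)

/-- The derivative of `f` from the product rule for `T(f s, t)` is cancelled by the one in `D (f
s)`. Real functions suffice for tensoriality, so bilinear and sesquilinear forms need no
distinction. -/
theorem tensorial_left (hT : IsSmoothFormOn θ T U) (hx : x ∈ U)
    (v : TangentSpace (𝓡 4) x) (ht : SmoothSecNear C2 t x) :
    SmoothTensorialAt C2 (fun s ↦ leibniz D T x v s t) x where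
  smul {f s} hf hs := by
    have h : (fun y ↦ T y ((f • s) y) (t y)) =ᶠ[𝓝 x]
        fun y ↦ Complex.ofRealCLM (f y) * T y (s y) (t y) := by
      filter_upwards [hT.isOpen.mem_nhds hx] with y hy using hT.real_smul_left hy _ _ _
    simp only [leibniz]
    rw [mvfderiv_congr h, mvfderiv_mul_apply (hf.clm_comp _).mdiff (hT.smooth x hx s t hs ht).mdiff,
      mvfderiv_clm_comp hf.mdiff, D.smul_apply hf hs, hT.add_left x hx, hT.real_smul_left hx,
      hT.real_smul_left hx, Pi.smul_apply', hT.real_smul_left hx]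
    simp only [Complex.ofRealCLM_apply, Complex.real_smul]
    ring
  add {s s'} hs hs' := by
    have h : (fun y ↦ T y ((s + s') y) (t y)) =ᶠ[𝓝 x]
        fun y ↦ T y (s y) (t y) + T y (s' y) (t y) := by
      filter_upwards [hT.isOpen.mem_nhds hx] with y hy using hT.add_left y hy _ _ _
    simp only [leibniz]
    rw [mvfderiv_congr h, mvfderiv_add_apply (hT.smooth x hx s t hs ht).mdiff
      (hT.smooth x hx s' t hs' ht).mdiff, D.add_apply hs hs', hT.add_left x hx, Pi.add_apply,
      hT.add_left x hx]
    ring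

theorem tensorial_right (hT : IsSmoothFormOn θ T U) (hx : x ∈ U)
    (v : TangentSpace (𝓡 4) x) (hs : SmoothSecNear C2 s x) :
    SmoothTensorialAt C2 (fun t ↦ leibniz D T x v s t) x where
  smul {f t} hf ht := by
    have h : (fun y ↦ T y (s y) ((f • t) y)) =ᶠ[𝓝 x]
        fun y ↦ Complex.ofRealCLM (f y) * T y (s y) (t y) := by
      filter_upwards [hT.isOpen.mem_nhds hx] with y hy using hT.real_smul_right hy _ _ _
    simp only [leibniz]
    rw [mvfderiv_congr h, mvfderiv_mul_apply (hf.clm_comp _).mdiff (hT.smooth x hx s t hs ht).mdiff,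
      mvfderiv_clm_comp hf.mdiff, D.smul_apply hf ht, hT.add_right x hx, hT.real_smul_right hx,
      hT.real_smul_right hx, Pi.smul_apply', hT.real_smul_right hx]
    simp only [Complex.ofRealCLM_apply, Complex.real_smul]
    ring
  add {t t'} ht ht' := by
    have h : (fun y ↦ T y (s y) ((t + t') y)) =ᶠ[𝓝 x]
        fun y ↦ T y (s y) (t y) + T y (s y) (t' y) := by
      filter_upwards [hT.isOpen.mem_nhds hx] with y hy using hT.add_right y hy _ _ _
    simp only [leibniz]
    rw [mvfderiv_congr h, mvfderiv_add_apply (hT.smooth x hx s t hs ht).mdiff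
      (hT.smooth x hx s t' hs ht').mdiff, D.add_apply ht ht', hT.add_right x hx, Pi.add_apply,
      hT.add_right x hx]
    ring

/-- The covariant derivative of a form is independent of the extensions of the spinors. -/
theorem covDeriv_eq (hT : IsSmoothFormOn θ T U) (hx : x ∈ U)
    (v : TangentSpace (𝓡 4) x) (hs : SmoothSecNear C2 s x)
    (ht : SmoothSecNear C2 t x) : covDeriv D T x v (s x) (t x) =
      mvfderiv (𝓡 4) (fun y ↦ T y (s y) (t y)) x v - T x (D s x v) (t x) - T x (s x) (D t x v) := by
  have hs' : SmoothSecNear C2 (FiberBundle.extend C2 (s x)) x := .extend _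
  have ht' : SmoothSecNear C2 (FiberBundle.extend C2 (t x)) x := .extend _
  have h : covDeriv D T x v (s x) (t x) =
      leibniz D T x v (FiberBundle.extend C2 (s x)) (FiberBundle.extend C2 (t x)) := by
    simp only [covDeriv, leibniz, FiberBundle.extend_apply_self]
  rw [h, (hT.tensorial_left hx v ht').pointwise hs' hs (FiberBundle.extend_apply_self ..),
    (hT.tensorial_right hx v hs).pointwise ht' ht (FiberBundle.extend_apply_self ..)]
  rfl

theorem isLinearMap_covDeriv (hT : IsSmoothFormOn θ T U) (hx : x ∈ U)
    (a b : S x) : IsLinearMap ℝ fun v ↦ covDeriv D T x v a b where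
  map_add v w := by
    simp only [covDeriv, map_add, hT.add_left x hx, hT.add_right x hx]
    ring
  map_smul r v := by
    simp only [covDeriv, map_smul, hT.real_smul_left hx, hT.real_smul_right hx, Complex.real_smul]
    ring

theorem covDeriv_add_left (hT : IsSmoothFormOn θ T U) (hx : x ∈ U)
    (v : TangentSpace (𝓡 4) x) (a a' b : S x) :
    covDeriv D T x v (a + a') b = covDeriv D T x v a b + covDeriv D T x v a' b := by
  have h (a : S x) : SmoothSecNear C2 (FiberBundle.extend C2 a) x := .extend _
  have h' (a : S x) : FiberBundle.extend C2 a x = a := FiberBundle.extend_apply_self ..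
  have key (s t : ∀ x, S x) (hs : SmoothSecNear C2 s x) (ht : SmoothSecNear C2 t x) :
      covDeriv D T x v (s x) (t x) = leibniz D T x v s t := hT.covDeriv_eq hx v hs ht
  have h₁ := (hT.tensorial_left (D := D) hx v (h b)).add (h a) (h a')
  simpa only [← key _ _ (h _) (h _), ← key _ _ ((h _).add (h _)) (h _), Pi.add_apply, h'] using h₁

theorem covDeriv_add_right (hT : IsSmoothFormOn θ T U) (hx : x ∈ U)
    (v : TangentSpace (𝓡 4) x) (a b b' : S x) :
    covDeriv D T x v a (b + b') = covDeriv D T x v a b + covDeriv D T x v a b' := by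
  have h (a : S x) : SmoothSecNear C2 (FiberBundle.extend C2 a) x := .extend _
  have h' (a : S x) : FiberBundle.extend C2 a x = a := FiberBundle.extend_apply_self ..
  have key (s t : ∀ x, S x) (hs : SmoothSecNear C2 s x) (ht : SmoothSecNear C2 t x) :
      covDeriv D T x v (s x) (t x) = leibniz D T x v s t := hT.covDeriv_eq hx v hs ht
  have h₁ := (hT.tensorial_right (D := D) hx v (h a)).add (h b) (h b')
  simpa only [← key _ _ (h _) (h _), ← key _ _ (h _) ((h _).add (h _)), Pi.add_apply, h'] using h₁

theorem smoothSecNear_const_smul (z : ℂ) (hs : SmoothSecNear C2 s x) :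
    SmoothSecNear C2 (fun y ↦ z • s y) x :=
  ((SmoothSecNear.smul (smoothFunNear_const z.re) hs).add
    (.smul (smoothFunNear_const z.im) hs.I_smul)).congr (.of_forall fun _ ↦ complex_smul_eq _ _)

theorem covDeriv_smul_left (hT : IsSmoothFormOn θ T U) (hx : x ∈ U)
    (hD : σ.IsSpinConnection nabla D) (v : TangentSpace (𝓡 4) x) (z : ℂ)
    (a b : S x) : covDeriv D T x v (z • a) b = z * covDeriv D T x v a b := by
  have ha : SmoothSecNear C2 (FiberBundle.extend C2 a) x := .extend _
  have hb : SmoothSecNear C2 (FiberBundle.extend C2 b) x := .extend _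
  have h₁ := hT.covDeriv_eq (D := D) hx v (smoothSecNear_const_smul z ha) hb
  have h : (fun y ↦ T y (z • FiberBundle.extend C2 a y) (FiberBundle.extend C2 b y)) =ᶠ[𝓝 x]
      fun y ↦ z * T y (FiberBundle.extend C2 a y) (FiberBundle.extend C2 b y) := by
    filter_upwards [hT.isOpen.mem_nhds hx] with y hy using hT.smul_left y hy _ _ _
  rw [mvfderiv_congr h, mvfderiv_mul_apply (smoothFunNear_const z).mdiff
    (hT.smooth x hx _ _ ha hb).mdiff, hD.apply_smul (smoothFunNear_const z) ha] at h₁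
  simp only [mvfderiv_const, FiberBundle.extend_apply_self] at h₁
  rw [h₁, covDeriv]
  simp [hT.smul_left x hx]
  ring

theorem covDeriv_smul_right (hT : IsSmoothFormOn θ T U) (hx : x ∈ U)
    (hD : σ.IsSpinConnection nabla D) (v : TangentSpace (𝓡 4) x) (z : ℂ)
    (a b : S x) : covDeriv D T x v a (z • b) = θ z * covDeriv D T x v a b := by
  have ha : SmoothSecNear C2 (FiberBundle.extend C2 a) x := .extend _
  have hb : SmoothSecNear C2 (FiberBundle.extend C2 b) x := .extend _
  have h₁ := hT.covDeriv_eq (D := D) hx v ha (smoothSecNear_const_smul z hb)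
  have h : (fun y ↦ T y (FiberBundle.extend C2 a y) (z • FiberBundle.extend C2 b y)) =ᶠ[𝓝 x]
      fun y ↦ θ z * T y (FiberBundle.extend C2 a y) (FiberBundle.extend C2 b y) := by
    filter_upwards [hT.isOpen.mem_nhds hx] with y hy using hT.smul_right y hy _ _ _
  rw [mvfderiv_congr h, mvfderiv_mul_apply (smoothFunNear_const _).mdiff
    (hT.smooth x hx _ _ ha hb).mdiff, hD.apply_smul (smoothFunNear_const z) hb] at h₁
  simp only [mvfderiv_const, FiberBundle.extend_apply_self] at h₁
  rw [h₁, covDeriv]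
  simp [hT.smul_right x hx]
  ring

end IsSmoothFormOn
end Forms

/-! ### Spinor derivatives in dyad components -/

section SpinorDerivative

open Filter Topology smoothFunctions

variable {M : Type*} [TopologicalSpace M] [ChartedSpace R4 M] [IsManifold (𝓡 4) ∞ M]
  {S : M → Type*} [TopologicalSpace (TotalSpace C2 S)]
  [∀ x, AddCommGroup (S x)] [∀ x, Module ℝ (S x)] [∀ x, Module ℂ (S x)]
  [∀ x, IsScalarTower ℝ ℂ (S x)] [∀ x, TopologicalSpace (S x)]
  [∀ x, IsTopologicalAddGroup (S x)] [∀ x, ContinuousSMul ℝ (S x)]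
  [FiberBundle C2 S] [VectorBundle ℝ C2 S] [VectorBundle ℂ C2 S]
  [ContMDiffVectorBundle ∞ C2 S (𝓡 4)]
  {g : LorentzMetric M} {σ : SpinStructure S g} {x : M}
  {nabla : CovariantDerivative (𝓡 4) R4 (TangentSpace (𝓡 4) : M → Type _)}
  {D : CovariantDerivative (𝓡 4) C2 S} {p q s t : ∀ x, S x}
  {e : Fin 2 → ∀ x, S x} {U : Set M} {θ : ℂ →+* ℂ} {T : ∀ x, S x → S x → ℂ}

theorem SpinStructure.exists_dyad_eq {e : Fin 2 → S x} (h : σ.IsDyad (e 0) (e 1)) (a : S x) :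
    ∃ z₀ z₁ : ℂ, a = z₀ • e 0 + z₁ • e 1 :=
  ⟨_, _, (σ.sum_dyadCoeff h a).trans (Fin.sum_univ_two _)⟩

/-- A field of forms whose components in a smooth dyad are smooth is smooth. -/
theorem SpinStructure.IsSmoothDyadOn.isSmoothFormOn (he : σ.IsSmoothDyadOn e U)
    (map_real : ∀ r : ℝ, θ r = r)
    (hθ : ∀ (f : M → ℂ) (x : M), SmoothFunNear f x → SmoothFunNear (fun y ↦ θ (f y)) x)
    (add_left : ∀ x ∈ U, ∀ a a' b, T x (a + a') b = T x a b + T x a' b)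
    (smul_left : ∀ x ∈ U, ∀ (z : ℂ) a b, T x (z • a) b = z * T x a b)
    (add_right : ∀ x ∈ U, ∀ a b b', T x a (b + b') = T x a b + T x a b')
    (smul_right : ∀ x ∈ U, ∀ (z : ℂ) a b, T x a (z • b) = θ z * T x a b)
    (smooth : ∀ k l, ∀ x ∈ U, SmoothFunNear (fun y ↦ T y (e k y) (e l y)) x) :
    IsSmoothFormOn θ T U where
  isOpen := he.isOpen
  map_real := map_real
  add_left := add_left
  smul_left := smul_left
  add_right := add_right
  smul_right := smul_right
  smooth x hx s t hs ht := by
    have hc {s : ∀ x, S x} (hs : SmoothSecNear C2 s x) (m : Fin 2) :=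
      smoothFunNear_dyadCoeff (σ := σ) (fun k ↦ he.smooth k x hx) hs m
    have key (k l : Fin 2) := ((hc hs k).mul (hθ _ _ (hc ht l))).mul (smooth k l x hx)
    refine (((key 0 0).add (key 0 1)).add ((key 1 0).add (key 1 1))).congr ?_
    filter_upwards [he.isOpen.mem_nhds hx] with y hy
    conv_lhs => rw [σ.sum_dyadCoeff (e := fun n ↦ e n y) (he.dyad y hy) (s y),
      σ.sum_dyadCoeff (e := fun n ↦ e n y) (he.dyad y hy) (t y)]
    simp only [Fin.sum_univ_two, add_left y hy, add_right y hy, smul_left y hy, smul_right y hy]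
    ring

namespace IsSmoothFormOn

theorem spinorDeriv_add_one (hT : IsSmoothFormOn θ T U) (hx : x ∈ U) (c d c' a b : S x) :
    σ.spinorDeriv D T x (c + d) c' a b =
      σ.spinorDeriv D T x c c' a b + σ.spinorDeriv D T x d c' a b :=
  σ.complexify_add_left (hT.isLinearMap_covDeriv hx a b)

theorem spinorDeriv_smul_one (hT : IsSmoothFormOn θ T U) (hx : x ∈ U) (z : ℂ) (c c' a b : S x) :
    σ.spinorDeriv D T x (z • c) c' a b = z * σ.spinorDeriv D T x c c' a b :=
  σ.complexify_smul_left (hT.isLinearMap_covDeriv hx a b) z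

theorem spinorDeriv_add_two (hT : IsSmoothFormOn θ T U) (hx : x ∈ U) (c c' d' a b : S x) :
    σ.spinorDeriv D T x c (c' + d') a b =
      σ.spinorDeriv D T x c c' a b + σ.spinorDeriv D T x c d' a b :=
  σ.complexify_add_right (hT.isLinearMap_covDeriv hx a b)

theorem spinorDeriv_smul_two (hT : IsSmoothFormOn θ T U) (hx : x ∈ U) (z : ℂ) (c c' a b : S x) :
    σ.spinorDeriv D T x c (z • c') a b = conj z * σ.spinorDeriv D T x c c' a b :=
  σ.complexify_smul_right (hT.isLinearMap_covDeriv hx a b) z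

theorem spinorDeriv_add_three (hT : IsSmoothFormOn θ T U) (hx : x ∈ U) (c c' a a' b : S x) :
    σ.spinorDeriv D T x c c' (a + a') b =
      σ.spinorDeriv D T x c c' a b + σ.spinorDeriv D T x c c' a' b := by
  simp only [SpinStructure.spinorDeriv, SpinStructure.cext, hT.covDeriv_add_left hx]
  ring

theorem spinorDeriv_smul_three (hD : σ.IsSpinConnection nabla D) (hT : IsSmoothFormOn θ T U)
    (hx : x ∈ U) (z : ℂ) (c c' a b : S x) :
    σ.spinorDeriv D T x c c' (z • a) b = z * σ.spinorDeriv D T x c c' a b := by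
  simp only [SpinStructure.spinorDeriv, SpinStructure.cext, hT.covDeriv_smul_left hx hD]
  ring

theorem spinorDeriv_add_four (hT : IsSmoothFormOn θ T U) (hx : x ∈ U) (c c' a b b' : S x) :
    σ.spinorDeriv D T x c c' a (b + b') =
      σ.spinorDeriv D T x c c' a b + σ.spinorDeriv D T x c c' a b' := by
  simp only [SpinStructure.spinorDeriv, SpinStructure.cext, hT.covDeriv_add_right hx]
  ring

theorem spinorDeriv_smul_four (hD : σ.IsSpinConnection nabla D) (hT : IsSmoothFormOn θ T U)
    (hx : x ∈ U) (z : ℂ) (c c' a b : S x) :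
    σ.spinorDeriv D T x c c' a (z • b) = θ z * σ.spinorDeriv D T x c c' a b := by
  simp only [SpinStructure.spinorDeriv, SpinStructure.cext, hT.covDeriv_smul_right hx hD]
  ring

theorem sub_I_smul_left (hT : IsSmoothFormOn θ T U) (hx : x ∈ U) (a a' b : S x) :
    T x (a - Complex.I • a') b = T x a b - Complex.I * T x a' b := by
  rw [sub_eq_add_neg, ← neg_smul, hT.add_left x hx, hT.smul_left x hx]
  ring

/-- The spinor derivative of a bilinear form. -/
theorem spinorDeriv_bilinear (hT : IsSmoothFormOn (RingHom.id ℂ) T U) (hx : x ∈ U)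
    (hs : SmoothSecNear C2 s x) (ht : SmoothSecNear C2 t x) :
    σ.spinorDeriv D T x (p x) (q x) (s x) (t x) = σ.derivC p q (fun y ↦ T y (s y) (t y)) x
      - T x (σ.nablaC D p q s x) (t x) - T x (s x) (σ.nablaC D p q t x) := by
  have h (a b b' : S x) : T x a (b - Complex.I • b') = T x a b - Complex.I * T x a b' := by
    rw [sub_eq_add_neg, ← neg_smul, hT.add_right x hx, hT.smul_right x hx, RingHom.id_apply]
    ring
  simp only [SpinStructure.spinorDeriv, SpinStructure.cext, hT.covDeriv_eq hx _ hs ht,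
    SpinStructure.derivC_eq, SpinStructure.nablaC_eq, hT.sub_I_smul_left hx, h, smul_eq_mul]
  ring

/-- The spinor derivative of a sesquilinear form. -/
theorem spinorDeriv_sesquilinear (hT : IsSmoothFormOn (starRingEnd ℂ) T U) (hx : x ∈ U)
    (hs : SmoothSecNear C2 s x) (ht : SmoothSecNear C2 t x) :
    σ.spinorDeriv D T x (p x) (q x) (s x) (t x) = σ.derivC p q (fun y ↦ T y (s y) (t y)) x
      - T x (σ.nablaC D p q s x) (t x) - T x (s x) (σ.nablaC D q p t x) := by
  have h (a b b' : S x) : T x a (b - Complex.I • b') = T x a b + Complex.I * T x a b' := by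
    rw [sub_eq_add_neg, ← neg_smul, hT.add_right x hx, hT.smul_right x hx, map_neg,
      Complex.conj_I, neg_neg]
  have h' (a b : S x) : T x a (-b) = -T x a b := by
    rw [← neg_one_smul ℂ, hT.smul_right x hx, map_neg, map_one, neg_one_mul]
  -- The conjugate linear argument is differentiated along `q (conj p)`; moving `i` across `vec`
  -- brings this back to the direction `p (conj q)`.
  simp only [SpinStructure.spinorDeriv, SpinStructure.cext, hT.covDeriv_eq hx _ hs ht,
    SpinStructure.derivC_eq, SpinStructure.nablaC_eq, hT.sub_I_smul_left hx, h, smul_eq_mul,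
    σ.vec_symm x (q x) (p x), σ.vec_symm x _ (p x), σ.vec_right_I_smul, map_neg, h']
  ring

variable {c : ℝ} (he : σ.IsSmoothDyadOn e U)
    (hD : σ.IsSpinConnection nabla D) (hn : IsLeviCivita g nabla)
    (hc : ∀ (x : M) (v w : TangentSpace (𝓡 4) x), ricci nabla x v w = c * g.inner x v w)
    (hΨ₀ : ∀ x ∈ U, σ.weylScalar D e 0 x = 0) (hΨ₁ : ∀ x ∈ U, σ.weylScalar D e 1 x = 0)

/-- The bridge from geometry to algebra: identities proved in the ring can be evaluated at a point
and read as statements about `∇T`. Both indices are unprimed, so `Γ` acts on both. -/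
theorem spinorDeriv_dyad_bilinear (hT : IsSmoothFormOn (RingHom.id ℂ) T U)
    {t : Fin 2 → Fin 2 → smoothFunctions U}
    (ht : ∀ k l, ∀ x : U, (t k l).1 x = T x (e k x) (e l x)) (x : U) (i j k l : Fin 2) :
    σ.spinorDeriv D T x (e i x) (e j x) (e k x) (e l x) =
      eval x ((he.spinCoefficients hD hn hc hΨ₀ hΨ₁).E i j (t k l)
        - ∑ n, ((he.spinCoefficients hD hn hc hΨ₀ hΨ₁).Γ i j k n * t n l
          + (he.spinCoefficients hD hn hc hΨ₀ hΨ₁).Γ i j l n * t k n)) := by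
  rw [hT.spinorDeriv_bilinear x.2 (he.smooth k x x.2) (he.smooth l x x.2),
    ← σ.derivation_apply he.isOpen (he.smooth i) (he.smooth j) (t k l) (ht k l) x,
    he.nablaC_eq_sum x.2, he.nablaC_eq_sum x.2]
  simp only [Fin.sum_univ_two, hT.add_left _ x.2, hT.add_right _ x.2, hT.smul_left _ x.2,
    hT.smul_right _ x.2, map_sub, map_add, map_mul, eval_apply, ht, RingHom.id_apply]
  simp only [SpinStructure.IsSmoothDyadOn.spinCoefficients, mk_apply]
  ring

theorem spinorDeriv_dyad_sesquilinear (hT : IsSmoothFormOn (starRingEnd ℂ) T U)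
    {t : Fin 2 → Fin 2 → smoothFunctions U}
    (ht : ∀ k l, ∀ x : U, (t k l).1 x = T x (e k x) (e l x)) (x : U) (i j k l : Fin 2) :
    σ.spinorDeriv D T x (e i x) (e j x) (e k x) (e l x) =
      eval x ((he.spinCoefficients hD hn hc hΨ₀ hΨ₁).covDerivComponent t i j k l) := by
  rw [hT.spinorDeriv_sesquilinear x.2 (he.smooth k x x.2) (he.smooth l x x.2),
    ← σ.derivation_apply he.isOpen (he.smooth i) (he.smooth j) (t k l) (ht k l) x,
    he.nablaC_eq_sum x.2, he.nablaC_eq_sum x.2, SpinCoefficients.covDerivComponent]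
  simp only [Fin.sum_univ_two, hT.add_left _ x.2, hT.add_right _ x.2, hT.smul_left _ x.2,
    hT.smul_right _ x.2, map_sub, map_add, map_mul, eval_apply, ht]
  simp only [SpinStructure.IsSmoothDyadOn.spinCoefficients, mk_apply]
  ring

end IsSmoothFormOn
end SpinorDerivative

/-! ### The principal spinor condition and the components of the Killing spinor -/

section PetrovType

open Filter Topology smoothFunctions

variable {M : Type*} [TopologicalSpace M] [ChartedSpace R4 M] [IsManifold (𝓡 4) ∞ M]
  {S : M → Type*} [TopologicalSpace (TotalSpace C2 S)]
  [∀ x, AddCommGroup (S x)] [∀ x, Module ℝ (S x)] [∀ x, Module ℂ (S x)]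
  [∀ x, IsScalarTower ℝ ℂ (S x)] [∀ x, TopologicalSpace (S x)]
  [∀ x, IsTopologicalAddGroup (S x)] [∀ x, ContinuousSMul ℝ (S x)]
  [FiberBundle C2 S] [VectorBundle ℝ C2 S] [VectorBundle ℂ C2 S]
  [ContMDiffVectorBundle ∞ C2 S (𝓡 4)]
  {g : LorentzMetric M} {σ : SpinStructure S g} {x : M}
  {nabla : CovariantDerivative (𝓡 4) R4 (TangentSpace (𝓡 4) : M → Type _)}
  {D : CovariantDerivative (𝓡 4) C2 S} {U : Set M} {o ι : ∀ x, S x} {φ : M → ℂ}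

namespace SpinStructure

theorem IsSpinConnection.curvatureC_linear_three (hD : σ.IsSpinConnection nabla D) (z w : ℂ)
    (a a' b b' e c : S x) : σ.curvatureC D a a' (z • b + w • b') e c =
      z • σ.curvatureC D a a' b e c + w • σ.curvatureC D a a' b' e c := by
  have hL : IsLinearMap ℝ fun u ↦ σ.complexify (fun v ↦ curvatureAt D x u v c) a a' :=
    σ.isLinearMap_complexify fun v ↦ curvatureAt_isLinearMap_left hD.isSmoothConnection v c
  rw [curvatureC_swap (a := a), curvatureC_swap (a := a), curvatureC_swap (a := a), curvatureC,
    σ.complexify_add_left hL, σ.complexify_smul_left hL, σ.complexify_smul_left hL]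
  simp only [curvatureC]
  module

theorem IsSpinConnection.curvatureC_linear_five (hD : σ.IsSpinConnection nabla D) (z w : ℂ)
    (a a' b b' c c' : S x) : σ.curvatureC D a a' b b' (z • c + w • c') =
      z • σ.curvatureC D a a' b b' c + w • σ.curvatureC D a a' b b' c' := by
  simp only [curvatureC, complexify, curvatureAt_add hD.isSmoothConnection, hD.curvatureAt_smul]
  module

theorem IsSpinConnection.weylSpinor_linear_four (hD : σ.IsSpinConnection nabla D)
    (hn : IsLeviCivita g nabla) {p q : S x} (h : σ.IsDyad p q) (z w : ℂ) (a b c d d' : S x) :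
    σ.weylSpinor nabla p q a b c (z • d + w • d') =
      z * σ.weylSpinor nabla p q a b c d + w * σ.weylSpinor nabla p q a b c d' := by
  simp only [weylSpinor, hD.curvatureSpinor_eq hn h, hD.curvatureC_linear_three,
    hD.curvatureC_linear_five, map_add, map_smul, LinearMap.add_apply, LinearMap.smul_apply,
    smul_eq_mul]
  ring

theorem IsSpinConnection.weylSpinor_linear_three (hD : σ.IsSpinConnection nabla D)
    (hn : IsLeviCivita g nabla) {p q : S x} (h : σ.IsDyad p q) (z w : ℂ) (a b c c' d : S x) :
    σ.weylSpinor nabla p q a b (z • c + w • c') d =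
      z * σ.weylSpinor nabla p q a b c d + w * σ.weylSpinor nabla p q a b c' d := by
  simp only [weylSpinor, hD.curvatureSpinor_eq hn h, hD.curvatureC_linear_three,
    hD.curvatureC_linear_five, map_add, map_smul, LinearMap.add_apply, LinearMap.smul_apply,
    smul_eq_mul]
  ring

/-- In a dyad whose first spinor is a repeated principal spinor, `Ψ_2` does not vanish. -/
theorem IsSpinConnection.weyl2_ne_zero (hD : σ.IsSpinConnection nabla D)
    (hn : IsLeviCivita g nabla) {c : ℝ}
    (hc : ∀ v w : TangentSpace (𝓡 4) x, ricci nabla x v w = c * g.inner x v w)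
    {e : Fin 2 → S x} (h : σ.IsDyad (e 0) (e 1)) (ht : σ.IsDoublePrincipal nabla (e 0) (e 1)) :
    σ.weyl2 nabla (e 0) (e 1) ≠ 0 := by
  intro h₂
  obtain ⟨h₀, a, b, hab⟩ := ht
  obtain ⟨z₀, z₁, rfl⟩ := exists_dyad_eq h a
  obtain ⟨w₀, w₁, rfl⟩ := exists_dyad_eq h b
  -- Both `Ψ_ABCD o^A o^B ι^C o^D` and `Ψ_ABCD o^A o^B o^C ι^D` are the scalar `Ψ_1`. With `Ψ_2 = 0`
  -- all components of `Ψ_ABCD o^A o^B` would then vanish.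
  have h₃ : σ.weylSpinor nabla (e 0) (e 1) (e 0) (e 0) (e 1) (e 0) = 0 := by
    rw [hD.weylSpinor_dyad hn hc h, ← h₀ (e 1), hD.weylSpinor_dyad hn hc h]
    rfl
  rw [weyl2] at h₂
  simp [hD.weylSpinor_linear_three hn h, hD.weylSpinor_linear_four hn h, h₀, h₂, h₃] at hab

/-- The minus sign off the diagonal comes from `ε(ι,o) = -1`; `o_A o_B` contributes to the `ιι`
component only. -/
theorem killingSpinor_dyad {e : Fin 2 → ∀ x, S x} (h : σ.IsDyad (e 0 x) (e 1 x)) (k l : Fin 2) :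
    σ.killingSpinor nabla (e 0) (e 1) φ x (e k x) (e l x) =
      if k = l then if k = 0 then 0 else
        -((1 / 3) * ((φ x)⁻¹ ^ 4 * σ.weyl3 nabla (e 0 x) (e 1 x)))
      else -((φ x)⁻¹ * (1 / 2)) := by
  rw [killingSpinor]
  simp only [eps_dyad (e := fun n ↦ e n x) h]
  fin_cases k <;> fin_cases l <;> simp [levi]

end SpinStructure

end PetrovType

/-! ### Derivatives of a symmetric spinor with vanishing `oo` component -/

namespace SpinCoefficients

variable {A : Type*} [CommRing A] [Algebra ℂ A] (S : SpinCoefficients A) {K₁ K₂ : A}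

/-- The components of the symmetric spinor `K_AB` with `K_00 = 0`, `K_01 = K₁`, `K_11 = K₂`. -/
def symmetricComponent (K₁ K₂ : A) (k l : Fin 2) : A :=
  if k = l then if k = 0 then 0 else K₂ else K₁

/-- The components `∇_ij K_kl` of the covariant derivative of a spinor `K_AB`. -/
def covDerivBilinear (t : Fin 2 → Fin 2 → A) (i j k l : Fin 2) : A :=
  S.E i j (t k l) - ∑ n, (S.Γ i j k n * t n l + S.Γ i j l n * t k n)

theorem covDerivBilinear_zero_zero (i j : Fin 2) :
    S.covDerivBilinear (symmetricComponent K₁ K₂) i j 0 0 = -2 * (S.Γ i j 0 1 * K₁) := by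
  simp [covDerivBilinear, symmetricComponent]
  ring

theorem covDerivBilinear_zero_one (i j : Fin 2) :
    S.covDerivBilinear (symmetricComponent K₁ K₂) i j 0 1 = S.E i j K₁ - S.Γ i j 0 1 * K₂ := by
  simp [covDerivBilinear, symmetricComponent, S.trace]

theorem covDerivBilinear_one_zero (i j : Fin 2) :
    S.covDerivBilinear (symmetricComponent K₁ K₂) i j 1 0 = S.E i j K₁ - S.Γ i j 0 1 * K₂ := by
  simp [covDerivBilinear, symmetricComponent, S.trace]

theorem covDerivBilinear_one_one (i j : Fin 2) :
    S.covDerivBilinear (symmetricComponent K₁ K₂) i j 1 1 =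
      S.E i j K₂ - 2 * (S.Γ i j 1 0 * K₁) + 2 * (S.Γ i j 0 0 * K₂) := by
  simp [covDerivBilinear, symmetricComponent, S.trace]
  ring

namespace IsProjectedKillingSpinor

variable {S}

theorem symmetrization (h : S.IsProjectedKillingSpinor K₁ K₂) (j k l : Fin 2) :
    S.covDerivBilinear (symmetricComponent K₁ K₂) 0 j k l
      + S.covDerivBilinear (symmetricComponent K₁ K₂) k j l 0
      + S.covDerivBilinear (symmetricComponent K₁ K₂) l j 0 k = 0 := by
  fin_cases k <;> fin_cases l <;>
    simp only [Fin.zero_eta, Fin.mk_one, covDerivBilinear_zero_zero, covDerivBilinear_zero_one,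
      covDerivBilinear_one_zero, covDerivBilinear_one_one, h.shear_free]
  · ring
  · linear_combination 2 * h.deriv_one j
  · linear_combination 2 * h.deriv_one j
  · linear_combination h.deriv_two j

/-- The projected Killing spinor equation trades the derivatives of `K₁` and `K₂` along `e₀` for
terms along `e₁`, which triples the terms already present. -/
theorem divergence_eq (h : S.IsProjectedKillingSpinor K₁ K₂) (k j : Fin 2) :
    S.covDerivBilinear (symmetricComponent K₁ K₂) 1 j k 0
      - S.covDerivBilinear (symmetricComponent K₁ K₂) 0 j k 1 =
      S.divergenceComponent K₁ K₂ k j := by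
  fin_cases k <;>
    simp only [Fin.zero_eta, Fin.mk_one, covDerivBilinear_zero_zero, covDerivBilinear_zero_one,
      covDerivBilinear_one_zero, covDerivBilinear_one_one, h.shear_free, divergenceComponent_zero,
      divergenceComponent_one]
  · linear_combination -h.deriv_one j
  · linear_combination -h.deriv_two j

end IsProjectedKillingSpinor
end SpinCoefficients

/-! ### From components back to spinor equations -/

section Main

open Filter Topology smoothFunctions SpinCoefficients

variable {M : Type*} [TopologicalSpace M] [ChartedSpace R4 M] [IsManifold (𝓡 4) ∞ M]
  {S : M → Type*} [TopologicalSpace (TotalSpace C2 S)]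
  [∀ x, AddCommGroup (S x)] [∀ x, Module ℝ (S x)] [∀ x, Module ℂ (S x)]
  [∀ x, IsScalarTower ℝ ℂ (S x)] [∀ x, TopologicalSpace (S x)]
  [∀ x, IsTopologicalAddGroup (S x)] [∀ x, ContinuousSMul ℝ (S x)]
  [FiberBundle C2 S] [VectorBundle ℝ C2 S] [VectorBundle ℂ C2 S]
  [ContMDiffVectorBundle ∞ C2 S (𝓡 4)]
  {g : LorentzMetric M} {σ : SpinStructure S g} {x : M}
  {nabla : CovariantDerivative (𝓡 4) R4 (TangentSpace (𝓡 4) : M → Type _)}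
  {D : CovariantDerivative (𝓡 4) C2 S} {e : Fin 2 → ∀ x, S x} {U : Set M}
  {K : ∀ x, S x → S x → ℂ} {K₁ K₂ : smoothFunctions U} {c : ℝ} {φ : M → ℂ}

namespace IsSmoothFormOn

theorem spinorDeriv_symmetric (hK : IsSmoothFormOn (RingHom.id ℂ) K U)
    (he : σ.IsSmoothDyadOn e U) (hk : ∀ k l, ∀ x : U,
      (symmetricComponent K₁ K₂ k l).1 x = K x (e k x) (e l x))
    (hD : σ.IsSpinConnection nabla D) (hn : IsLeviCivita g nabla)
    (hc : ∀ (x : M) (v w : TangentSpace (𝓡 4) x), ricci nabla x v w = c * g.inner x v w)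
    (hΨ₀ : ∀ x ∈ U, σ.weylScalar D e 0 x = 0) (hΨ₁ : ∀ x ∈ U, σ.weylScalar D e 1 x = 0)
    (x : U) (i j k l : Fin 2) : σ.spinorDeriv D K x (e i x) (e j x) (e k x) (e l x) =
      eval x ((he.spinCoefficients hD hn hc hΨ₀ hΨ₁).covDerivBilinear
        (symmetricComponent K₁ K₂) i j k l) :=
  hK.spinorDeriv_dyad_bilinear he hD hn hc hΨ₀ hΨ₁ hk x i j k l

theorem projectedKillingSpinorEq (hK : IsSmoothFormOn (RingHom.id ℂ) K U)
    (he : σ.IsSmoothDyadOn e U) (hk : ∀ k l, ∀ x : U,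
      (symmetricComponent K₁ K₂ k l).1 x = K x (e k x) (e l x))
    (hD : σ.IsSpinConnection nabla D) (hn : IsLeviCivita g nabla)
    (hc : ∀ (x : M) (v w : TangentSpace (𝓡 4) x), ricci nabla x v w = c * g.inner x v w)
    (hΨ₀ : ∀ x ∈ U, σ.weylScalar D e 0 x = 0) (hΨ₁ : ∀ x ∈ U, σ.weylScalar D e 1 x = 0)
    (h : (he.spinCoefficients hD hn hc hΨ₀ hΨ₁).IsProjectedKillingSpinor K₁ K₂) (hx : x ∈ U) :
    σ.ProjectedKillingSpinorEq D (e 0) K x := by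
  intro a b d
  have key (j k l : Fin 2) : σ.spinorDeriv D K x (e 0 x) (e j x) (e k x) (e l x)
      + σ.spinorDeriv D K x (e k x) (e j x) (e l x) (e 0 x)
      + σ.spinorDeriv D K x (e l x) (e j x) (e 0 x) (e k x) = 0 := by
    have h₁ := congrArg (eval ⟨x, hx⟩) (h.symmetrization j k l)
    simpa only [map_add, map_zero,
      ← hK.spinorDeriv_symmetric he hk hD hn hc hΨ₀ hΨ₁ ⟨x, hx⟩] using h₁
  -- Both sides are multilinear, conjugate linear in the primed spinor `a`, so the eight dyad
  -- components suffice; `a₀` and `a₁` enter through their conjugates.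
  obtain ⟨a₀, a₁, rfl⟩ := SpinStructure.exists_dyad_eq (e := fun n ↦ e n x) (he.dyad x hx) a
  obtain ⟨b₀, b₁, rfl⟩ := SpinStructure.exists_dyad_eq (e := fun n ↦ e n x) (he.dyad x hx) b
  obtain ⟨d₀, d₁, rfl⟩ := SpinStructure.exists_dyad_eq (e := fun n ↦ e n x) (he.dyad x hx) d
  simp only [hK.spinorDeriv_add_one hx, hK.spinorDeriv_smul_one hx, hK.spinorDeriv_add_two hx,
    hK.spinorDeriv_smul_two hx, hK.spinorDeriv_add_three hx, spinorDeriv_smul_three hD hK hx,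
    hK.spinorDeriv_add_four hx, spinorDeriv_smul_four hD hK hx, RingHom.id_apply]
  linear_combination (1 / 3) * (conj a₀ * (b₀ * d₀ * key 0 0 0 + b₀ * d₁ * key 0 0 1
    + b₁ * d₀ * key 0 1 0 + b₁ * d₁ * key 0 1 1) + conj a₁ * (b₀ * d₀ * key 1 0 0
    + b₀ * d₁ * key 1 0 1 + b₁ * d₀ * key 1 1 0 + b₁ * d₁ * key 1 1 1))

theorem divergence_dyad (hK : IsSmoothFormOn (RingHom.id ℂ) K U)
    (he : σ.IsSmoothDyadOn e U) (hk : ∀ k l, ∀ x : U,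
      (symmetricComponent K₁ K₂ k l).1 x = K x (e k x) (e l x))
    (hD : σ.IsSpinConnection nabla D) (hn : IsLeviCivita g nabla)
    (hc : ∀ (x : M) (v w : TangentSpace (𝓡 4) x), ricci nabla x v w = c * g.inner x v w)
    (hΨ₀ : ∀ x ∈ U, σ.weylScalar D e 0 x = 0) (hΨ₁ : ∀ x ∈ U, σ.weylScalar D e 1 x = 0)
    (h : (he.spinCoefficients hD hn hc hΨ₀ hΨ₁).IsProjectedKillingSpinor K₁ K₂) (k l : Fin 2)
    (x : U) : ((he.spinCoefficients hD hn hc hΨ₀ hΨ₁).divergenceComponent K₁ K₂ k l).1 x =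
      σ.divergence D (e 0) (e 1) K x (e k x) (e l x) := by
  simp only [SpinStructure.divergence, epsContract, ← h.divergence_eq, ← eval_apply, map_sub,
    hK.spinorDeriv_symmetric he hk hD hn hc hΨ₀ hΨ₁]

/-- Needed because `ξ` is differentiated once more. Its dyad components are elements of the ring by
`divergence_dyad`, hence smooth. -/
theorem isSmoothFormOn_divergence (hK : IsSmoothFormOn (RingHom.id ℂ) K U)
    (he : σ.IsSmoothDyadOn e U) (hk : ∀ k l, ∀ x : U,
      (symmetricComponent K₁ K₂ k l).1 x = K x (e k x) (e l x))
    (hD : σ.IsSpinConnection nabla D) (hn : IsLeviCivita g nabla)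
    (hc : ∀ (x : M) (v w : TangentSpace (𝓡 4) x), ricci nabla x v w = c * g.inner x v w)
    (hΨ₀ : ∀ x ∈ U, σ.weylScalar D e 0 x = 0) (hΨ₁ : ∀ x ∈ U, σ.weylScalar D e 1 x = 0)
    (h : (he.spinCoefficients hD hn hc hΨ₀ hΨ₁).IsProjectedKillingSpinor K₁ K₂) :
    IsSmoothFormOn (starRingEnd ℂ) (σ.divergence D (e 0) (e 1) K) U := by
  refine he.isSmoothFormOn Complex.conj_ofReal (fun f x hf ↦ hf.conj)
    (fun x hx a a' b ↦ ?_) (fun x hx z a b ↦ ?_) (fun x hx a b b' ↦ ?_) (fun x hx z a b ↦ ?_)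
    fun k l x hx ↦ ?_
  · simp only [SpinStructure.divergence, epsContract, hK.spinorDeriv_add_three hx]; ring
  · simp only [SpinStructure.divergence, epsContract, spinorDeriv_smul_three hD hK hx]; ring
  · simp only [SpinStructure.divergence, epsContract, hK.spinorDeriv_add_two hx]; ring
  · simp only [SpinStructure.divergence, epsContract, hK.spinorDeriv_smul_two hx]; ring
  · exact (rep_smooth _ x hx).congr (rep_eventuallyEq he.isOpen _
      (hK.divergence_dyad he hk hD hn hc hΨ₀ hΨ₁ h k l) ⟨x, hx⟩).symm

theorem projectedKillingEq (hK : IsSmoothFormOn (RingHom.id ℂ) K U)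
    (he : σ.IsSmoothDyadOn e U) (hk : ∀ k l, ∀ x : U,
      (symmetricComponent K₁ K₂ k l).1 x = K x (e k x) (e l x))
    (hD : σ.IsSpinConnection nabla D) (hn : IsLeviCivita g nabla)
    (hc : ∀ (x : M) (v w : TangentSpace (𝓡 4) x), ricci nabla x v w = c * g.inner x v w)
    (hΨ₀ : ∀ x ∈ U, σ.weylScalar D e 0 x = 0) (hΨ₁ : ∀ x ∈ U, σ.weylScalar D e 1 x = 0)
    (h : (he.spinCoefficients hD hn hc hΨ₀ hΨ₁).IsProjectedKillingSpinor K₁ K₂) (hx : x ∈ U) :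
    σ.ProjectedKillingEq D (e 0) (σ.divergence D (e 0) (e 1) K) x := by
  intro a b d
  have hξ := hK.isSmoothFormOn_divergence he hk hD hn hc hΨ₀ hΨ₁ h
  have key (j k l : Fin 2) :
      σ.spinorDeriv D (σ.divergence D (e 0) (e 1) K) x (e 0 x) (e j x) (e k x) (e l x)
      + σ.spinorDeriv D (σ.divergence D (e 0) (e 1) K) x (e k x) (e l x) (e 0 x) (e j x) = 0 := by
    have h₁ := congrArg (eval ⟨x, hx⟩) (SpinCoefficients.projectedKilling h j k l)
    simpa only [map_add, map_zero, ← hξ.spinorDeriv_dyad_sesquilinear he hD hn hc hΨ₀ hΨ₁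
      (hK.divergence_dyad he hk hD hn hc hΨ₀ hΨ₁ h) ⟨x, hx⟩] using h₁
  obtain ⟨a₀, a₁, rfl⟩ := SpinStructure.exists_dyad_eq (e := fun n ↦ e n x) (he.dyad x hx) a
  obtain ⟨b₀, b₁, rfl⟩ := SpinStructure.exists_dyad_eq (e := fun n ↦ e n x) (he.dyad x hx) b
  obtain ⟨d₀, d₁, rfl⟩ := SpinStructure.exists_dyad_eq (e := fun n ↦ e n x) (he.dyad x hx) d
  simp only [hξ.spinorDeriv_add_one hx, hξ.spinorDeriv_smul_one hx, hξ.spinorDeriv_add_two hx,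
    hξ.spinorDeriv_smul_two hx, hξ.spinorDeriv_add_three hx, spinorDeriv_smul_three hD hξ hx,
    hξ.spinorDeriv_add_four hx, spinorDeriv_smul_four hD hξ hx]
  linear_combination conj a₀ * (b₀ * conj d₀ * key 0 0 0 + b₀ * conj d₁ * key 0 0 1
    + b₁ * conj d₀ * key 0 1 0 + b₁ * conj d₁ * key 0 1 1) + conj a₁ * (b₀ * conj d₀ * key 1 0 0
    + b₀ * conj d₁ * key 1 0 1 + b₁ * conj d₀ * key 1 1 0 + b₁ * conj d₁ * key 1 1 1)

end IsSmoothFormOn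

namespace SpinStructure.IsSmoothDyadOn

theorem projected_equations (he : σ.IsSmoothDyadOn e U)
    (hD : σ.IsSpinConnection nabla D) (hn : IsLeviCivita g nabla)
    (hc : ∀ (x : M) (v w : TangentSpace (𝓡 4) x), ricci nabla x v w = c * g.inner x v w)
    (ht : ∀ x ∈ U, σ.IsDoublePrincipal nabla (e 0 x) (e 1 x))
    (hφ : ∀ x ∈ U, SmoothFunNear φ x) (hφ3 : ∀ x ∈ U, φ x ^ 3 = σ.weyl2 nabla (e 0 x) (e 1 x)) :
    (∀ x ∈ U, σ.ProjectedKillingSpinorEq D (e 0) (σ.killingSpinor nabla (e 0) (e 1) φ) x) ∧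
    (∀ x ∈ U, σ.ProjectedKillingEq D (e 0)
      (σ.divergence D (e 0) (e 1) (σ.killingSpinor nabla (e 0) (e 1) φ)) x) := by
  have hw (i j k l : Fin 2) {x : M} (hx : x ∈ U) :=
    hD.weylSpinor_dyad hn (hc x) (e := fun n ↦ e n x) (he.dyad x hx) i j k l
  have hΨ₀ : ∀ x ∈ U, σ.weylScalar D e 0 x = 0 := fun x hx ↦
    (hw 0 0 0 0 hx).symm.trans ((ht x hx).1 _)
  have hΨ₁ : ∀ x ∈ U, σ.weylScalar D e 1 x = 0 := fun x hx ↦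
    (hw 0 0 0 1 hx).symm.trans ((ht x hx).1 _)
  have hΨ₂ : ∀ x ∈ U, φ x ^ 3 = σ.weylScalar D e 2 x := fun x hx ↦
    (hφ3 x hx).trans (hw 0 0 1 1 hx)
  have hΨ₃ : ∀ x ∈ U, σ.weyl3 nabla (e 0 x) (e 1 x) = σ.weylScalar D e 3 x := fun x hx ↦
    hw 0 1 1 1 hx
  -- Multiplicity exactly two means `Ψ_2 ≠ 0`, so its cube root can be inverted in the ring.
  have hφ₀ : ∀ x ∈ U, φ x ≠ 0 := fun x hx h₀ ↦
    hD.weyl2_ne_zero hn (hc x) (e := fun n ↦ e n x) (he.dyad x hx) (ht x hx)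
      ((hφ3 x hx).symm.trans (by simp [h₀]))
  let C := he.spinCoefficients hD hn hc hΨ₀ hΨ₁
  let p : smoothFunctions U := smoothFunctions.mk (fun x ↦ (φ x)⁻¹) fun x hx ↦
    (hφ x hx).inv (by filter_upwards [he.isOpen.mem_nhds hx] with y hy using hφ₀ y hy)
  -- The components `K_01` and `K_11` from `killingSpinor_dyad`, with `p = Ψ_2^(-1/3)`.
  let K₁ : smoothFunctions U := algebraMap ℂ _ (-(1 / 2)) * p
  let K₂ : smoothFunctions U := algebraMap ℂ _ (-(1 / 3)) * (p ^ 4 * C.Ψ 3)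
  have hp : p ^ 3 * C.Ψ 2 = 1 := smoothFunctions.ext fun x ↦ by
    change (φ x)⁻¹ ^ 3 * σ.weylScalar D e 2 x = 1
    rw [← hΨ₂ x x.2, ← mul_pow, inv_mul_cancel₀ (hφ₀ x x.2), one_pow]
  have h₁ : 2 * K₁ = -p := smoothFunctions.ext fun x ↦ by
    change 2 * (-(1 / 2) * (φ x)⁻¹) = -(φ x)⁻¹
    ring
  have h₂ : 3 * K₂ = -(p ^ 4 * C.Ψ 3) := smoothFunctions.ext fun x ↦ by
    change 3 * (-(1 / 3) * ((φ x)⁻¹ ^ 4 * σ.weylScalar D e 3 x)) =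
      -((φ x)⁻¹ ^ 4 * σ.weylScalar D e 3 x)
    ring
  have h := C.isProjectedKillingSpinor hp h₁ h₂
  have hk (k l : Fin 2) (x : U) : (symmetricComponent K₁ K₂ k l).1 x =
      σ.killingSpinor nabla (e 0) (e 1) φ x (e k x) (e l x) := by
    rw [killingSpinor_dyad (he.dyad x x.2), hΨ₃ x x.2, symmetricComponent]
    split_ifs
    · rfl
    · change -(1 / 3) * ((φ x)⁻¹ ^ 4 * σ.weylScalar D e 3 x) = _
      ring
    · change -(1 / 2) * (φ x)⁻¹ = _
      ring
  have hK : IsSmoothFormOn (RingHom.id ℂ) (σ.killingSpinor nabla (e 0) (e 1) φ) U := by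
    refine he.isSmoothFormOn (fun _ ↦ rfl) (fun f x hf ↦ hf)
      (fun x hx a a' b ↦ ?_) (fun x hx z a b ↦ ?_) (fun x hx a b b' ↦ ?_) (fun x hx z a b ↦ ?_)
      fun k l x hx ↦ ?_
    · simp only [killingSpinor, map_add]; ring
    · simp only [killingSpinor, map_smul, smul_eq_mul]; ring
    · simp only [killingSpinor, map_add]; ring
    · simp only [killingSpinor, map_smul, smul_eq_mul, RingHom.id_apply]; ring
    · exact (rep_smooth _ x hx).congr (rep_eventuallyEq he.isOpen _ (hk k l) ⟨x, hx⟩).symm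
  exact ⟨fun x hx ↦ hK.projectedKillingSpinorEq he hk hD hn hc hΨ₀ hΨ₁ h hx,
    fun x hx ↦ hK.projectedKillingEq he hk hD hn hc hΨ₀ hΨ₁ h hx⟩

end SpinStructure.IsSmoothDyadOn

end Main

end

theorem theorem1
    {M : Type*} [TopologicalSpace M] [ChartedSpace R4 M] [IsManifold (𝓡 4) ∞ M]
    -- the smooth complex vector bundle `S` of rank two
    {S : M → Type*} [TopologicalSpace (TotalSpace C2 S)]
    [∀ x, AddCommGroup (S x)] [∀ x, Module ℝ (S x)] [∀ x, Module ℂ (S x)]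
    [∀ x, IsScalarTower ℝ ℂ (S x)] [∀ x, TopologicalSpace (S x)]
    [∀ x, IsTopologicalAddGroup (S x)] [∀ x, ContinuousSMul ℝ (S x)]
    [FiberBundle C2 S] [VectorBundle ℝ C2 S] [VectorBundle ℂ C2 S]
    [ContMDiffVectorBundle ∞ C2 S (𝓡 4)]
    -- the Einstein metric with its Levi-Civita connection
    (g : LorentzMetric M)
    (nabla : CovariantDerivative (𝓡 4) R4 (TangentSpace (𝓡 4) : M → Type _))
    (hnabla : IsLeviCivita g nabla) (hg : IsEinstein g nabla)
    -- the spinor structure with its covariant derivative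
    (σ : SpinStructure S g) (D : CovariantDerivative (𝓡 4) C2 S)
    (hD : σ.IsSpinConnection nabla D)
    -- a smooth spin dyad on an open set, with `o` a repeated principal spinor
    (U : Set M) (hU : IsOpen U) (o ι : ∀ x, S x)
    (ho : SmoothSpinorOn o U) (hι : SmoothSpinorOn ι U)
    (hdyad : ∀ x ∈ U, σ.IsDyad (o x) (ι x))
    (htype : ∀ x ∈ U, σ.IsDoublePrincipal nabla (o x) (ι x))
    -- a smooth branch of the cube root of `Ψ_2`
    (φ : M → ℂ) (hφ : ContMDiffOn (𝓡 4) 𝓘(ℝ, ℂ) ∞ φ U)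
    (hφ3 : ∀ x ∈ U, φ x ^ 3 = σ.weyl2 nabla (o x) (ι x)) :
    (∀ x ∈ U, σ.ProjectedKillingSpinorEq D o (σ.killingSpinor nabla o ι φ) x) ∧
    (∀ x ∈ U, σ.ProjectedKillingEq D o
      (σ.divergence D o ι (σ.killingSpinor nabla o ι φ)) x) := by
  obtain ⟨c, hc⟩ := hg
  have he : σ.IsSmoothDyadOn ![o, ι] U := by
    refine ⟨hU, fun k x hx ↦ ?_, hdyad⟩
    fin_cases k
    exacts [.of_contMDiffOn ho hU hx, .of_contMDiffOn hι hU hx]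
  exact he.projected_equations hD hnabla hc htype
    (fun x hx ↦ smoothFunNear_of_contMDiffOn hφ hU hx) hφ3
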